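/- Let $O\subset\mathbb R^2$ be the regular octagon centred at the origin with two horizontal sides, with pairs of opposite sides labelled $A,B,C,D$ (going clockwise from the top side, $A,B,C,D,A,B,C,D$). Let $S_O$ be the translation surface obtained by gluing opposite sides of $O$ by translations, with its single singular point (the image of the vertices). **Words.** For $j=0,\dots,7$ let $\mathscr D_j$ be the transition diagram for directions in $[j\pi/8,(j+1)\pi/8]$: $\mathscr D_0$ has the edges $A\rightleftarrows D\rightleftarrows B\rightleftarrows C$ and a loop at $C$, and $L\to L'$ is an edge of $\mathscr D_j$ iff $\pi_jL\to\pi_jL'$ is an edge of $\mathscr D_0$, where $\pi_0=\mathrm{id}$, $\pi_1=(AD)(BC)$, $\pi_2=(ABCD)$, $\pi_3=(AC)$, $\pi_4=(AC)(BD)$, $\pi_5=(AB)(CD)$, $\pi_6=(ADCB)$, $\pi_7=(BD)$. A bi-infinite word is admissible if it is a path in some $\mathscr D_j$. The derived sequence $w'$ of an admissible word $w\in\{A,B,C,D\}^{\mathbb Z}$ is the bi-infinite word obtained by keeping only the letters of $w$ that are preceded and followed by the same letter; put $w^{(0)}=w$ and $w^{(k+1)}=(w^{(k)})'$. Bi-infinite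 words are considered up to shift. **Reflections.** Let $\gamma=\begin{pmatrix}-1&2(1+\sqrt2)\\0&1\end{pmatrix}$. For $i=0,\dots,7$ let $\nu_i$ be the following linear isometry of $O$, which maps the sector of lines with angle in $[i\pi/8,(i+1)\pi/8]$ to the sector $[0,\pi/8]$: for $i$ even, the rotation by $-i\pi/8$; for $i$ odd, the reflection in the line of angle $(i+1)\pi/16$. Put $\gamma_i=\nu_i^{-1}\gamma\nu_i$. A matrix $\begin{pmatrix}a&b\\c&d\end{pmatrix}$ of determinant $\pm1$ acts on the right on the upper half plane $\mathbb H$ by $z\mapsto\frac{az+c}{bz+d}$ if its determinant is $1$ and by $z\mapsto\frac{a\bar z+c}{b\bar z+d}$ if it is $-1$. Let $E_0$ be the geodesic fixed pointwise by $\gamma$, and $E_i=E_0\nu_i$; then $E_0,\dots,E_7$ are the sides of an ideal octagon $\mathscr O$ containing the point $\mathrm i=\sqrt{-1}$, and the $\gamma_i$ are the hyperbolic reflections in them. The images of $\mathscr O$ under the group generated by $\gamma_0,\dots,\gamma_7$ tessellate $\mathbb H$; give $E_i$ the label $i$ and transport the labels to all sides of the tessellation by this group. **Teichmüller cutting sequence.**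 For a direction $\theta$ let $r_\theta$ be the geodesic ray in $\mathbb H$ consisting of the images of $\mathrm i$ under the right action of $g^\theta_t=\rho_{\pi/2-\theta}^{-1}\,\mathrm{diag}(e^{t/2},e^{-t/2})\,\rho_{\pi/2-\theta}$, $t\ge0$, where $\rho_\varphi$ is the counterclockwise rotation by $\varphi$. Let $c(r_\theta)$ be the (finite or infinite) sequence of labels of the sides of the tessellation that $r_\theta$ crosses, in order. If it starts with $s_0,\dots,s_{k-1}$, put $\gamma^{(k)}=\gamma_{s_0}\gamma_{s_1}\cdots\gamma_{s_{k-1}}$ (and $\gamma^{(0)}=I$). **Proposition.** Let $\tau$ be a bi-infinite linear trajectory on $S_O$ in direction $\theta$ that does not hit the singular point, let $w$ be its cutting sequence with respect to the labelled sides of $O$, and let $k\ge0$ be such that $c(r_\theta)$ has at least $k$ entries. Then the $k$-th derived sequence $w^{(k)}$ exists, there is a unique affine automorphism $\Psi_{\gamma^{(k)}}$ of $S_O$ with derivative $\gamma^{(k)}$, and $w^{(k)}$ is the cutting sequence of the same trajectory $\tau$ with respect to the sides of $\Psi_{\gamma^{(k)}}O$, where the image under $\Psi_{\gamma^{(k)}}$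 of a side of $O$ carries the label of that side. -/

import Mathlib

open Matrix UpperHalfPlane

namespace OctagonFlow

noncomputable section

/-! ### The regular octagon and the translation surface obtained from it -/

/-- The Euclidean plane in linear coordinates. -/
abbrev Plane : Type := Fin 2 → ℝ

/-- The four labels of the pairs of opposite sides of the octagon. -/
inductive Letter : Type
  | A
  | B
  | C
  | D

/-- The outward unit normals of the sides of the octagon: the `i`-th one makes the angle
`i π / 4` with the horizontal (so the sides with `i = 2, 6` are the horizontal ones). -/
def normal (i : Fin 8) : Plane :=
  ![Real.cos ((i : ℕ) * Real.pi / 4), Real.sin ((i : ℕ) * Real.pi / 4)]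

/-- The (closed) regular octagon, centred at the origin, with inradius `1` and with two
horizontal sides. -/
def octagon : Set Plane := {x | ∀ i : Fin 8, normal i ⬝ᵥ x ≤ 1}

/-- The `i`-th closed side of the octagon. -/
def side (i : Fin 8) : Set Plane := {x | x ∈ octagon ∧ normal i ⬝ᵥ x = 1}

/-- The label of each side; opposite sides carry the same letter.  The horizontal sides are
labelled `A`, and going clockwise from the top side one reads `A, B, C, D, A, B, C, D`. -/
def sideLabel : Fin 8 → Letter :=
  ![.C, .B, .A, .D, .C, .B, .A, .D]

/-- The gluing: a point of the `i`-th side is identified with its translate on the opposite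
side. -/
def Glue (x y : octagon) : Prop :=
  ∃ i : Fin 8, (x : Plane) ∈ side i ∧ (y : Plane) = (x : Plane) - (2 : ℝ) • normal i

/-- The surface `S_O`, with the quotient topology: the quotient of the octagon by the
equivalence relation generated by the gluing. -/
abbrev OctagonSurface : Type := Quot Glue

/-- The image in the surface of a point of the octagon. -/
def toSurface (x : octagon) : OctagonSurface := Quot.mk Glue x

/-- The set of singular points of the surface: the image of the vertices of the octagon (all
vertices are identified to a single point, of cone angle `6π`). -/
def singularSet : Set OctagonSurface :=
  {p | ∃ (x : octagon) (i j : Fin 8),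
    i ≠ j ∧ (x : Plane) ∈ side i ∧ (x : Plane) ∈ side j ∧ toSurface x = p}

/-- The union in the surface of the sides of the octagon labelled by `L`. -/
def labelledSide (L : Letter) : Set OctagonSurface :=
  {p | ∃ (x : octagon) (i : Fin 8), sideLabel i = L ∧ (x : Plane) ∈ side i ∧ toSurface x = p}

/-- `Step p u q`: the point `q` is reached from `p` by a straight segment with displacement
vector `u` that stays inside the octagon.  For `p` outside the singular set and `u` small there
is exactly one such `q`, so that `u ↦ q` is the inverse of a chart of the translation structure
centred at `p`. -/
def Step (p : OctagonSurface) (u : Plane) (q : OctagonSurface) : Prop :=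
  ∃ x y : octagon, toSurface x = p ∧ toSurface y = q ∧ (y : Plane) = (x : Plane) + u

/-! ### Linear trajectories, affine automorphisms, cutting sequences -/

/-- A bi-infinite linear trajectory with velocity vector `v`: it never meets the singular set
and in the charts of the translation structure it moves with constant velocity `v`. -/
def IsLinearTrajectory (v : Plane) (τ : ℝ → OctagonSurface) : Prop :=
  (∀ t, τ t ∉ singularSet) ∧
  ∀ t, ∃ ε > 0, ∀ h : ℝ, |h| < ε → Step (τ t) (h • v) (τ (t + h))

/-- `Ψ` is an affine automorphism of the surface with derivative `M`: a homeomorphism which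
preserves the singular set and which away from it has the form `p + u ↦ Ψ p + M u` in the charts
of the translation structure. -/
def IsAffineAutomorphism (Ψ : OctagonSurface ≃ₜ OctagonSurface) (M : GL (Fin 2) ℝ) : Prop :=
  Ψ '' singularSet = singularSet ∧
  ∀ p, p ∉ singularSet → ∃ ε > 0, ∀ (u : Plane) (q : OctagonSurface), ‖u‖ < ε →
    Step p u q → Step (Ψ p) ((M : Matrix (Fin 2) (Fin 2) ℝ) *ᵥ u) (Ψ q)

/-- `w` is the cutting sequence of the path `τ` with respect to a family of labelled sides: the
times at which `τ` meets one of the sides are enumerated increasingly by `ℤ`, and `w` lists the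
labels of the sides that are met.  (As a bi-infinite word, `w` is determined up to a shift.) -/
def IsCuttingSequence (sides : Letter → Set OctagonSurface) (τ : ℝ → OctagonSurface)
    (w : ℤ → Letter) : Prop :=
  ∃ t : ℤ → ℝ, StrictMono t ∧ Set.range t = {s | ∃ L, τ s ∈ sides L} ∧
    ∀ n, τ (t n) ∈ sides (w n)

/-- The sides of the image of the octagon under `Ψ`, with the labelling induced by `Ψ`. -/
def inducedSide (Ψ : OctagonSurface ≃ₜ OctagonSurface) (L : Letter) : Set OctagonSurface :=
  Ψ '' labelledSide L

/-! ### Admissible words and derivation -/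

/-- The edges of the transition diagram `𝒟₀`, belonging to directions in `[0, π/8]`:
`A ⇄ D ⇄ B ⇄ C`, with a loop at `C`. -/
inductive BaseEdge : Letter → Letter → Prop
  | ad : BaseEdge .A .D
  | da : BaseEdge .D .A
  | db : BaseEdge .D .B
  | bd : BaseEdge .B .D
  | bc : BaseEdge .B .C
  | cb : BaseEdge .C .B
  | cc : BaseEdge .C .C

/-- The permutations `π₀ = id, π₁ = (AD)(BC), π₂ = (ABCD), π₃ = (AC), π₄ = (AC)(BD),
π₅ = (AB)(CD), π₆ = (ADCB), π₇ = (BD)` by which the isometries `ν_j` permute the labels. -/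
def relabel (j : Fin 8) : Letter → Letter
  | .A => ![.A, .D, .B, .C, .C, .B, .D, .A] j
  | .B => ![.B, .C, .C, .B, .D, .A, .A, .D] j
  | .C => ![.C, .B, .D, .A, .A, .D, .B, .C] j
  | .D => ![.D, .A, .A, .D, .B, .C, .C, .B] j

/-- The edges of the transition diagram `𝒟_j`, belonging to directions in
`[j π/8, (j+1) π/8]`. -/
def DiagramEdge (j : Fin 8) (a b : Letter) : Prop := BaseEdge (relabel j a) (relabel j b)

/-- A bi-infinite word is admissible if it is an infinite path on one of the diagrams. -/
def Admissible (w : ℤ → Letter) : Prop :=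
  ∃ j : Fin 8, ∀ n, DiagramEdge j (w n) (w (n + 1))

/-- `w'` is the derived sequence of the admissible bi-infinite word `w`: it is obtained by
keeping only the sandwiched letters of `w`, i.e. those that are preceded and followed by one and
the same letter.  (Bi-infinite words are considered up to shift.) -/
def IsDerived (w w' : ℤ → Letter) : Prop :=
  Admissible w ∧ ∃ e : ℤ → ℤ, StrictMono e ∧ Set.range e = {n | w (n - 1) = w (n + 1)} ∧
    ∀ n, w' n = w (e n)

/-- `v` is the `k`-th derived sequence `w^{(k)}` of `w` (up to shift). -/
def IsIteratedDerived : ℕ → (ℤ → Letter) → (ℤ → Letter) → Prop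
  | 0, w, v => ∃ m : ℤ, ∀ n, v n = w (n + m)
  | k + 1, w, v => ∃ u, IsIteratedDerived k w u ∧ IsDerived u v

/-! ### The Veech group elements -/

/-- The linear part `γ` of the basic renormalization move. -/
def gammaGL : GL (Fin 2) ℝ :=
  .mkOfDetNeZero !![-1, 2 * (1 + √2); 0, 1] (by simp [Matrix.det_fin_two])

/-- The isometry `ν_i` of the octagon, which maps the sector of lines with angle in
`[i π/8, (i+1) π/8]` to the sector `[0, π/8]`. -/
def nuMatrix (i : Fin 8) : Matrix (Fin 2) (Fin 2) ℝ :=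
  ![!![1, 0; 0, 1],
    !![1 / √2, 1 / √2; 1 / √2, -(1 / √2)],
    !![1 / √2, 1 / √2; -(1 / √2), 1 / √2],
    !![0, 1; 1, 0],
    !![0, 1; -1, 0],
    !![-(1 / √2), 1 / √2; 1 / √2, 1 / √2],
    !![-(1 / √2), 1 / √2; -(1 / √2), -(1 / √2)],
    !![-1, 0; 0, 1]] i

theorem nuMatrix_det_ne_zero (i : Fin 8) : (nuMatrix i).det ≠ 0 := by
  have h : (√2 : ℝ)⁻¹ * (√2)⁻¹ = 1 / 2 := by
    rw [← mul_inv, Real.mul_self_sqrt (by norm_num)]; norm_num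
  fin_cases i <;> simp [nuMatrix, Matrix.det_fin_two, h] <;> norm_num

/-- `ν_i` as an invertible matrix. -/
def nuGL (i : Fin 8) : GL (Fin 2) ℝ := .mkOfDetNeZero (nuMatrix i) (nuMatrix_det_ne_zero i)

/-- `γ_i = ν_i⁻¹ γ ν_i`. -/
def gammaSide (i : Fin 8) : GL (Fin 2) ℝ := (nuGL i)⁻¹ * gammaGL * nuGL i

/-- `γ^{(k)} = γ_{s_0} γ_{s_1} ⋯ γ_{s_{k-1}}`. -/
def gammaProd {k : ℕ} (s : Fin k → Fin 8) : GL (Fin 2) ℝ :=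
  (List.ofFn fun j => gammaSide (s j)).prod

/-! ### The Teichmüller disk, the ideal octagon tessellation, Teichmüller cutting sequences

The upper half plane is the Teichmüller disk of `S_O`: the marked surface given by the matrix
with rows `(a, b)` and `(c, d)` is represented by `(a i + c) / (b i + d)` or by its complex
conjugate, whichever is in the upper half plane.  This is the image of the base point `i` under
the right action below. -/

/-- The transpose of an invertible matrix. -/
def transposeGL (M : GL (Fin 2) ℝ) : GL (Fin 2) ℝ :=
  .mkOfDetNeZero (M : Matrix (Fin 2) (Fin 2) ℝ)ᵀ (by
    rw [Matrix.det_transpose]; exact M.det.ne_zero)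

/-- The right action of matrices on the upper half plane: the matrix with rows `(a, b)` and
`(c, d)` maps `z` to `(a z + c) / (b z + d)` if its determinant is positive, and to
`(a z̄ + c) / (b z̄ + d)` if its determinant is negative.  It is expressed through the usual left
action of the transposed matrix. -/
def rightAct (z : ℍ) (M : GL (Fin 2) ℝ) : ℍ := transposeGL M • z

/-- The point of the Teichmüller disk that represents the marked surface `η · S_O`. -/
def diskPoint (η : GL (Fin 2) ℝ) : ℍ := rightAct UpperHalfPlane.I η

/-- The counterclockwise rotation `ρ_φ`. -/
def rotation (φ : ℝ) : GL (Fin 2) ℝ :=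
  .mkOfDetNeZero !![Real.cos φ, -Real.sin φ; Real.sin φ, Real.cos φ] (by
    have h := Real.cos_sq_add_sin_sq φ
    rw [Matrix.det_fin_two_of]
    nlinarith)

/-- The Teichmüller flow `g_t = diag(e^{t/2}, e^{-t/2})`. -/
def teichFlow (t : ℝ) : GL (Fin 2) ℝ :=
  .mkOfDetNeZero !![Real.exp (t / 2), 0; 0, Real.exp (-t / 2)] (by
    rw [Matrix.det_fin_two_of]
    have h1 := Real.exp_pos (t / 2)
    have h2 := Real.exp_pos (-t / 2)
    have h3 := mul_pos h1 h2
    linarith)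

/-- `g_t^θ = ρ_{π/2-θ}⁻¹ g_t ρ_{π/2-θ}`, which for `t > 0` contracts the direction `θ`. -/
def teichFlowDir (θ t : ℝ) : GL (Fin 2) ℝ :=
  (rotation (Real.pi / 2 - θ))⁻¹ * teichFlow t * rotation (Real.pi / 2 - θ)

/-- The Teichmüller geodesic ray `r_θ` (for `t ≥ 0`), which starts at the base point. -/
def teichRay (θ t : ℝ) : ℍ := diskPoint (teichFlowDir θ t)

/-- The side `E₀` of the ideal octagon: the hyperbolic geodesic (with endpoints `0` and
`-tan (π/8)`) that is fixed pointwise by the hyperbolic reflection `γ`. -/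
def idealSideZero : Set ℍ := {z | rightAct z gammaGL = z}

/-- The sides `E_i = E₀ ν_i` of the ideal octagon `𝒪` around the base point. -/
def idealSide (i : Fin 8) : Set ℍ := (fun z => rightAct z (nuGL i)) '' idealSideZero

/-- The group generated by the hyperbolic reflections `γ_i` in the sides of the ideal octagon. -/
def reflectionGroup : Subgroup (GL (Fin 2) ℝ) := Subgroup.closure (Set.range gammaSide)

/-- The union of the sides with label `i` of the tessellation of the Teichmüller disk by ideal
octagons: the side `E_i` of `𝒪` has label `i`, and the labelling is transported by the right
action of the group generated by the reflections in the sides of `𝒪`. -/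
def tessellationSide (i : Fin 8) : Set ℍ :=
  {z | ∃ g ∈ reflectionGroup, z ∈ (fun y => rightAct y g) '' idealSide i}

/-- The Teichmüller cutting sequence of `r_θ`, i.e. the sequence of labels of the sides of the
ideal octagon tessellation that are crossed by the ray, starts with `s_0, …, s_{k-1}`. -/
def TeichCuttingStartsWith (θ : ℝ) {k : ℕ} (s : Fin k → Fin 8) : Prop :=
  ∃ t : Fin k → ℝ, StrictMono t ∧
    (∀ j, 0 ≤ t j ∧ teichRay θ (t j) ∈ tessellationSide (s j)) ∧
    ∀ u, 0 ≤ u → (∃ i, teichRay θ u ∈ tessellationSide i) →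
      (∃ j, u = t j) ∨ ∀ j, t j < u

end

end OctagonFlow

open OctagonFlow

namespace OctagonFlow

open Filter Topology

/-! ### Geometry of the octagon -/

/-! The argument is renormalization (`exists_renormalization`). If Ψ has derivative γ^(k), then Ψ⁻¹τ
is a linear trajectory in the direction (γ^(k))⁻¹e_θ, with e_θ = (cos θ, sin θ), and by induction
its cutting sequence with respect to O is w^(k). So only a single derivation has to be understood,
in a direction whose sector is announced by the next Teichmüller label.

The sector. A point z of ℍ carries the quadratic form |u₀z + u₁|², polarized in `form`; the right
action of M becomes the substitution u ↦ Mu, up to a positive factor. The reflection γ_i has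
eigenvectors `negVec i` and `fixVec i`, which span the two lines bounding the i-th sector, and E_i
is the set of z for which they are orthogonal. Along r_θ the rescaled form is affine in e^{2t}, so a
wall that is positive and then vanishes has negative slope `sideSign`. This says that, up to sign,
M⁻¹e_θ lies inside the i-th sector (`inSector_of_sideSign`). A ping-pong argument
(`Reduced.wall_nonpos`) shows that a closed octagon of the tessellation meets no sides but its own,
so the labels met by the ray are those of the octagons it leaves.

One derivation. The symmetries ν_i and -I of the octagon reduce everything to the open sector (0,
π/8) (`exists_derived_of_sector`). The surface consists of two horizontal cylinders, in which the
ratio of circumference to height is 1+√2 and 2(1+√2); hence γ is the derivative of an affine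
involution, a reflection composed with two twists of the first cylinder and one of the second. The
involution preserves side A and turns every other side into a diagonal with the same midpoint,
ending at vertices (`mem_inducedSide_involution`). The trajectory through a side meets the
corresponding diagonal iff it separates the ends of the diagonal. The position of one end depends
only on the next transition and that of the other only on the previous one, and what matters is
whether the transition stays in one cylinder (`transition`). Hence the diagonal is met iff the
letter is sandwiched (`Crossings.sandwiched_iff`), and these meetings occur in the order of the
letters (`Crossings.diagTime_strictMonoOn`).

Uniqueness. Two automorphisms with the same derivative differ by one with derivative 1. It fixes the
centre of O, the only point from which all eight vertex vectors can lead to the singular point, and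
hence everything (`IsAffineAutomorphism.eq_refl_of_one`). -/

theorem normal_eq (i : Fin 8) : normal i =
    ![![1, √2 / 2, 0, -(√2 / 2), -1, -(√2 / 2), 0, √2 / 2] i,
      ![0, √2 / 2, 1, √2 / 2, 0, -(√2 / 2), -1, -(√2 / 2)] i] := by
  have e1 : (3 : ℝ) * Real.pi / 4 = Real.pi - Real.pi / 4 := by ring
  have e2 : (2 : ℝ) * Real.pi / 4 = Real.pi / 2 := by ring
  have e3 : (4 : ℝ) * Real.pi / 4 = Real.pi := by ring
  have e4 : (5 : ℝ) * Real.pi / 4 = Real.pi / 4 + Real.pi := by ring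
  have e5 : (6 : ℝ) * Real.pi / 4 = Real.pi / 2 + Real.pi := by ring
  have e6 : (7 : ℝ) * Real.pi / 4 = 2 * Real.pi - Real.pi / 4 := by ring
  fin_cases i <;>
    simp [normal, e1, e2, e3, e4, e5, e6, Real.cos_add_pi, Real.sin_add_pi, Real.cos_pi_sub,
      Real.sin_pi_sub, Real.cos_two_pi_sub, Real.sin_two_pi_sub]

theorem sqrt_two_mul_self : √2 * √2 = (2 : ℝ) := Real.mul_self_sqrt (by norm_num)

theorem normal_add_four (i : Fin 8) : normal (i + 4) = -normal i := by
  rw [normal_eq, normal_eq]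
  fin_cases i <;> ext k <;> fin_cases k <;> simp

theorem normal_dot_self (i : Fin 8) : normal i ⬝ᵥ normal i = 1 := by
  have h := sqrt_two_mul_self
  rw [normal_eq]
  fin_cases i <;> simp <;> nlinarith

theorem normal_reflect (i j : Fin 8) :
    normal (2 * i + 4 - j) = normal j - (2 * (normal i ⬝ᵥ normal j)) • normal i := by
  have h : √2 / 2 * (√2 / 2) = 1 / 2 := by linarith [sqrt_two_mul_self]
  simp only [normal_eq]
  fin_cases i <;> fin_cases j <;> ext k <;> fin_cases k <;> simp [h] <;> nlinarith

/-- A point lying on two different sides of the octagon. -/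
def IsVertex (x : Plane) : Prop := ∃ i j : Fin 8, i ≠ j ∧ x ∈ side i ∧ x ∈ side j

theorem dot_ge_neg_one {x : Plane} (h : x ∈ octagon) (i : Fin 8) : -1 ≤ normal i ⬝ᵥ x := by
  have := h (i + 4)
  rw [normal_add_four, neg_dotProduct] at this
  linarith

theorem dot_sub_two_normal (i : Fin 8) (x : Plane) :
    normal i ⬝ᵥ (x - (2 : ℝ) • normal i) = normal i ⬝ᵥ x - 2 := by
  rw [dotProduct_sub, dotProduct_smul, normal_dot_self]; simp

/-- On side `i` the gluing translation agrees with the reflection in the line through 0 orthogonal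
to `normal i`. The latter permutes the normals, so gluing carries sides to sides and vertices to
vertices. -/
theorem dot_reflect (i j : Fin 8) {x : Plane} (hx : normal i ⬝ᵥ x = 1) :
    normal (2 * i + 4 - j) ⬝ᵥ (x - (2 : ℝ) • normal i) = normal j ⬝ᵥ x := by
  rw [normal_reflect, sub_dotProduct, smul_dotProduct, dot_sub_two_normal, hx, dotProduct_sub,
    dotProduct_smul, dotProduct_comm (normal j) (normal i)]
  simp only [smul_eq_mul]; ring

theorem sub_two_normal_mem_side {i : Fin 8} {x : Plane} (hx : x ∈ side i) :
    x - (2 : ℝ) • normal i ∈ side (i + 4) := by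
  refine ⟨fun k => ?_, ?_⟩
  · have h := dot_reflect i (2 * i + 4 - k) hx.2
    rw [sub_sub_cancel] at h
    rw [h]; exact hx.1 _
  · rw [normal_add_four, neg_dotProduct, dot_sub_two_normal, hx.2]; norm_num

theorem IsVertex.sub_two_normal {i : Fin 8} {x : Plane} (hx : x ∈ side i) (h : IsVertex x) :
    IsVertex (x - (2 : ℝ) • normal i) := by
  have hm := sub_two_normal_mem_side hx
  obtain ⟨j, hj, hxj⟩ : ∃ j, j ≠ i ∧ x ∈ side j := by
    obtain ⟨j, k, hjk, hj, hk⟩ := h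
    by_cases hji : j = i
    · exact ⟨k, fun h => hjk (hji.trans h.symm), hk⟩
    · exact ⟨j, hji, hj⟩
  refine ⟨2 * i + 4 - j, i + 4, ?_, ⟨hm.1, ?_⟩, hm⟩
  · have : ∀ i j : Fin 8, 2 * i + 4 - j = i + 4 → j = i := by decide
    exact fun h => hj (this i j h)
  · rw [dot_reflect i j hx.2]; exact hxj.2

theorem eq_of_mem_side {x : Plane} (hx : ¬ IsVertex x) {i j : Fin 8} (hi : x ∈ side i)
    (hj : x ∈ side j) : i = j := by
  by_contra h; exact hx ⟨i, j, h, hi, hj⟩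

theorem add_four_add_four (i : Fin 8) : i + 4 + 4 = i := by
  rw [add_assoc]; exact add_zero i

theorem not_isVertex_sub {i : Fin 8} {x : Plane} (hx : x ∈ side i) (h : ¬ IsVertex x) :
    ¬ IsVertex (x - (2 : ℝ) • normal i) := by
  intro hv
  apply h
  have := hv.sub_two_normal (sub_two_normal_mem_side hx)
  rw [normal_add_four] at this
  simpa using this

/-! ### The gluing relation -/

/-- The equivalence relation generated by the gluing, up to the identification of vertices. -/
def GlueRel (x y : octagon) : Prop :=
  x = y ∨ (∃ i : Fin 8, (x : Plane) ∈ side i ∧ (y : Plane) = (x : Plane) - (2 : ℝ) • normal i) ∨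
    (IsVertex x ∧ IsVertex y)

theorem GlueRel.symm {x y : octagon} (h : GlueRel x y) : GlueRel y x := by
  rcases h with h | ⟨i, hi, hy⟩ | h
  · exact Or.inl h.symm
  · refine Or.inr (Or.inl ⟨i + 4, ?_, ?_⟩)
    · rw [hy]; exact sub_two_normal_mem_side hi
    · rw [hy, normal_add_four]; simp
  · exact Or.inr (Or.inr h.symm)

theorem GlueRel.isVertex {x y : octagon} (h : GlueRel x y) (hx : IsVertex x) : IsVertex y := by
  rcases h with h | ⟨i, hi, hy⟩ | h
  · exact h ▸ hx
  · rw [hy]; exact hx.sub_two_normal hi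
  · exact h.2

/-- A point that is not a vertex lies on at most one side, so two successive gluings through it
cancel. -/
theorem GlueRel.trans {x y z : octagon} (h : GlueRel x y) (h' : GlueRel y z) : GlueRel x z := by
  by_cases hv : IsVertex y
  · exact Or.inr (Or.inr ⟨h.symm.isVertex hv, h'.isVertex hv⟩)
  rcases h with h | ⟨i, hi, hy⟩ | h
  · exact h ▸ h'
  · rcases h' with h' | ⟨j, hj, hz⟩ | h'
    · exact h' ▸ Or.inr (Or.inl ⟨i, hi, hy⟩)
    · have h1 : (y : Plane) ∈ side (i + 4) := by rw [hy]; exact sub_two_normal_mem_side hi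
      have h2 := eq_of_mem_side hv h1 hj
      left
      apply Subtype.ext
      rw [hz, ← h2, hy, normal_add_four]; simp
    · exact absurd h'.1 hv
  · exact absurd h.2 hv

theorem glueRel_of_eq {x y : octagon} (h : toSurface x = toSurface y) : GlueRel x y := by
  have h' := Quot.eqvGen_exact h
  clear h
  induction h' with
  | rel x y h => exact Or.inr (Or.inl h)
  | refl x => exact Or.inl rfl
  | symm x y _ ih => exact ih.symm
  | trans x y z _ _ ih1 ih2 => exact ih1.trans ih2

/-- Opposite sides are at distance 2, so two points of the octagon that differ by `2 • normal i` lie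
on these sides automatically. -/
theorem toSurface_eq_of_sub {x y : octagon} {i : Fin 8} 
    (hy : (y : Plane) = (x : Plane) - (2 : ℝ) • normal i) : toSurface x = toSurface y := by
  refine Quot.sound ⟨i, ⟨x.2, le_antisymm (x.2 i) ?_⟩, hy⟩
  have := dot_ge_neg_one y.2 i
  rw [hy, dot_sub_two_normal] at this
  linarith

theorem toSurface_mem_singularSet {x : octagon} : toSurface x ∈ singularSet ↔ IsVertex x := by
  constructor
  · rintro ⟨y, i, j, hij, hi, hj, h⟩
    exact (glueRel_of_eq h).isVertex ⟨i, j, hij, hi, hj⟩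
  · rintro ⟨i, j, hij, hi, hj⟩
    exact ⟨x, i, j, hij, hi, hj, rfl⟩

theorem exists_rep (p : OctagonSurface) : ∃ x, toSurface x = p := Quot.exists_rep p

theorem eq_or_glue_of_not_isVertex {x y : octagon} (hx : ¬ IsVertex x)
    (h : toSurface x = toSurface y) :
    x = y ∨ ∃ i : Fin 8, (x : Plane) ∈ side i ∧ (y : Plane) = (x : Plane) - (2 : ℝ) • normal i := by
  rcases glueRel_of_eq h with h | h | h
  · exact Or.inl h
  · exact Or.inr h
  · exact absurd h.1 hx

theorem sideLabel_add_four (i : Fin 8) : sideLabel (i + 4) = sideLabel i := by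
  fin_cases i <;> rfl

theorem toSurface_mem_labelledSide {x : octagon} (hx : ¬ IsVertex x) {L : Letter} :
    toSurface x ∈ labelledSide L ↔ ∃ i, sideLabel i = L ∧ (x : Plane) ∈ side i := by
  constructor
  · rintro ⟨y, i, hL, hi, h⟩
    rcases eq_or_glue_of_not_isVertex hx h.symm with h | ⟨j, hj, hy⟩
    · exact ⟨i, hL, h ▸ hi⟩
    · refine ⟨j, ?_, hj⟩
      have h1 := sub_two_normal_mem_side hj
      rw [← hy] at h1
      have h2 : ¬ IsVertex y := by rw [hy]; exact not_isVertex_sub hj hx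
      rw [← sideLabel_add_four, eq_of_mem_side h2 h1 hi, hL]
  · rintro ⟨i, hL, hi⟩
    exact ⟨x, i, hL, hi, rfl⟩

theorem label_unique {p : OctagonSurface} (hp : p ∉ singularSet) {L L' : Letter}
    (h : p ∈ labelledSide L) (h' : p ∈ labelledSide L') : L = L' := by
  obtain ⟨x, rfl⟩ := exists_rep p
  rw [toSurface_mem_singularSet] at hp
  rw [toSurface_mem_labelledSide hp] at h h'
  obtain ⟨i, rfl, hi⟩ := h
  obtain ⟨j, rfl, hj⟩ := h'
  rw [eq_of_mem_side hp hi hj]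

/-! ### Small steps -/

/-- The end points computed from two representatives differ by the same gluing vector as the
representatives themselves. -/
theorem Step.unique {p : OctagonSurface} (hp : p ∉ singularSet) {u : Plane}
    {q q' : OctagonSurface} (h : Step p u q) (h' : Step p u q') : q = q' := by
  obtain ⟨x, y, rfl, rfl, hy⟩ := h
  obtain ⟨x', y', hx', rfl, hy'⟩ := h'
  rw [toSurface_mem_singularSet] at hp
  rcases eq_or_glue_of_not_isVertex hp hx'.symm with h | ⟨i, hi, hx⟩
  · have : y = y' := Subtype.ext (by rw [hy, hy', h])
    rw [this]
  · apply toSurface_eq_of_sub (i := i)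
    rw [hy', hx, hy]; abel

theorem continuous_dot (n : Plane) : Continuous fun u : Plane => n ⬝ᵥ u := by
  simp only [dotProduct]; fun_prop

theorem eventually_dot_lt {n x : Plane} (h : n ⬝ᵥ x < 1) : ∀ᶠ u in 𝓝 (0 : Plane), n ⬝ᵥ (x + u) < 1 := by
  have hc : Continuous fun u : Plane => n ⬝ᵥ (x + u) :=
    (continuous_dot n).comp (by fun_prop)
  exact hc.continuousAt.eventually_lt continuousAt_const (by simpa using h)

theorem eventually_not_isVertex_add {x : Plane} (hO : x ∈ octagon) (hx : ¬ IsVertex x) :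
    ∀ᶠ u in 𝓝 (0 : Plane), ¬ IsVertex (x + u) := by
  have : ∀ i : Fin 8, ∀ᶠ u in 𝓝 (0 : Plane), x ∈ side i ∨ x + u ∉ side i := by
    intro i
    by_cases hi : x ∈ side i
    · exact Eventually.of_forall fun _ => Or.inl hi
    · have : normal i ⬝ᵥ x < 1 := lt_of_le_of_ne (hO i) fun h => hi ⟨hO, h⟩
      filter_upwards [eventually_dot_lt this] with u hu
      exact Or.inr fun h => hu.ne h.2
  filter_upwards [eventually_all.2 this] with u hu
  rintro ⟨i, j, hij, hi, hj⟩
  exact hij (eq_of_mem_side hx ((hu i).resolve_right (by simpa using hi))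
    ((hu j).resolve_right (by simpa using hj)))

/-- A nonsingular point has at most two representatives, so a property holding near each of them
holds on a common neighbourhood. -/
theorem eventually_reps {p : OctagonSurface} (hp : p ∉ singularSet) {P : Plane → Plane → Prop}
    (h : ∀ x : octagon, toSurface x = p → ∀ᶠ u in 𝓝 (0 : Plane), P x u) :
    ∀ᶠ u in 𝓝 (0 : Plane), ∀ x : octagon, toSurface x = p → P x u := by
  obtain ⟨x, rfl⟩ := exists_rep p
  rw [toSurface_mem_singularSet] at hp
  have h2 : ∀ i : Fin 8, ∀ᶠ u in 𝓝 (0 : Plane), (x : Plane) ∈ side i →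
      P ((x : Plane) - (2 : ℝ) • normal i) u := by
    intro i
    by_cases hi : (x : Plane) ∈ side i
    · have h3 := h ⟨_, (sub_two_normal_mem_side hi).1⟩ (toSurface_eq_of_sub (i := i) rfl).symm
      filter_upwards [h3] with u hu _ using hu
    · exact Eventually.of_forall fun _ h => absurd h hi
  filter_upwards [h x rfl, eventually_all.2 h2] with u h1 h2 y hy
  rcases eq_or_glue_of_not_isVertex hp hy.symm with h | ⟨i, hi, hx⟩
  · rw [← h]; exact h1
  · rw [hx]; exact h2 i hi

/-- At a point of a side, inward displacements start from the representative on that side, outward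
ones from its glued copy. -/
theorem eventually_exists_step {p : OctagonSurface} (hp : p ∉ singularSet) :
    ∀ᶠ u in 𝓝 (0 : Plane), ∃ q, Step p u q := by
  obtain ⟨x, rfl⟩ := exists_rep p
  rw [toSurface_mem_singularSet] at hp
  have key : ∀ y : octagon, ¬ IsVertex y → ∀ᶠ u in 𝓝 (0 : Plane),
      ∀ k, (y : Plane) ∈ side k ∨ normal k ⬝ᵥ ((y : Plane) + u) < 1 := by
    intro y hy
    refine eventually_all.2 fun k => ?_
    by_cases hk : (y : Plane) ∈ side k
    · exact Eventually.of_forall fun _ => Or.inl hk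
    · have : normal k ⬝ᵥ (y : Plane) < 1 := lt_of_le_of_ne (y.2 k) fun h => hk ⟨y.2, h⟩
      filter_upwards [eventually_dot_lt this] with u hu using Or.inr hu
  by_cases hs : ∃ i, (x : Plane) ∈ side i
  · obtain ⟨i, hi⟩ := hs
    have hm := sub_two_normal_mem_side hi
    have hnv := not_isVertex_sub hi hp
    filter_upwards [key x hp, key ⟨_, hm.1⟩ hnv] with u h1 h2
    by_cases hu : normal i ⬝ᵥ u ≤ 0
    · refine ⟨toSurface ⟨x + u, fun k => ?_⟩, x, _, rfl, rfl, rfl⟩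
      rcases h1 k with h | h
      · rw [← eq_of_mem_side hp hi h, dotProduct_add, hi.2]; linarith
      · exact h.le
    · refine ⟨toSurface ⟨x - (2 : ℝ) • normal i + u, fun k => ?_⟩, ⟨_, hm.1⟩, _,
        (toSurface_eq_of_sub (i := i) rfl).symm, rfl, rfl⟩
      rcases h2 k with h | h
      · rw [← eq_of_mem_side hnv hm h, dotProduct_add, hm.2, normal_add_four, neg_dotProduct]
        linarith
      · exact h.le
  · filter_upwards [key x hp] with u h1
    refine ⟨toSurface ⟨x + u, fun k => ?_⟩, x, _, rfl, rfl, rfl⟩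
    rcases h1 k with h | h
    · exact absurd ⟨k, h⟩ hs
    · exact h.le

/-- Two different points, the first one not singular, cannot be moved to the same point by
the same small displacement. -/
theorem eventually_step_ne {p : OctagonSurface} (hp : p ∉ singularSet) (y : octagon)
    (hne : p ≠ toSurface y) : ∀ᶠ u in 𝓝 (0 : Plane), ∀ z : octagon, (z : Plane) = y + u →
      ¬ Step p u (toSurface z) := by
  have := eventually_reps hp (P := fun x u => ¬ IsVertex (x + u)) (fun x hx =>
    eventually_not_isVertex_add x.2 (by rw [← toSurface_mem_singularSet, hx]; exact hp))
  filter_upwards [this] with u hu z hz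
  rintro ⟨x, x', hx, hx', h⟩
  have hv := hu x hx
  rw [← h] at hv
  rcases eq_or_glue_of_not_isVertex hv hx' with h1 | ⟨i, hi, h1⟩
  · apply hne
    rw [← hx]
    congr 1
    apply Subtype.ext
    have : (x : Plane) + u = y + u := by rw [← h, ← hz, h1]
    exact add_right_cancel this
  · apply hne
    rw [← hx]
    apply toSurface_eq_of_sub (i := i)
    have : (y : Plane) + u = x - (2 : ℝ) • normal i + u := by rw [← hz, h1, h]; abel
    exact add_right_cancel this

theorem tendsto_smul_zero (v : Plane) : Tendsto (fun h : ℝ => h • v) (𝓝 0) (𝓝 0) := by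
  have : Continuous fun h : ℝ => h • v := by fun_prop
  simpa using this.tendsto 0

theorem octagon_convex : Convex ℝ octagon := by
  intro x hx y hy a b ha hb hab k
  rw [dotProduct_add, dotProduct_smul, dotProduct_smul, smul_eq_mul, smul_eq_mul]
  nlinarith [hx k, hy k]

theorem add_smul_mem_octagon {X v : Plane} {l : ℝ} (h0 : X ∈ octagon) (hl : X + l • v ∈ octagon)
    {t : ℝ} (ht : t ∈ Set.Icc 0 l) : X + t • v ∈ octagon := by
  intro k
  have h1 := h0 k
  have h2 := hl k
  rw [dotProduct_add, dotProduct_smul, smul_eq_mul] at h2 ⊢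
  rcases le_total 0 (normal k ⬝ᵥ v) with h | h
  · nlinarith [ht.1, ht.2]
  · nlinarith [ht.1, ht.2]

/-- A linear path which avoids the singular point and starts at the image of a point of the
octagon follows the straight line in the octagon as long as the latter stays there. -/
theorem linear_path_eq {v X : Plane} {l : ℝ} {τ : ℝ → OctagonSurface}
    (hns : ∀ t ∈ Set.Icc 0 l, τ t ∉ singularSet)
    (hstep : ∀ t ∈ Set.Icc 0 l, ∀ᶠ h in 𝓝 (0 : ℝ), t + h ∈ Set.Icc 0 l →
      Step (τ t) (h • v) (τ (t + h)))
    (hmem : ∀ t ∈ Set.Icc 0 l, X + t • v ∈ octagon) (h0 : ∀ hX : X ∈ octagon, τ 0 = toSurface ⟨X, hX⟩)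
    {t : ℝ} (ht : t ∈ Set.Icc 0 l) : τ t = toSurface ⟨X + t • v, hmem t ht⟩ := by
  have hl : 0 ≤ l := ht.1.trans ht.2
  -- Continuity method: agreement with the line is a closed condition by `eventually_step_ne`, and
  -- it extends to the right by `Step.unique`.
  let s : Set ℝ := {t | ∃ h : t ∈ Set.Icc 0 l, τ t = toSurface ⟨X + t • v, hmem t h⟩}
  suffices h : Set.Icc 0 l ⊆ s from (h ht).2
  have hclosed : IsClosed (s ∩ Set.Icc 0 l) := by
    rw [← isOpen_compl_iff, isOpen_iff_mem_nhds]
    intro t ht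
    by_cases htI : t ∈ Set.Icc 0 l
    · have hne : τ t ≠ toSurface ⟨X + t • v, hmem t htI⟩ := fun h => ht ⟨⟨htI, h⟩, htI⟩
      have h1 := (tendsto_smul_zero v).eventually (eventually_step_ne (hns t htI) _ hne)
      have h2 : ∀ᶠ h in 𝓝 (0 : ℝ), t + h ∉ s ∩ Set.Icc 0 l := by
        filter_upwards [h1, hstep t htI] with h h1 h2
        rintro ⟨⟨h3, h4⟩, -⟩
        refine h1 ⟨_, hmem _ h3⟩ ?_ ?_
        · simp only [add_smul, add_assoc]
        · rw [← h4]; exact h2 h3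
      have h3 : Tendsto (fun t' => t' - t) (𝓝 t) (𝓝 0) := by
        have : Continuous fun t' : ℝ => t' - t := by fun_prop
        simpa using this.tendsto t
      filter_upwards [h3.eventually h2] with t' ht'
      simpa using ht'
    · exact Filter.mem_of_superset (isClosed_Icc.isOpen_compl.mem_nhds htI) fun x hx h => hx h.2
  refine hclosed.Icc_subset_of_forall_exists_gt ⟨⟨le_rfl, hl⟩, ?_⟩ ?_
  · have hX : X ∈ octagon := by simpa using hmem 0 ⟨le_rfl, hl⟩
    rw [h0 hX]; congr 2; simp
  · rintro t ⟨⟨htI, hteq⟩, ht0, htl⟩ y hy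
    have h1 := hstep t htI
    obtain ⟨ε, hε, hε'⟩ := Metric.eventually_nhds_iff.1 h1
    obtain ⟨h, hh0, hh⟩ : ∃ h, 0 < h ∧ h < ε ∧ t + h ≤ y ∧ t + h ≤ l := by
      refine ⟨min (ε / 2) (min (y - t) (l - t)), by
        have : t < y := hy
        simp [hε, this, htl], ?_, ?_, ?_⟩
      · exact (min_le_left _ _).trans_lt (by linarith)
      · have : min (ε / 2) (min (y - t) (l - t)) ≤ y - t := (min_le_right _ _).trans (min_le_left _ _)
        linarith
      · have : min (ε / 2) (min (y - t) (l - t)) ≤ l - t := (min_le_right _ _).trans (min_le_right _ _)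
        linarith
    have hI : t + h ∈ Set.Icc 0 l := ⟨by linarith, hh.2.2⟩
    have h2 := hε' (y := h) (by simpa [abs_of_pos hh0] using hh.1) hI
    refine ⟨t + h, ⟨hI, ?_⟩, by simpa using hh0, hh.2.1⟩
    refine h2.unique (hns t htI) ⟨⟨_, hmem t htI⟩, ⟨_, hmem _ hI⟩, hteq.symm, rfl, ?_⟩
    simp only [add_smul, add_assoc]

/-! ### Coordinates -/

theorem sqrt_two_bounds : (1.414 : ℝ) < √2 ∧ √2 < (1.415 : ℝ) :=
  ⟨Real.lt_sqrt_of_sq_lt (by norm_num), (Real.sqrt_lt' (by norm_num)).2 (by norm_num)⟩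

theorem normal_dot (i : Fin 8) (x : Plane) : normal i ⬝ᵥ x =
    ![x 0, √2 / 2 * (x 0 + x 1), x 1, √2 / 2 * (x 1 - x 0), -x 0, -(√2 / 2 * (x 0 + x 1)), -x 1,
      √2 / 2 * (x 0 - x 1)] i := by
  rw [normal_eq]
  fin_cases i <;> simp [dotProduct] <;> ring

theorem half_sqrt_two_mul_lt {s : ℝ} : √2 / 2 * s < 1 ↔ s < √2 := by
  have h := sqrt_two_mul_self
  have := sqrt_two_bounds.1
  constructor <;> intro h1 <;> nlinarith

theorem half_sqrt_two_mul_le {s : ℝ} : √2 / 2 * s ≤ 1 ↔ s ≤ √2 := by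
  have h := sqrt_two_mul_self
  have := sqrt_two_bounds.1
  constructor <;> intro h1 <;> nlinarith

theorem half_sqrt_two_mul_eq {s : ℝ} : √2 / 2 * s = 1 ↔ s = √2 := by
  have h := sqrt_two_mul_self
  have := sqrt_two_bounds.1
  constructor <;> intro h1 <;> nlinarith

theorem mem_octagon_iff {x : Plane} : x ∈ octagon ↔
    x 0 ≤ 1 ∧ x 0 + x 1 ≤ √2 ∧ x 1 ≤ 1 ∧ x 1 - x 0 ≤ √2 ∧ -1 ≤ x 0 ∧ -√2 ≤ x 0 + x 1 ∧ -1 ≤ x 1 ∧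
      x 0 - x 1 ≤ √2 := by
  have h : x ∈ octagon ↔ ∀ i, normal i ⬝ᵥ x ≤ 1 := Iff.rfl
  simp only [h, normal_dot, Fin.forall_fin_succ]
  simp [half_sqrt_two_mul_le, ← mul_neg, neg_le]

theorem interior_iff {x : Plane} : (∀ i, normal i ⬝ᵥ x < 1) ↔
    x 0 < 1 ∧ x 0 + x 1 < √2 ∧ x 1 < 1 ∧ x 1 - x 0 < √2 ∧ -1 < x 0 ∧ -√2 < x 0 + x 1 ∧ -1 < x 1 ∧
      x 0 - x 1 < √2 := by
  simp only [normal_dot, Fin.forall_fin_succ]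
  simp [half_sqrt_two_mul_lt, ← mul_neg, neg_lt]

/-! ### The singular point -/

/-- The common vertex of the sides `i` and `i + 1`. -/
noncomputable def vertex (i : Fin 8) : Plane := normal i + (√2 - 1) • normal (i + 2)

theorem vertex_eq (i : Fin 8) : vertex i =
    ![![1, √2 - 1, 1 - √2, -1, -1, 1 - √2, √2 - 1, 1] i,
      ![√2 - 1, 1, 1, √2 - 1, 1 - √2, -1, -1, 1 - √2] i] := by
  have h := sqrt_two_mul_self
  simp only [vertex, normal_eq]
  fin_cases i <;> ext k <;> fin_cases k <;> simp <;> grind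

theorem vertex_mem_octagon (i : Fin 8) : vertex i ∈ octagon := by
  have := sqrt_two_bounds
  rw [mem_octagon_iff, vertex_eq]
  fin_cases i <;> refine ⟨?_, ?_, ?_, ?_, ?_, ?_, ?_, ?_⟩ <;> simp <;> linarith

theorem vertex_mem_side (i : Fin 8) : vertex i ∈ side i ∧ vertex i ∈ side (i + 1) := by
  have h := sqrt_two_mul_self
  refine ⟨⟨vertex_mem_octagon i, ?_⟩, ⟨vertex_mem_octagon i, ?_⟩⟩ <;>
  · rw [vertex_eq, normal_dot]
    fin_cases i <;> simp <;> nlinarith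

theorem isVertex_vertex (i : Fin 8) : IsVertex (vertex i) :=
  ⟨i, i + 1, by simp, vertex_mem_side i⟩

theorem eq_vertex_of_isVertex {x : Plane} (h : IsVertex x) : ∃ i, x = vertex i := by
  have h2 := sqrt_two_mul_self
  have hb := sqrt_two_bounds
  obtain ⟨i, j, hij, ⟨hO, hi⟩, ⟨-, hj⟩⟩ := h
  rw [mem_octagon_iff] at hO
  obtain ⟨h0, h1, h2, h3, h4, h5, h6, h7⟩ := hO
  have key : ∀ k : Fin 8, x 0 = ![1, √2 - 1, 1 - √2, -1, -1, 1 - √2, √2 - 1, 1] k →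
      x 1 = ![√2 - 1, 1, 1, √2 - 1, 1 - √2, -1, -1, 1 - √2] k → ∃ i, x = vertex i := fun k h h' =>
    ⟨k, by rw [vertex_eq]; ext l; fin_cases l; exacts [h, h']⟩
  rw [normal_dot] at hi hj
  fin_cases i <;> simp [half_sqrt_two_mul_eq, ← mul_neg] at hi <;> fin_cases j <;>
    simp [half_sqrt_two_mul_eq, ← mul_neg] at hj hij <;>
    first
    | (exfalso; linarith)
    | exact key 0 (by simp; linarith) (by simp; linarith)
    | exact key 1 (by simp; linarith) (by simp; linarith)
    | exact key 2 (by simp; linarith) (by simp; linarith)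
    | exact key 3 (by simp; linarith) (by simp; linarith)
    | exact key 4 (by simp; linarith) (by simp; linarith)
    | exact key 5 (by simp; linarith) (by simp; linarith)
    | exact key 6 (by simp; linarith) (by simp; linarith)
    | exact key 7 (by simp; linarith) (by simp; linarith)

/-- Gluing along side `i` takes `vertex i` to `vertex (i + 3)`, and 3 generates ℤ/8. -/
theorem toSurface_vertex (i : Fin 8) :
    toSurface ⟨vertex i, vertex_mem_octagon i⟩ = toSurface ⟨vertex 0, vertex_mem_octagon 0⟩ := by
  have step : ∀ i : Fin 8, toSurface ⟨vertex i, vertex_mem_octagon i⟩ =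
      toSurface ⟨vertex (i + 3), vertex_mem_octagon _⟩ := by
    intro i
    refine toSurface_eq_of_sub (i := i) ?_
    have h := sqrt_two_mul_self
    simp only [vertex_eq, normal_eq]
    fin_cases i <;> ext k <;> fin_cases k <;> simp <;> grind
  have h1 := step 0
  have h2 := step 3
  have h3 := step 6
  have h4 := step 1
  have h5 := step 4
  have h6 := step 7
  have h7 := step 2
  have e : (0 : Fin 8) + 3 = 3 ∧ (3 : Fin 8) + 3 = 6 ∧ (6 : Fin 8) + 3 = 1 ∧ (1 : Fin 8) + 3 = 4 ∧
    (4 : Fin 8) + 3 = 7 ∧ (7 : Fin 8) + 3 = 2 ∧ (2 : Fin 8) + 3 = 5 := by decide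
  simp only [e] at h1 h2 h3 h4 h5 h6 h7
  fin_cases i
  · rfl
  · exact ((h1.trans h2).trans h3).symm
  · exact ((((h1.trans h2).trans h3).trans h4).trans (h5.trans h6)).symm
  · exact h1.symm
  · exact ((h1.trans h2).trans (h3.trans h4)).symm
  · exact (((((h1.trans h2).trans h3).trans h4).trans (h5.trans h6)).trans h7).symm
  · exact (h1.trans h2).symm
  · exact (((h1.trans h2).trans (h3.trans h4)).trans h5).symm

theorem singularSet_subsingleton {p q : OctagonSurface} (hp : p ∈ singularSet)
    (hq : q ∈ singularSet) : p = q := by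
  obtain ⟨x, rfl⟩ := exists_rep p
  obtain ⟨y, rfl⟩ := exists_rep q
  rw [toSurface_mem_singularSet] at hp hq
  obtain ⟨i, hi⟩ := eq_vertex_of_isVertex hp
  obtain ⟨j, hj⟩ := eq_vertex_of_isVertex hq
  have hx : x = ⟨vertex i, vertex_mem_octagon i⟩ := Subtype.ext hi
  have hy : y = ⟨vertex j, vertex_mem_octagon j⟩ := Subtype.ext hj
  rw [hx, hy, toSurface_vertex i, toSurface_vertex j]

theorem not_isVertex_of_interior {x : Plane} (h : ∀ i, normal i ⬝ᵥ x < 1) : ¬ IsVertex x :=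
  fun ⟨i, _, _, hi, _⟩ => (h i).ne hi.2

/-! ### Affine automorphisms -/

theorem IsLinearTrajectory.eventually {v : Plane} {τ : ℝ → OctagonSurface}
    (h : IsLinearTrajectory v τ) (t : ℝ) : ∀ᶠ s in 𝓝 (0 : ℝ), Step (τ t) (s • v) (τ (t + s)) := by
  obtain ⟨ε, hε, h'⟩ := h.2 t
  exact Metric.eventually_nhds_iff.2 ⟨ε, hε, fun s hs => h' s (by simpa using hs)⟩

namespace IsAffineAutomorphism

variable {Ψ Φ : OctagonSurface ≃ₜ OctagonSurface} {M N : GL (Fin 2) ℝ}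

theorem apply_mem_iff (h : IsAffineAutomorphism Ψ M) {p : OctagonSurface} :
    Ψ p ∈ singularSet ↔ p ∈ singularSet := by
  conv_lhs => rw [← h.1]
  exact Ψ.injective.mem_set_image

theorem symm_apply_mem_iff (h : IsAffineAutomorphism Ψ M) {p : OctagonSurface} :
    Ψ.symm p ∈ singularSet ↔ p ∈ singularSet := by
  rw [← h.apply_mem_iff, Ψ.apply_symm_apply]

theorem eventually (h : IsAffineAutomorphism Ψ M) {p : OctagonSurface} (hp : p ∉ singularSet) :
    ∀ᶠ u in 𝓝 (0 : Plane), ∀ q, Step p u q →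
      Step (Ψ p) ((M : Matrix (Fin 2) (Fin 2) ℝ) *ᵥ u) (Ψ q) := by
  obtain ⟨ε, hε, h'⟩ := h.2 p hp
  exact Metric.eventually_nhds_iff.2 ⟨ε, hε, fun u hu q => h' u q (by simpa using hu)⟩

/-- The singular set is a single point, so an inclusion of its image is already an equality. -/
theorem of_eventually (h1 : ∀ p, p ∈ singularSet → Ψ p ∈ singularSet)
    (h2 : ∀ p, p ∉ singularSet → ∀ᶠ u in 𝓝 (0 : Plane), ∀ q, Step p u q →
      Step (Ψ p) ((M : Matrix (Fin 2) (Fin 2) ℝ) *ᵥ u) (Ψ q)) : IsAffineAutomorphism Ψ M := by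
  have hs : toSurface ⟨vertex 0, vertex_mem_octagon 0⟩ ∈ singularSet :=
    toSurface_mem_singularSet.2 (isVertex_vertex 0)
  refine ⟨?_, fun p hp => ?_⟩
  · ext p
    constructor
    · rintro ⟨q, hq, rfl⟩
      exact h1 q hq
    · intro hp
      exact ⟨_, hs, singularSet_subsingleton (h1 _ hs) hp⟩
  · obtain ⟨ε, hε, h⟩ := Metric.eventually_nhds_iff.1 (h2 p hp)
    exact ⟨ε, hε, fun u q hu => h (by simpa using hu) q⟩

theorem tendsto_mulVec_zero (M : Matrix (Fin 2) (Fin 2) ℝ) :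
    Tendsto (fun u : Plane => M *ᵥ u) (𝓝 0) (𝓝 0) := by
  have : Continuous fun u : Plane => M *ᵥ u := by fun_prop
  simpa using this.tendsto 0

theorem trans (hΦ : IsAffineAutomorphism Φ M) (hΨ : IsAffineAutomorphism Ψ N) :
    IsAffineAutomorphism (Φ.trans Ψ) (N * M) := by
  refine of_eventually (fun p hp => ?_) fun p hp => ?_
  · exact hΨ.apply_mem_iff.2 (hΦ.apply_mem_iff.2 hp)
  · have hp' : Φ p ∉ singularSet := fun h => hp (hΦ.apply_mem_iff.1 h)
    filter_upwards [hΦ.eventually hp,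
      (tendsto_mulVec_zero (M : Matrix (Fin 2) (Fin 2) ℝ)).eventually (hΨ.eventually hp')]
      with u h1 h2 q hq
    have := h2 _ (h1 q hq)
    rwa [mulVec_mulVec] at this

/-- The step `M⁻¹u` from `Ψ⁻¹p` exists for small `u`; its image is the step `u` from `p`, and
uniqueness of steps identifies the end points. -/
theorem symm (h : IsAffineAutomorphism Ψ M) : IsAffineAutomorphism Ψ.symm M⁻¹ := by
  refine of_eventually (fun p hp => h.symm_apply_mem_iff.2 hp) fun p hp => ?_
  have hp' : Ψ.symm p ∉ singularSet := fun h' => hp (h.symm_apply_mem_iff.1 h')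
  have ht := tendsto_mulVec_zero ((M⁻¹ : GL (Fin 2) ℝ) : Matrix (Fin 2) (Fin 2) ℝ)
  filter_upwards [ht.eventually (h.eventually hp'), ht.eventually (eventually_exists_step hp')]
    with u h1 ⟨r, hr⟩ q hq
  have h3 := h1 r hr
  rw [mulVec_mulVec, ← Units.val_mul, mul_inv_cancel, Units.val_one, one_mulVec,
    Ψ.apply_symm_apply] at h3
  have := hq.unique hp h3
  rw [this, Ψ.symm_apply_apply]
  exact hr

theorem linearTrajectory (h : IsAffineAutomorphism Ψ M) {v : Plane} {τ : ℝ → OctagonSurface}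
    (hτ : IsLinearTrajectory v τ) :
    IsLinearTrajectory ((M : Matrix (Fin 2) (Fin 2) ℝ) *ᵥ v) (fun t => Ψ (τ t)) := by
  refine ⟨fun t ht => hτ.1 t (h.apply_mem_iff.1 ht), fun t => ?_⟩
  have : ∀ᶠ s in 𝓝 (0 : ℝ), Step (Ψ (τ t)) (s • (M : Matrix (Fin 2) (Fin 2) ℝ) *ᵥ v)
      (Ψ (τ (t + s))) := by
    filter_upwards [hτ.eventually t,
      (tendsto_smul_zero v).eventually (h.eventually (hτ.1 t))] with s h1 h2
    rw [← mulVec_smul]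
    exact h2 _ h1
  obtain ⟨ε, hε, h'⟩ := Metric.eventually_nhds_iff.1 this
  exact ⟨ε, hε, fun s hs => h' (by simpa using hs)⟩

/-- Straight segments in the octagon which avoid the vertices are followed by translation
automorphisms. -/
theorem apply_segment (h : IsAffineAutomorphism Φ 1) {X Y V : Plane}
    (hX : ∀ t ∈ Set.Icc (0 : ℝ) 1, X + t • V ∈ octagon)
    (hXv : ∀ t ∈ Set.Icc (0 : ℝ) 1, ¬ IsVertex (X + t • V))
    (hY : ∀ t ∈ Set.Icc (0 : ℝ) 1, Y + t • V ∈ octagon)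
    (h0 : ∀ (hX : X ∈ octagon) (hY : Y ∈ octagon), Φ (toSurface ⟨X, hX⟩) = toSurface ⟨Y, hY⟩)
    (h1 : X + V ∈ octagon) (h2 : Y + V ∈ octagon) :
    Φ (toSurface ⟨X + V, h1⟩) = toSurface ⟨Y + V, h2⟩ := by
  classical
  -- The value outside [0, 1] is a dummy that is never used.
  let σ : ℝ → OctagonSurface := fun t =>
    if ht : t ∈ Set.Icc (0 : ℝ) 1 then Φ (toSurface ⟨X + t • V, hX t ht⟩) else Φ (toSurface ⟨X + V, h1⟩)
  have hσ : ∀ t (ht : t ∈ Set.Icc (0 : ℝ) 1), σ t = Φ (toSurface ⟨X + t • V, hX t ht⟩) :=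
    fun t ht => dif_pos ht
  have hns : ∀ t (ht : t ∈ Set.Icc (0 : ℝ) 1), toSurface ⟨X + t • V, hX t ht⟩ ∉ singularSet :=
    fun t ht => by rw [toSurface_mem_singularSet]; exact hXv t ht
  have := linear_path_eq (v := V) (X := Y) (l := 1) (τ := σ)
    (fun t ht => by rw [hσ t ht, h.apply_mem_iff]; exact hns t ht)
    (fun t ht => by
      filter_upwards [(tendsto_smul_zero V).eventually (h.eventually (hns t ht))] with s hs hts
      rw [hσ t ht, hσ _ hts]
      have := hs (toSurface ⟨X + (t + s) • V, hX _ hts⟩) ⟨_, _, rfl, rfl, by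
        simp only [add_smul, add_assoc]⟩
      simpa using this)
    hY (fun hY' => by
      have e := hX 0 ⟨le_rfl, zero_le_one⟩
      rw [hσ 0 ⟨le_rfl, zero_le_one⟩, ← h0 (by simpa using e) hY']
      congr 3; simp) (t := 1) ⟨zero_le_one, le_rfl⟩
  rw [hσ 1 ⟨zero_le_one, le_rfl⟩] at this
  simpa using this

/-- The vertex in the octant opposite to `x` pulls `x` into the interior. For `x = 0` this fails,
which singles out the centre. -/
theorem exists_vertex_translate {x : Plane} (hx : x ∈ octagon) (h0 : x ≠ 0) :
    ∃ k, ∀ i, normal i ⬝ᵥ (x + vertex k) < 1 := by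
  have hb := sqrt_two_bounds
  simp only [interior_iff]
  rw [mem_octagon_iff] at hx
  have h0' : x 0 ≠ 0 ∨ x 1 ≠ 0 := by
    by_contra! h
    apply h0; ext k; fin_cases k; exacts [h.1, h.2]
  obtain ⟨a0, a1, a2, a3, a4, a5, a6, a7⟩ := hx
  have key : ∀ k, (let y := x + vertex k; y 0 < 1 ∧ y 0 + y 1 < √2 ∧ y 1 < 1 ∧ y 1 - y 0 < √2 ∧
      -1 < y 0 ∧ -√2 < y 0 + y 1 ∧ -1 < y 1 ∧ y 0 - y 1 < √2) → ∃ k, (let y := x + vertex k; y 0 < 1 ∧ y 0 + y 1 < √2 ∧ y 1 < 1 ∧ y 1 - y 0 < √2 ∧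
      -1 < y 0 ∧ -√2 < y 0 + y 1 ∧ -1 < y 1 ∧ y 0 - y 1 < √2) := fun k h => ⟨k, h⟩
  simp only [Pi.add_apply, vertex_eq] at key ⊢
  rcases le_total (x 0) 0 with s0 | s0 <;> rcases le_total (x 1) 0 with s1 | s1 <;>
  rcases le_total |x 0| |x 1| with s2 | s2 <;> 
  simp only [abs_of_nonpos, abs_of_nonneg, s0, s1] at s2 <;>
  [refine key 1 ?_; refine key 0 ?_; refine key 6 ?_; refine key 7 ?_; refine key 2 ?_;
   refine key 3 ?_; refine key 5 ?_; refine key 4 ?_] <;>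
  simp <;> rcases h0'.imp lt_or_gt_of_ne lt_or_gt_of_ne with (h | h) | (h | h) <;>
  refine ⟨?_, ?_, ?_, ?_, ?_, ?_, ?_, ?_⟩ <;> linarith

theorem zero_mem_octagon : (0 : Plane) ∈ octagon := fun i => by simp

/-- If the centre moved to `x ≠ 0`, some vertex vector would lead from `x` to an interior point, but
from the centre to the singular point. Once the centre is fixed, every point is carried along its
segment from the centre. -/
theorem eq_refl_of_one (h : IsAffineAutomorphism Φ 1) : Φ = Homeomorph.refl _ := by
  have hsym : IsAffineAutomorphism Φ.symm 1 := by simpa using h.symm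
  have hc : Φ (toSurface ⟨0, zero_mem_octagon⟩) = toSurface ⟨0, zero_mem_octagon⟩ := by
    obtain ⟨x, hx⟩ := exists_rep (Φ (toSurface ⟨0, zero_mem_octagon⟩))
    by_cases hx0 : (x : Plane) = 0
    · rw [← hx]; congr 1; exact Subtype.ext hx0
    exfalso
    obtain ⟨k, hk⟩ := exists_vertex_translate x.2 hx0
    have hxv : ¬ IsVertex (x : Plane) := by
      rw [← toSurface_mem_singularSet, hx, h.apply_mem_iff, toSurface_mem_singularSet]
      exact not_isVertex_of_interior fun i => by simp
    have hkO : (x : Plane) + vertex k ∈ octagon := fun i => (hk i).le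
    have hv0 : (0 : Plane) + vertex k ∈ octagon := by simpa using vertex_mem_octagon k
    -- The inverse is used because the segment starting at `x` avoids the vertices, as
    -- `apply_segment` requires, while the one starting at the centre ends in a vertex.
    have := apply_segment hsym (X := x) (Y := 0) (V := vertex k)
      (fun t ht => add_smul_mem_octagon x.2 (by simpa using hkO) ht)
      (fun t ht => by
        rcases eq_or_lt_of_le ht.1 with h | h
        · rw [← h]; simpa using hxv
        · refine not_isVertex_of_interior fun i => ?_
          have h1 := x.2 i
          have h2 := hk i
          rw [dotProduct_add] at h2 ⊢
          rw [dotProduct_smul, smul_eq_mul]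
          nlinarith [ht.2])
      (fun t ht => add_smul_mem_octagon zero_mem_octagon (by simpa using hv0) ht)
      (fun _ _ => by
        have : toSurface ⟨x, x.2⟩ = Φ (toSurface ⟨0, zero_mem_octagon⟩) := hx
        rw [this, Φ.symm_apply_apply]) hkO hv0
    have h1 : toSurface ⟨0 + vertex k, hv0⟩ ∈ singularSet :=
      toSurface_mem_singularSet.2 (by simpa using isVertex_vertex k)
    rw [← this, hsym.apply_mem_iff, toSurface_mem_singularSet] at h1
    exact not_isVertex_of_interior hk h1
  ext p
  by_cases hp : p ∈ singularSet
  · exact singularSet_subsingleton (h.apply_mem_iff.2 hp) hp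
  · obtain ⟨y, rfl⟩ := exists_rep p
    rw [toSurface_mem_singularSet] at hp
    have hy : (0 : Plane) + y ∈ octagon := by simp
    have hseg : ∀ t ∈ Set.Icc (0 : ℝ) 1, (0 : Plane) + t • (y : Plane) ∈ octagon :=
      fun t ht => add_smul_mem_octagon zero_mem_octagon (by simp) ht
    have := apply_segment h (X := 0) (Y := 0) (V := y) hseg
      (fun t ht => by
        rcases eq_or_lt_of_le ht.2 with h | h
        · rw [h]; simpa using hp
        · refine not_isVertex_of_interior fun i => ?_
          have h1 := y.2 i
          rw [zero_add, dotProduct_smul, smul_eq_mul]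
          nlinarith [ht.1])
      hseg (fun _ _ => hc) hy hy
    simpa using this

theorem unique (hΦ : IsAffineAutomorphism Φ M) (hΨ : IsAffineAutomorphism Ψ M) : Φ = Ψ := by
  have h := hΦ.trans hΨ.symm
  rw [inv_mul_cancel] at h
  have h' := h.eq_refl_of_one
  ext p
  have : Ψ.symm (Φ p) = p := by
    have := congrArg (fun f : OctagonSurface ≃ₜ OctagonSurface => f p) h'
    simpa using this
  rw [← this, Ψ.apply_symm_apply, this]

end IsAffineAutomorphism

/-! ### Homeomorphisms of the surface -/

/-- The homeomorphism of the surface given by two mutually inverse continuous maps from the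
octagon to the surface. -/
def surfaceHomeomorph (f g : octagon → OctagonSurface) (hf : Continuous f) (hg : Continuous g)
    (hf' : ∀ x y, Glue x y → f x = f y) (hg' : ∀ x y, Glue x y → g x = g y)
    (hgf : ∀ x, Quot.lift g hg' (f x) = toSurface x)
    (hfg : ∀ x, Quot.lift f hf' (g x) = toSurface x) : OctagonSurface ≃ₜ OctagonSurface where
  toFun := Quot.lift f hf'
  invFun := Quot.lift g hg'
  left_inv := by rintro ⟨x⟩; exact hgf x
  right_inv := by rintro ⟨x⟩; exact hfg x
  continuous_toFun := continuous_quot_lift hf' hf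
  continuous_invFun := continuous_quot_lift hg' hg

theorem continuous_toSurface : Continuous toSurface := continuous_quot_mk

/-! ### Linear symmetries of the octagon -/

/-- An orthogonal matrix which permutes the normals of the sides. -/
structure IsOctagonSymmetry (M : Matrix (Fin 2) (Fin 2) ℝ) (e : Equiv.Perm (Fin 8)) : Prop where
  orthogonal : Mᵀ * M = 1
  mulVec_normal : ∀ k, M *ᵥ normal k = normal (e k)

namespace IsOctagonSymmetry

variable {M : Matrix (Fin 2) (Fin 2) ℝ} {e : Equiv.Perm (Fin 8)}

theorem transpose (h : IsOctagonSymmetry M e) : IsOctagonSymmetry Mᵀ e.symm where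
  orthogonal := by rw [transpose_transpose]; exact mul_eq_one_comm.1 h.orthogonal
  mulVec_normal k := by
    have := h.mulVec_normal (e.symm k)
    rw [e.apply_symm_apply] at this
    rw [← this, mulVec_mulVec, h.orthogonal, one_mulVec]

theorem dot (h : IsOctagonSymmetry M e) (k : Fin 8) (x : Plane) :
    normal (e k) ⬝ᵥ (M *ᵥ x) = normal k ⬝ᵥ x := by
  rw [← h.mulVec_normal, dotProduct_mulVec, ← mulVec_transpose, mulVec_mulVec, h.orthogonal,
    one_mulVec]

theorem mem_octagon (h : IsOctagonSymmetry M e) {x : Plane} (hx : x ∈ octagon) :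
    M *ᵥ x ∈ octagon := fun k => by
  obtain ⟨j, rfl⟩ := e.surjective k
  rw [h.dot]; exact hx j

theorem mem_side (h : IsOctagonSymmetry M e) {x : Plane} {k : Fin 8} (hx : x ∈ side k) :
    M *ᵥ x ∈ side (e k) := ⟨h.mem_octagon hx.1, by rw [h.dot]; exact hx.2⟩

/-- The map from the octagon to the surface induced by a symmetry. -/
def toMap (h : IsOctagonSymmetry M e) (x : octagon) : OctagonSurface :=
  toSurface ⟨M *ᵥ x, h.mem_octagon x.2⟩

theorem continuous_toMap (h : IsOctagonSymmetry M e) : Continuous h.toMap := by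
  refine continuous_toSurface.comp ?_
  fun_prop

theorem toMap_eq (h : IsOctagonSymmetry M e) (x y : octagon) (hxy : Glue x y) :
    h.toMap x = h.toMap y := by
  obtain ⟨i, hi, hy⟩ := hxy
  refine toSurface_eq_of_sub (i := e i) ?_
  change M *ᵥ (y : Plane) = M *ᵥ (x : Plane) - _
  rw [hy, mulVec_sub, mulVec_smul, h.mulVec_normal]

theorem exists_homeomorph (h : IsOctagonSymmetry M e) : ∃ Ψ : OctagonSurface ≃ₜ OctagonSurface,
    ∀ x : octagon, Ψ (toSurface x) = toSurface ⟨M *ᵥ x, h.mem_octagon x.2⟩ :=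
  ⟨surfaceHomeomorph h.toMap h.transpose.toMap h.continuous_toMap h.transpose.continuous_toMap
    h.toMap_eq h.transpose.toMap_eq
    (fun x => by
      change toSurface ⟨Mᵀ *ᵥ (M *ᵥ x), _⟩ = _
      congr 1; apply Subtype.ext
      simp only [mulVec_mulVec, h.orthogonal, one_mulVec])
    (fun x => by
      change toSurface ⟨M *ᵥ (Mᵀ *ᵥ x), _⟩ = _
      congr 1; apply Subtype.ext
      simp only [mulVec_mulVec, mul_eq_one_comm.1 h.orthogonal, one_mulVec]), fun _ => rfl⟩

/-- A symmetry of the octagon induces an affine automorphism which permutes the labels. -/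
theorem exists_automorphism {M : GL (Fin 2) ℝ} (h : IsOctagonSymmetry M e) {ρ : Letter → Letter}
    (hρ : Function.Injective ρ) (hlabel : ∀ k, sideLabel (e k) = ρ (sideLabel k)) :
    ∃ Ψ : OctagonSurface ≃ₜ OctagonSurface, IsAffineAutomorphism Ψ M ∧
      ∀ p L, Ψ p ∈ labelledSide (ρ L) ↔ p ∈ labelledSide L := by
  obtain ⟨Ψ, hΨ⟩ := h.exists_homeomorph
  refine ⟨Ψ, .of_eventually ?_ ?_, ?_⟩
  · intro p hp
    obtain ⟨x, rfl⟩ := exists_rep p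
    rw [toSurface_mem_singularSet] at hp
    rw [hΨ, toSurface_mem_singularSet]
    obtain ⟨i, j, hij, hi, hj⟩ := hp
    exact ⟨e i, e j, e.injective.ne hij, h.mem_side hi, h.mem_side hj⟩
  · intro p _
    refine Eventually.of_forall fun u q => ?_
    rintro ⟨x, y, rfl, rfl, hxy⟩
    exact ⟨_, _, (hΨ x).symm, (hΨ y).symm, by simp [hxy, mulVec_add]⟩
  · intro p L
    constructor
    · rintro ⟨y, i, hi, hy, hyp⟩
      obtain ⟨j, rfl⟩ := e.surjective i
      rw [hlabel] at hi
      have hm := h.transpose.mem_side hy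
      rw [e.symm_apply_apply] at hm
      refine ⟨⟨_, hm.1⟩, j, hρ hi, hm, ?_⟩
      apply Ψ.injective
      rw [hΨ, ← hyp]
      congr 1; apply Subtype.ext
      simp only [mulVec_mulVec, mul_eq_one_comm.1 h.orthogonal, one_mulVec]
    · rintro ⟨x, i, rfl, hx, rfl⟩
      exact ⟨_, e i, hlabel i, h.mem_side hx, (hΨ x).symm⟩

end IsOctagonSymmetry

/-- The permutation of the normals induced by `ν_i`. -/
def nuPerm (i : Fin 8) : Equiv.Perm (Fin 8) :=
  ![Equiv.refl _, Equiv.subLeft 1, Equiv.subRight 1, Equiv.subLeft 2, Equiv.subRight 2,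
    Equiv.subLeft 3, Equiv.subRight 3, Equiv.subLeft 4] i

theorem isOctagonSymmetry_nu (i : Fin 8) : IsOctagonSymmetry (nuGL i) (nuPerm i) := by
  have h := sqrt_two_mul_self
  have h' : (√2)⁻¹ = √2 / 2 := by
    have := sqrt_two_bounds.1
    field_simp; linarith
  have hM : ((nuGL i : GL (Fin 2) ℝ) : Matrix (Fin 2) (Fin 2) ℝ) = nuMatrix i := rfl
  refine ⟨?_, fun k => ?_⟩
  · rw [hM]
    fin_cases i <;> ext a b <;> fin_cases a <;> fin_cases b <;>
      simp [nuMatrix, Matrix.mul_apply, h'] <;> nlinarith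
  · rw [hM, normal_eq, normal_eq]
    fin_cases i <;> fin_cases k <;> ext a <;> fin_cases a <;>
      simp [nuMatrix, nuPerm, Matrix.mulVec, dotProduct, h'] <;> grind

theorem isOctagonSymmetry_neg : IsOctagonSymmetry ((-1 : GL (Fin 2) ℝ) : Matrix (Fin 2) (Fin 2) ℝ)
    (Equiv.addRight 4) := by
  refine ⟨by simp, fun k => ?_⟩
  simp [normal_add_four, neg_mulVec]

theorem relabel_injective (i : Fin 8) : Function.Injective (relabel i) := by
  intro a b
  fin_cases i <;> cases a <;> cases b <;> simp [relabel]

theorem exists_nu_automorphism (i : Fin 8) : ∃ Ψ : OctagonSurface ≃ₜ OctagonSurface,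
    IsAffineAutomorphism Ψ (nuGL i) ∧
      ∀ p L, Ψ p ∈ labelledSide (relabel i L) ↔ p ∈ labelledSide L :=
  (isOctagonSymmetry_nu i).exists_automorphism (relabel_injective i) (by
    intro k; fin_cases i <;> fin_cases k <;> simp [nuPerm, sideLabel, relabel])

theorem exists_neg_automorphism : ∃ Ψ : OctagonSurface ≃ₜ OctagonSurface,
    IsAffineAutomorphism Ψ (-1) ∧ ∀ p L, Ψ p ∈ labelledSide L ↔ p ∈ labelledSide L :=
  isOctagonSymmetry_neg.exists_automorphism Function.injective_id sideLabel_add_four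

/-! ### The affine involution with derivative `γ` -/

/-- The linear map `γ` in coordinates. -/
noncomputable def shearRefl (x : Plane) : Plane := ![-x 0 + 2 * (1 + √2) * x 1, x 1]

theorem gammaGL_mulVec (x : Plane) : (gammaGL : Matrix (Fin 2) (Fin 2) ℝ) *ᵥ x = shearRefl x := by
  have : (gammaGL : Matrix (Fin 2) (Fin 2) ℝ) = !![-1, 2 * (1 + √2); 0, 1] := rfl
  rw [this]
  ext k; fin_cases k <;> simp [shearRefl, Matrix.mulVec, dotProduct]

/-- The part of the octagon in the horizontal cylinder of circumference `2`. -/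
def midZone : Set Plane := {x | x ∈ octagon ∧ x 1 ≤ √2 - 1 ∧ 1 - √2 ≤ x 1}

/-- The upper one of the two trapezoids forming the horizontal cylinder of circumference
`2 √2`. -/
def upZone : Set Plane := {x | x ∈ octagon ∧ √2 - 1 ≤ x 1}

/-- The lower one of the two trapezoids forming the horizontal cylinder of circumference
`2 √2`. -/
def lowZone : Set Plane := {x | x ∈ octagon ∧ x 1 ≤ 1 - √2}

/-- `unroll x X` says that `X` is the position of the point `x` of a trapezoid in the strip
`√2 - 1 ≤ y ≤ 1` that covers the second horizontal cylinder. -/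
def Unroll (x X : Plane) : Prop :=
  -- The shift is `2 • normal 1`: the two trapezoids are laid side by side along the sides labelled
  -- B.
  (x ∈ upZone ∧ X = x) ∨ (x ∈ lowZone ∧ X = x + ![√2, √2])

/-- `x` is mapped to `x'` by `γ` in the first horizontal cylinder. -/
def MidMove (x x' : Plane) : Prop :=
  -- At the heights ±(√2 - 1) the shear displaces by ±2, one circumference, so on the boundary the
  -- map is (x, y) ↦ (-x, y).
  x ∈ midZone ∧ x' ∈ midZone ∧ ∃ k : ℤ, x' = shearRefl x + ![(2 : ℝ) * k, 0]

/-- `x` is mapped to `x'` by `γ` in the second horizontal cylinder. -/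
def OuterMove (x x' : Plane) : Prop :=
  -- The constant -2 makes the map (x, y) ↦ (-x, y) at height √2 - 1; up to height 1 the shear gains
  -- 2√2, again one circumference. So the two cylinder maps agree on their common boundary.
  ∃ X X', Unroll x X ∧ Unroll x' X' ∧ ∃ k : ℤ, X' = shearRefl X + ![-2 + 2 * √2 * k, 0]

/-- The graph of the involution on the octagon. -/
def Move (x x' : octagon) : Prop := MidMove x x' ∨ OuterMove x x'

theorem Move.symm {x x' : octagon} (h : Move x x') : Move x' x := by
  rcases h with ⟨h1, h2, k, h⟩ | ⟨X, X', h1, h2, k, h⟩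
  · refine Or.inl ⟨h2, h1, k, ?_⟩
    rw [h]; ext i; fin_cases i <;> simp [shearRefl]; ring
  · refine Or.inr ⟨X', X, h2, h1, k, ?_⟩
    rw [h]; ext i; fin_cases i <;> simp [shearRefl]; ring

theorem toSurface_eq_of_mid {x y : octagon} {k : ℤ} (h : (y : Plane) = x + ![(2 : ℝ) * k, 0]) : toSurface x = toSurface y := by
  have hx' := mem_octagon_iff.1 x.2
  have hy' := mem_octagon_iff.1 y.2
  have h0 : (y : Plane) 0 = (x : Plane) 0 + 2 * k := by rw [h]; simp
  have hk : k ≤ 1 := by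
    have : (k : ℝ) ≤ 1 := by linarith
    exact_mod_cast this
  have hk' : -1 ≤ k := by
    have : (-1 : ℝ) ≤ k := by linarith
    exact_mod_cast this
  obtain rfl | rfl | rfl : k = -1 ∨ k = 0 ∨ k = 1 := by omega
  · refine toSurface_eq_of_sub (i := 0) ?_
    rw [h, normal_eq]; ext i; fin_cases i <;> simp; ring
  · congr 1; apply Subtype.ext
    rw [h]; ext i; fin_cases i <;> simp
  · refine toSurface_eq_of_sub (i := 4) ?_
    rw [h, normal_eq]; ext i; fin_cases i <;> simp

/-- Translates of the two trapezoids alternate along the strip. Their widths leave only `k = 0` or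
`k = ±1`: equality of the points or a gluing along a slanted side. -/
theorem toSurface_eq_of_outer {x y : octagon} {X Y : Plane} (hx : Unroll x X) (hy : Unroll y Y)
    {k : ℤ} (h : Y = X + ![2 * √2 * k, 0]) : toSurface x = toSurface y := by
  have hb := sqrt_two_bounds
  have hs := sqrt_two_mul_self
  have hx' := mem_octagon_iff.1 x.2
  have hy' := mem_octagon_iff.1 y.2
  have h0 : Y 0 = X 0 + 2 * √2 * k := by rw [h]; simp
  have h1 : Y 1 = X 1 := by rw [h]; simp
  have hlt : ∀ {m : ℤ} {n : ℤ}, √2 * m < √2 * n → m < n := fun {m n} h => by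
    have := lt_of_mul_lt_mul_left h (by linarith)
    exact_mod_cast this
  rcases hx with ⟨hx, rfl⟩ | ⟨hx, rfl⟩ <;> rcases hy with ⟨hy, rfl⟩ | ⟨hy, rfl⟩
  · have a1 : k < 1 := hlt (by push_cast; nlinarith)
    have a2 : -1 < k := hlt (by push_cast; nlinarith)
    obtain rfl : k = 0 := by omega
    congr 1; apply Subtype.ext
    rw [h]; ext i; fin_cases i <;> simp
  · simp at h0 h1
    have a1 : k < 2 := hlt (by push_cast; nlinarith)
    have a2 : -1 < k := hlt (by push_cast; nlinarith)
    obtain rfl | rfl : k = 0 ∨ k = 1 := by omega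
    · refine toSurface_eq_of_sub (i := 1) ?_
      rw [normal_eq]
      simp at h0
      ext i; fin_cases i <;> simp <;> linarith
    · refine toSurface_eq_of_sub (i := 3) ?_
      rw [normal_eq]
      simp at h0
      ext i; fin_cases i <;> simp <;> linarith
  · simp at h0 h1
    have a1 : k < 1 := hlt (by push_cast; nlinarith)
    have a2 : -2 < k := hlt (by push_cast; nlinarith)
    obtain rfl | rfl : k = 0 ∨ k = -1 := by omega
    · refine toSurface_eq_of_sub (i := 5) ?_
      rw [normal_eq]
      simp at h0
      ext i; fin_cases i <;> simp <;> linarith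
    · refine toSurface_eq_of_sub (i := 7) ?_
      rw [normal_eq]
      simp at h0
      ext i; fin_cases i <;> simp <;> linarith
  · simp at h0 h1
    have a1 : k < 1 := hlt (by push_cast; nlinarith)
    have a2 : -1 < k := hlt (by push_cast; nlinarith)
    obtain rfl : k = 0 := by omega
    simp at h0
    congr 1; apply Subtype.ext
    ext i; fin_cases i <;> simp <;> linarith

theorem MidMove.toSurface_eq {x x' y y' : octagon} (hx : MidMove x x') (hy : MidMove y y') {m : ℤ}
    (h : (y : Plane) = x + ![(2 : ℝ) * m, 0]) : toSurface x' = toSurface y' := by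
  obtain ⟨-, -, k, hk⟩ := hx
  obtain ⟨-, -, l, hl⟩ := hy
  refine toSurface_eq_of_mid (k := l - k - m) ?_
  rw [hl, hk, h]
  ext i; fin_cases i <;> simp [shearRefl]; ring

theorem OuterMove.toSurface_eq {x x' y y' : octagon} (hx : OuterMove x x') (hy : OuterMove y y')
    (h : ∃ X Y, Unroll x X ∧ Unroll y Y ∧ ∃ m : ℤ, Y = X + ![2 * √2 * m, 0]) :
    toSurface x' = toSurface y' := by
  have hb := sqrt_two_bounds
  have huniq : ∀ {x X X' : Plane}, Unroll x X → Unroll x X' → X = X' := by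
    rintro x X X' (⟨h1, rfl⟩ | ⟨h1, rfl⟩) (⟨h2, rfl⟩ | ⟨h2, rfl⟩)
    · rfl
    · linarith [h1.2, h2.2]
    · linarith [h1.2, h2.2]
    · rfl
  obtain ⟨X, X', h1, h2, k, hk⟩ := hx
  obtain ⟨Y, Y', h3, h4, l, hl⟩ := hy
  obtain ⟨X₁, Y₁, h5, h6, m, hm⟩ := h
  rw [← huniq h1 h5, ← huniq h3 h6] at hm
  refine toSurface_eq_of_outer h2 h4 (k := l - k - m) ?_
  rw [hl, hk, hm]
  ext i; fin_cases i <;> simp [shearRefl]; ring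

theorem neg_fst_mem_octagon {x : Plane} (hx : x ∈ octagon) : ![-x 0, x 1] ∈ octagon := by
  rw [mem_octagon_iff] at hx ⊢
  obtain ⟨h0, h1, h2, h3, h4, h5, h6, h7⟩ := hx
  refine ⟨?_, ?_, ?_, ?_, ?_, ?_, ?_, ?_⟩ <;> simp <;> linarith

/-- Both rules apply only at the heights ±(√2 - 1), where both allow the mirror image (-x₀, x₁); it
serves as intermediate point. -/
theorem Move.toSurface_eq_of_eq {x x' y' : octagon} (hx : Move x x') (hy : Move x y') :
    toSurface x' = toSurface y' := by
  have hb := sqrt_two_bounds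
  have hs := sqrt_two_mul_self
  have key : ∀ {x' y' : octagon}, MidMove x x' → OuterMove x y' → toSurface x' = toSurface y' := by
    intro x' y' hx hy
    have hm := hx.1
    have hu : ∃ X, Unroll x X := let ⟨X, _, h, _⟩ := hy; ⟨X, h⟩
    obtain ⟨X, hX⟩ := hu
    obtain ⟨z, h1, h2⟩ : ∃ z : octagon, MidMove x z ∧ OuterMove x z := by
      refine ⟨⟨![-(x : Plane) 0, (x : Plane) 1], neg_fst_mem_octagon x.2⟩, ?_, ?_⟩
      · refine ⟨hm, ⟨neg_fst_mem_octagon x.2, by simpa using hm.2⟩, ?_⟩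
        rcases hX with ⟨hX, rfl⟩ | ⟨hX, rfl⟩
        · have h1 : (x : Plane) 1 = √2 - 1 := le_antisymm hm.2.1 hX.2
          refine ⟨-1, ?_⟩
          ext i; fin_cases i <;> simp [shearRefl, h1]; linarith
        · have h1 : (x : Plane) 1 = 1 - √2 := le_antisymm hX.2 hm.2.2
          refine ⟨1, ?_⟩
          ext i; fin_cases i <;> simp [shearRefl, h1]; linarith
      · rcases hX with ⟨hX, rfl⟩ | ⟨hX, rfl⟩
        · have h1 : (x : Plane) 1 = √2 - 1 := le_antisymm hm.2.1 hX.2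
          refine ⟨_, _, Or.inl ⟨hX, rfl⟩, Or.inl ⟨⟨neg_fst_mem_octagon x.2, by simpa using hX.2⟩, rfl⟩, 0, ?_⟩
          ext i; fin_cases i <;> simp [shearRefl, h1]; linarith
        · have h1 : (x : Plane) 1 = 1 - √2 := le_antisymm hX.2 hm.2.2
          refine ⟨_, _, Or.inr ⟨hX, rfl⟩, Or.inr ⟨⟨neg_fst_mem_octagon x.2, by simpa using hX.2⟩, rfl⟩, 0, ?_⟩
          ext i; fin_cases i <;> simp [shearRefl, h1]; linarith
    exact (hx.toSurface_eq h1 (m := 0) (by ext i; fin_cases i <;> simp)).trans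
      (h2.toSurface_eq hy ⟨X, X, hX, hX, 0, by ext i; fin_cases i <;> simp⟩)
  rcases hx with hx | hx <;> rcases hy with hy | hy
  · exact hx.toSurface_eq hy (m := 0) (by ext i; fin_cases i <;> simp)
  · exact key hx hy
  · exact (key hy hx).symm
  · obtain ⟨X, _, hX, _⟩ := id hx
    exact hx.toSurface_eq hy ⟨X, X, hX, hX, 0, by ext i; fin_cases i <;> simp⟩

/-! The nine pieces on which the involution is a single affine map. -/

/-- The zones of the octagon. -/
def zone : Fin 3 → Set Plane := ![midZone, upZone, lowZone]

theorem isClosed_zone (i : Fin 3) : IsClosed (zone i) := by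
  have hO : IsClosed octagon := by
    have : octagon = ⋂ i, {x | normal i ⬝ᵥ x ≤ 1} := by ext x; simp [octagon]
    rw [this]
    exact isClosed_iInter fun i => isClosed_le (continuous_dot _) continuous_const
  have h1 : Continuous fun x : Plane => x 1 := by fun_prop
  fin_cases i
  · exact hO.inter ((isClosed_le h1 continuous_const).inter (isClosed_le continuous_const h1))
  · exact hO.inter (isClosed_le continuous_const h1)
  · exact hO.inter (isClosed_le h1 continuous_const)

/-- The translation parts of the affine pieces. -/
noncomputable def pieceShift : Fin 9 → Plane :=
  ![![2, 0], ![0, 0], ![-2, 0],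
    ![-2, 0], ![-2 - √2, -√2], ![-2 - 2 * √2, 0],
    ![2, 0], ![2 + √2, √2], ![2 + 2 * √2, 0]]

/-- The domains of the affine pieces. -/
def piece (j : Fin 9) : Set octagon :=
  {x | (x : Plane) ∈ zone (![0, 0, 0, 1, 1, 1, 2, 2, 2] j) ∧
    shearRefl x + pieceShift j ∈ zone (![0, 0, 0, 1, 2, 1, 2, 1, 2] j)}

theorem zone_subset (i : Fin 3) : zone i ⊆ octagon := by
  intro x hx; fin_cases i <;> exact hx.1

theorem continuous_shearRefl : Continuous shearRefl := by
  refine continuous_pi fun k => ?_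
  fin_cases k <;> simp only [shearRefl] <;> simp <;> fun_prop

theorem isClosed_piece (j : Fin 9) : IsClosed (piece j) :=
  ((isClosed_zone _).preimage continuous_subtype_val).inter ((isClosed_zone _).preimage
    ((continuous_shearRefl.comp continuous_subtype_val).add continuous_const))

/-- In the unrolled strip the abscissa `X` of the image ranges from y - √2 to 3√2 - y. The lines X +
y = √2 and X - y = √2 cut this range into an upper, a lower and another upper trapezoid. -/
theorem exists_piece_up {x : Plane} (hx : x ∈ upZone) :
    shearRefl x + ![-2, 0] ∈ upZone ∨ shearRefl x + ![-2 - √2, -√2] ∈ lowZone ∨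
      shearRefl x + ![-2 - 2 * √2, 0] ∈ upZone := by
  have hb := sqrt_two_bounds
  have hs := sqrt_two_mul_self
  obtain ⟨hO, hy⟩ := hx
  obtain ⟨h0, h1, h2, h3, h4, h5, h6, h7⟩ := mem_octagon_iff.1 hO
  have a1 : 1 ≤ (1 + √2) * x 1 := by nlinarith
  have a2 : (1 + √2) * x 1 ≤ 1 + √2 := by nlinarith
  set X := -x 0 + 2 * (1 + √2) * x 1 - 2 with hX
  have e0 : shearRefl x 0 = X + 2 := by simp [shearRefl, hX]
  have e1 : shearRefl x 1 = x 1 := by simp [shearRefl]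
  have b1 : x 1 - X ≤ √2 := by linarith
  have b2 : X + x 1 ≤ 3 * √2 := by linarith
  rcases le_total (X + x 1) √2 with d1 | d1
  · left
    refine ⟨mem_octagon_iff.2 ?_, ?_⟩ <;> simp [e0, e1]
    · refine ⟨?_, ?_, ?_, ?_, ?_, ?_, ?_, ?_⟩ <;> linarith
    · linarith
  rcases le_total (X - x 1) √2 with d2 | d2
  · right; left
    refine ⟨mem_octagon_iff.2 ?_, ?_⟩ <;> simp [e0, e1]
    · refine ⟨?_, ?_, ?_, ?_, ?_, ?_, ?_, ?_⟩ <;> linarith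
    · linarith
  · right; right
    refine ⟨mem_octagon_iff.2 ?_, ?_⟩ <;> simp [e0, e1]
    · refine ⟨?_, ?_, ?_, ?_, ?_, ?_, ?_, ?_⟩ <;> linarith
    · linarith

theorem neg_mem_octagon {x : Plane} (hx : x ∈ octagon) : -x ∈ octagon := fun k => by
  have := dot_ge_neg_one hx k
  rw [dotProduct_neg]; linarith

theorem neg_mem_lowZone {x : Plane} (hx : x ∈ upZone) : -x ∈ lowZone :=
  ⟨neg_mem_octagon hx.1, by have := hx.2; simp; linarith⟩

theorem neg_mem_upZone {x : Plane} (hx : x ∈ lowZone) : -x ∈ upZone :=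
  ⟨neg_mem_octagon hx.1, by have := hx.2; simp; linarith⟩

theorem exists_piece_mid {x : Plane} (hx : x ∈ midZone) : shearRefl x + ![2, 0] ∈ midZone ∨
    shearRefl x + ![0, 0] ∈ midZone ∨ shearRefl x + ![-2, 0] ∈ midZone := by
  have hb := sqrt_two_bounds
  have hs := sqrt_two_mul_self
  obtain ⟨hO, c1, c2⟩ := hx
  obtain ⟨h0, h1, h2, h3, h4, h5, h6, h7⟩ := mem_octagon_iff.1 hO
  have hr : (1 + √2) * (√2 - 1) = 1 := by linarith
  have hy : (1 + √2) * x 1 ≤ 1 := by nlinarith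
  have hy' : -1 ≤ (1 + √2) * x 1 := by nlinarith
  have key : ∀ s : ℝ, -x 0 + 2 * (1 + √2) * x 1 + s ≤ 1 → -1 ≤ -x 0 + 2 * (1 + √2) * x 1 + s →
      shearRefl x + ![s, 0] ∈ midZone := fun s h h' => by
    refine ⟨mem_octagon_iff.2 ?_, ?_, ?_⟩ <;> simp [shearRefl]
    · refine ⟨h, ?_, ?_, ?_, h', ?_, ?_, ?_⟩ <;> linarith
    · linarith
    · linarith
  rcases le_total (-x 0 + 2 * (1 + √2) * x 1) (-1) with d1 | d1
  · exact Or.inl (key 2 (by linarith) (by linarith))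
  rcases le_total (-x 0 + 2 * (1 + √2) * x 1) 1 with d2 | d2
  · exact Or.inr (Or.inl (key 0 (by linarith) (by linarith)))
  · exact Or.inr (Or.inr (key (-2) (by linarith) (by linarith)))

theorem exists_piece_low {x : Plane} (hx : x ∈ lowZone) :
    shearRefl x + ![2, 0] ∈ lowZone ∨ shearRefl x + ![2 + √2, √2] ∈ upZone ∨
      shearRefl x + ![2 + 2 * √2, 0] ∈ lowZone := by
  have key : ∀ v w : Plane, w = -v → shearRefl x + w = -(shearRefl (-x) + v) := by
    rintro v w rfl
    ext i; fin_cases i <;> simp only [shearRefl, Pi.add_apply, Pi.neg_apply] <;> simp <;> ring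
  rcases exists_piece_up (neg_mem_upZone hx) with h | h | h
  · have := neg_mem_lowZone h
    rw [← key _ ![2, 0] (by ext i; fin_cases i <;> simp)] at this
    exact Or.inl this
  · have := neg_mem_upZone h
    rw [← key _ ![2 + √2, √2] (by ext i; fin_cases i <;> simp; ring)] at this
    exact Or.inr (Or.inl this)
  · have := neg_mem_lowZone h
    rw [← key _ ![2 + 2 * √2, 0] (by ext i; fin_cases i <;> simp; ring)] at this
    exact Or.inr (Or.inr this)

theorem exists_piece (x : octagon) : ∃ j, x ∈ piece j := by
  by_cases c1 : (x : Plane) 1 ≤ √2 - 1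
  · by_cases c2 : 1 - √2 ≤ (x : Plane) 1
    · have hm : (x : Plane) ∈ midZone := ⟨x.2, c1, c2⟩
      rcases exists_piece_mid hm with h | h | h
      exacts [⟨0, hm, h⟩, ⟨1, hm, h⟩, ⟨2, hm, h⟩]
    · have hl : (x : Plane) ∈ lowZone := ⟨x.2, by linarith⟩
      rcases exists_piece_low hl with h | h | h
      exacts [⟨6, hl, h⟩, ⟨7, hl, h⟩, ⟨8, hl, h⟩]
  · have hu : (x : Plane) ∈ upZone := ⟨x.2, by linarith⟩
    rcases exists_piece_up hu with h | h | h
    exacts [⟨3, hu, h⟩, ⟨4, hu, h⟩, ⟨5, hu, h⟩]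

/-- The image of a point under one of the affine pieces. -/
noncomputable def pieceMap (j : Fin 9) (x : piece j) : octagon :=
  ⟨shearRefl x + pieceShift j, zone_subset _ x.2.2⟩

theorem continuous_pieceMap (j : Fin 9) : Continuous (pieceMap j) :=
  Continuous.subtype_mk ((continuous_shearRefl.comp
    (continuous_subtype_val.comp continuous_subtype_val)).add continuous_const) _

theorem move_pieceMap (j : Fin 9) (x : piece j) : Move x (pieceMap j x) := by
  have hs := sqrt_two_mul_self
  obtain ⟨h1, h2⟩ := x.2
  have key : ∀ {v w : Plane}, v 0 = w 0 → v 1 = w 1 → v = w := fun h h' => by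
    ext i; fin_cases i; exacts [h, h']
  have e : ((pieceMap j x : octagon) : Plane) = shearRefl x + pieceShift j := rfl
  fin_cases j
  · exact Or.inl ⟨h1, h2, 1, by rw [e]; apply key <;> simp [pieceShift]⟩
  · exact Or.inl ⟨h1, h2, 0, by rw [e]; apply key <;> simp [pieceShift]⟩
  · exact Or.inl ⟨h1, h2, -1, by rw [e]; apply key <;> simp [pieceShift]⟩
  · exact Or.inr ⟨_, _, Or.inl ⟨h1, rfl⟩, Or.inl ⟨h2, rfl⟩, 0,
      by apply key <;> simp [pieceMap, pieceShift, shearRefl]⟩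
  · exact Or.inr ⟨_, _, Or.inl ⟨h1, rfl⟩, Or.inr ⟨h2, rfl⟩, 0,
      by apply key <;> simp [pieceMap, pieceShift, shearRefl]; ring⟩
  · exact Or.inr ⟨_, _, Or.inl ⟨h1, rfl⟩, Or.inl ⟨h2, rfl⟩, -1,
      by apply key <;> simp [pieceMap, pieceShift, shearRefl]; ring⟩
  · exact Or.inr ⟨_, _, Or.inr ⟨h1, rfl⟩, Or.inr ⟨h2, rfl⟩, 0,
      by apply key <;> simp [pieceMap, pieceShift, shearRefl]; linarith⟩
  · exact Or.inr ⟨_, _, Or.inr ⟨h1, rfl⟩, Or.inl ⟨h2, rfl⟩, 0,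
      by apply key <;> simp [pieceMap, pieceShift, shearRefl]; linarith⟩
  · exact Or.inr ⟨_, _, Or.inr ⟨h1, rfl⟩, Or.inr ⟨h2, rfl⟩, 1,
      by apply key <;> simp [pieceMap, pieceShift, shearRefl]; linarith⟩

theorem exists_midMove {x : octagon} (h : (x : Plane) ∈ midZone) : ∃ x' : octagon, MidMove x x' := by
  rcases exists_piece_mid h with h' | h' | h'
  · exact ⟨⟨_, h'.1⟩, h, h', 1, by simp⟩
  · exact ⟨⟨_, h'.1⟩, h, h', 0, by simp⟩
  · exact ⟨⟨_, h'.1⟩, h, h', -1, by simp⟩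

theorem exists_outerMove {x : octagon} {X : Plane} (h : Unroll x X) :
    ∃ x' : octagon, OuterMove x x' := by
  have hs := sqrt_two_mul_self
  have key : ∀ {v w : Plane}, v 0 = w 0 → v 1 = w 1 → v = w := fun h h' => by
    ext i; fin_cases i; exacts [h, h']
  rcases h with ⟨h, -⟩ | ⟨h, -⟩
  · rcases exists_piece_up h with h' | h' | h'
    · exact ⟨⟨_, h'.1⟩, _, _, Or.inl ⟨h, rfl⟩, Or.inl ⟨h', rfl⟩, 0,
        by apply key <;> simp [shearRefl]⟩
    · exact ⟨⟨_, h'.1⟩, _, _, Or.inl ⟨h, rfl⟩, Or.inr ⟨h', rfl⟩, 0,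
        by apply key <;> simp [shearRefl]; ring⟩
    · exact ⟨⟨_, h'.1⟩, _, _, Or.inl ⟨h, rfl⟩, Or.inl ⟨h', rfl⟩, -1,
        by apply key <;> simp [shearRefl]; ring⟩
  · rcases exists_piece_low h with h' | h' | h'
    · exact ⟨⟨_, h'.1⟩, _, _, Or.inr ⟨h, rfl⟩, Or.inr ⟨h', rfl⟩, 0,
        by apply key <;> simp [shearRefl]; linarith⟩
    · exact ⟨⟨_, h'.1⟩, _, _, Or.inr ⟨h, rfl⟩, Or.inl ⟨h', rfl⟩, 0,
        by apply key <;> simp [shearRefl]; linarith⟩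
    · exact ⟨⟨_, h'.1⟩, _, _, Or.inr ⟨h, rfl⟩, Or.inr ⟨h', rfl⟩, 1,
        by apply key <;> simp [shearRefl]; linarith⟩

theorem exists_move (x : octagon) : ∃ x', Move x x' :=
  let ⟨j, hj⟩ := exists_piece x
  ⟨_, move_pieceMap j ⟨x, hj⟩⟩

/-- The involution as a map from the octagon to the surface. -/
noncomputable def moveMap (x : octagon) : OctagonSurface := toSurface (exists_move x).choose

theorem moveMap_eq {x x' : octagon} (h : Move x x') : moveMap x = toSurface x' :=
  (exists_move x).choose_spec.toSurface_eq_of_eq h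

theorem continuous_moveMap : Continuous moveMap := by
  refine (locallyFinite_of_finite piece).continuous ?_ isClosed_piece fun j => ?_
  · ext x; simpa using exists_piece x
  · rw [continuousOn_iff_continuous_domRestrict]
    have : (piece j).domRestrict moveMap = toSurface ∘ pieceMap j := by
      ext x; exact moveMap_eq (move_pieceMap j x)
    rw [this]
    exact continuous_toSurface.comp (continuous_pieceMap j)

/-- The vertical and slanted sides lie inside a cylinder, where gluing is absorbed by the
translations allowed in the rule. On the horizontal sides the map is (x, y) ↦ (-x, y), which
commutes with the gluing. -/
theorem moveMap_eq_of_glue (x y : octagon) (h : Glue x y) : moveMap x = moveMap y := by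
  have hb := sqrt_two_bounds
  have hs := sqrt_two_mul_self
  have key : ∀ {v w : Plane}, v 0 = w 0 → v 1 = w 1 → v = w := fun h h' => by
    ext i; fin_cases i; exacts [h, h']
  have outer : ∀ {x y : octagon} {X Y : Plane}, Unroll x X → Unroll y Y →
      (∃ m : ℤ, Y = X + ![2 * √2 * m, 0]) → moveMap x = moveMap y := by
    intro x y X Y hx hy hm
    obtain ⟨x', hx'⟩ := exists_outerMove hx
    obtain ⟨y', hy'⟩ := exists_outerMove hy
    rw [moveMap_eq (Or.inr hx'), moveMap_eq (Or.inr hy')]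
    exact hx'.toSurface_eq hy' ⟨X, Y, hx, hy, hm⟩
  have main : ∀ (i : Fin 8), i < 4 → ∀ x y : octagon, (x : Plane) ∈ side i →
      (y : Plane) = x - (2 : ℝ) • normal i → moveMap x = moveMap y := by
    intro i hi4 x y hi hy
    obtain ⟨h0, h1, h2, h3, h4, h5, h6, h7⟩ := mem_octagon_iff.1 x.2
    obtain ⟨k0, k1, k2, k3, k4, k5, k6, k7⟩ := mem_octagon_iff.1 y.2
    have hx1 := hi.2
    have y0 : (y : Plane) 0 = (x : Plane) 0 - 2 * normal i 0 := by rw [hy]; simp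
    have y1 : (y : Plane) 1 = (x : Plane) 1 - 2 * normal i 1 := by rw [hy]; simp
    rw [normal_dot] at hx1
    rw [normal_eq] at y0 y1
    have hcases : ∀ i : Fin 8, i < 4 → i = 0 ∨ i = 1 ∨ i = 2 ∨ i = 3 := by decide
    obtain rfl | rfl | rfl | rfl := hcases i hi4
    · simp at hx1 y0 y1
      have hx : (x : Plane) ∈ midZone := ⟨x.2, by linarith, by linarith⟩
      have hy' : (y : Plane) ∈ midZone := ⟨y.2, by linarith, by linarith⟩
      obtain ⟨x', hx'⟩ := exists_midMove hx
      obtain ⟨y', hy'⟩ := exists_midMove hy'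
      rw [moveMap_eq (Or.inl hx'), moveMap_eq (Or.inl hy')]
      refine hx'.toSurface_eq hy' (m := -1) ?_
      apply key <;> simp [y0, y1]; ring
    · simp [half_sqrt_two_mul_eq] at hx1 y0 y1
      refine outer (Or.inl ⟨⟨x.2, by linarith⟩, rfl⟩) (Or.inr ⟨⟨y.2, by linarith⟩, rfl⟩) ⟨0, ?_⟩
      apply key <;> simp [y0, y1] <;> ring
    · simp at hx1 y0 y1
      have m1 : Move x ⟨![-(x : Plane) 0, (x : Plane) 1], neg_fst_mem_octagon x.2⟩ := by
        refine Or.inr ⟨_, _, Or.inl ⟨⟨x.2, by linarith⟩, rfl⟩,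
          Or.inl ⟨⟨neg_fst_mem_octagon x.2, by simp; linarith⟩, rfl⟩, -1, ?_⟩
        apply key <;> simp [shearRefl, hx1]; ring
      have m2 : Move y ⟨![-(y : Plane) 0, (y : Plane) 1], neg_fst_mem_octagon y.2⟩ := by
        refine Or.inr ⟨_, _, Or.inr ⟨⟨y.2, by linarith⟩, rfl⟩,
          Or.inr ⟨⟨neg_fst_mem_octagon y.2, by simp; linarith⟩, rfl⟩, 1, ?_⟩
        apply key <;> simp [shearRefl, hx1, y0, y1]; linarith
      rw [moveMap_eq m1, moveMap_eq m2]
      refine toSurface_eq_of_sub (i := 2) ?_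
      rw [normal_eq]
      apply key <;> simp [hx1, y0, y1]
    · simp [half_sqrt_two_mul_eq] at hx1 y0 y1
      refine outer (Or.inl ⟨⟨x.2, by linarith⟩, rfl⟩) (Or.inr ⟨⟨y.2, by linarith⟩, rfl⟩) ⟨1, ?_⟩
      apply key <;> simp [y0, y1] <;> ring
  obtain ⟨i, hi, hy⟩ := h
  by_cases h4 : i < 4
  · exact main i h4 x y hi hy
  · have hcases : ∀ i : Fin 8, ¬ i < 4 → i + 4 < 4 := by decide
    refine (main (i + 4) (hcases i h4) y x ?_ ?_).symm
    · rw [hy]; exact sub_two_normal_mem_side hi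
    · rw [hy, normal_add_four]; simp

theorem lift_moveMap (x x' : octagon) (h : Move x x') :
    Quot.lift moveMap moveMap_eq_of_glue (toSurface x) = toSurface x' := moveMap_eq h

/-- The affine involution of the surface with derivative `γ`. -/
noncomputable def involution : OctagonSurface ≃ₜ OctagonSurface :=
  surfaceHomeomorph moveMap moveMap continuous_moveMap continuous_moveMap moveMap_eq_of_glue
    moveMap_eq_of_glue
    (fun x => by
      obtain ⟨x', h⟩ := exists_move x
      rw [moveMap_eq h]; exact lift_moveMap _ _ h.symm)
    (fun x => by
      obtain ⟨x', h⟩ := exists_move x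
      rw [moveMap_eq h]; exact lift_moveMap _ _ h.symm)

theorem involution_toSurface {x x' : octagon} (h : Move x x') :
    involution (toSurface x) = toSurface x' := moveMap_eq h

theorem isAffineAutomorphism_involution : IsAffineAutomorphism involution gammaGL := by
  have hb := sqrt_two_bounds
  have hs := sqrt_two_mul_self
  refine .of_eventually (fun p hp => ?_) fun p hp => ?_
  · have h0 : toSurface ⟨vertex 0, vertex_mem_octagon 0⟩ ∈ singularSet :=
      toSurface_mem_singularSet.2 (isVertex_vertex 0)
    rw [singularSet_subsingleton hp h0]
    have hm : vertex 0 ∈ midZone :=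
      ⟨vertex_mem_octagon 0, by rw [vertex_eq]; simp, by rw [vertex_eq]; simp; linarith⟩
    have : Move ⟨vertex 0, vertex_mem_octagon 0⟩ ⟨vertex 0, vertex_mem_octagon 0⟩ := by
      refine Or.inl ⟨hm, hm, 0, ?_⟩
      ext i; fin_cases i <;> simp [shearRefl, vertex_eq]; linarith
    rw [involution_toSurface this]
    exact h0
  -- Pieces are closed, so for small `u` each piece containing `x + u` contains `x`. Both points are
  -- then moved by one affine formula, even when `x` lies where pieces meet.
  · have hsmall : ∀ᶠ u in 𝓝 (0 : Plane), ∀ x : octagon, toSurface x = p →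
        ∀ j, ∀ y : octagon, (y : Plane) = x + u → y ∈ piece j → x ∈ piece j := by
      refine eventually_reps hp (P := fun x u => ∀ j, ∀ y : octagon, (y : Plane) = x + u →
        y ∈ piece j → ∀ hx : x ∈ octagon, (⟨x, hx⟩ : octagon) ∈ piece j) (fun x _ => ?_) |>.mono
          fun u hu x hx j y hy hj => hu x hx j y hy hj x.2
      refine eventually_all.2 fun j => ?_
      by_cases hxj : x ∈ piece j
      · exact Eventually.of_forall fun _ _ _ _ _ => hxj
      · obtain ⟨ε, hε, hε'⟩ := Metric.isOpen_iff.1 (isClosed_piece j).isOpen_compl x hxj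
        filter_upwards [Metric.ball_mem_nhds (0 : Plane) hε] with u hu y hy hyj
        refine absurd hyj (hε' ?_)
        rw [Metric.mem_ball, Subtype.dist_eq, hy]
        simpa using hu
    filter_upwards [hsmall] with u hu q
    rintro ⟨x, y, hx, rfl, hy⟩
    obtain ⟨j, hj⟩ := exists_piece y
    have hxj := hu x hx j y hy hj
    refine ⟨pieceMap j ⟨x, hxj⟩, _, ?_, (involution_toSurface (move_pieceMap j ⟨y, hj⟩)).symm, ?_⟩
    · rw [← hx]; exact (involution_toSurface (move_pieceMap j ⟨x, hxj⟩)).symm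
    · rw [gammaGL_mulVec]
      change shearRefl y + _ = shearRefl x + _ + _
      rw [hy]
      ext i; fin_cases i <;> simp only [shearRefl, Pi.add_apply] <;> simp <;> ring

/-! ### The images of the sides under the involution -/

/-- The side with a given label through which trajectories in directions `(0, π/8)` leave the
octagon. -/
def outSide : Letter → Fin 8
  | .A => 2
  | .B => 1
  | .C => 0
  | .D => 7

/-- Half of the vector of the image of a side under the involution. -/
noncomputable def halfDiag : Letter → Plane
  -- A default value: side A is preserved and treated separately.
  | .A => 0
  | .B => ![1 + √2 / 2, 1 - √2 / 2]
  | .C => ![2, √2 - 1]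
  | .D => ![3 * √2 / 2 - 1, 1 - √2 / 2]

/-- Half of the vector of a side. -/
noncomputable def halfSide : Letter → Plane
  | .A => 0
  | .B => ![√2 / 2 - 1, 1 - √2 / 2]
  | .C => ![0, √2 - 1]
  | .D => ![1 - √2 / 2, 1 - √2 / 2]

theorem plane_ext {v w : Plane} (h : v 0 = w 0) (h' : v 1 = w 1) : v = w := by
  ext i; fin_cases i; exacts [h, h']

theorem sideLabel_outSide (L : Letter) : sideLabel (outSide L) = L := by
  cases L <;> rfl

theorem eq_outSide {i : Fin 8} : i = outSide (sideLabel i) ∨ i = outSide (sideLabel i) + 4 := by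
  fin_cases i <;> simp [sideLabel, outSide]

theorem add_halfSide_mem_side {L : Letter} (hL : L ≠ .A) {μ : ℝ} (hμ : μ ∈ Set.Icc (-1 : ℝ) 1) :
    normal (outSide L) + μ • halfSide L ∈ side (outSide L) := by
  have hb := sqrt_two_bounds
  have hs := sqrt_two_mul_self
  obtain ⟨h1, h2⟩ := hμ
  refine ⟨mem_octagon_iff.2 ?_, ?_⟩
  · cases L
    · exact absurd rfl hL
    all_goals
      refine ⟨?_, ?_, ?_, ?_, ?_, ?_, ?_, ?_⟩ <;> simp [outSide, halfSide, normal_eq] <;> nlinarith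
  · rw [normal_dot]
    cases L <;> simp [outSide, halfSide, normal_eq] at hL ⊢ <;> linarith

/-- The parameter is read off from the height: 2 + √2 and 1 + √2 are the reciprocals of the second
coordinates of `halfSide L`. -/
theorem exists_eq_add_halfSide {L : Letter} (hL : L ≠ .A) {x : Plane} (hx : x ∈ side (outSide L)) :
    ∃ μ ∈ Set.Icc (-1 : ℝ) 1, x = normal (outSide L) + μ • halfSide L := by
  have hb := sqrt_two_bounds
  have hs := sqrt_two_mul_self
  obtain ⟨hO, h⟩ := hx
  obtain ⟨h0, h1, h2, h3, h4, h5, h6, h7⟩ := mem_octagon_iff.1 hO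
  rw [normal_dot] at h
  cases L
  · exact absurd rfl hL
  · simp [outSide, half_sqrt_two_mul_eq] at h
    refine ⟨(x 1 - √2 / 2) * (2 + √2), ⟨by nlinarith, by nlinarith⟩, plane_ext ?_ ?_⟩ <;>
      simp [outSide, halfSide, normal_eq] <;> grind
  · simp [outSide] at h
    refine ⟨x 1 * (1 + √2), ⟨by nlinarith, by nlinarith⟩, plane_ext ?_ ?_⟩ <;>
      simp [outSide, halfSide, normal_eq] <;> grind
  · simp [outSide, half_sqrt_two_mul_eq] at h
    refine ⟨(x 1 + √2 / 2) * (2 + √2), ⟨by nlinarith, by nlinarith⟩, plane_ext ?_ ?_⟩ <;>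
      simp [outSide, halfSide, normal_eq] <;> grind

/-- The half diagonal starts at the midpoint of the opposite side and ends, at `μ = 1`, in vertex 7,
0 or 1 for B, C, D respectively. -/
theorem halfDiag_sub_mem_octagon {L : Letter} (hL : L ≠ .A) {μ : ℝ} (hμ : μ ∈ Set.Icc (0 : ℝ) 1) :
    μ • halfDiag L - normal (outSide L) ∈ octagon := by
  have hb := sqrt_two_bounds
  have hs := sqrt_two_mul_self
  obtain ⟨h1, h2⟩ := hμ
  rw [mem_octagon_iff]
  cases L <;> simp [outSide, halfDiag, normal_eq] at hL ⊢ <;>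
    refine ⟨?_, ?_, ?_, ?_, ?_, ?_, ?_, ?_⟩ <;> nlinarith

/-- The involution fixes the midpoint of the side. One half of the image lies in the octagon being
entered, where it is seen from the opposite midpoint, the other half in the octagon being left. -/
theorem move_halfSide {L : Letter} (hL : L ≠ .A) {μ : ℝ} (hμ : μ ∈ Set.Icc (-1 : ℝ) 1) (x y : octagon)
    (hx : (x : Plane) = normal (outSide L) + μ • halfSide L)
    (hy : (0 ≤ μ ∧ (y : Plane) = μ • halfDiag L - normal (outSide L)) ∨
      (μ ≤ 0 ∧ (y : Plane) = normal (outSide L) + μ • halfDiag L)) : Move x y := by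
  have hb := sqrt_two_bounds
  have hs := sqrt_two_mul_self
  obtain ⟨h1, h2⟩ := hμ
  have x0 := congrFun hx 0
  have x1 := congrFun hx 1
  rcases hy with ⟨hμ, hy⟩ | ⟨hμ, hy⟩ <;> have y0 := congrFun hy 0 <;> have y1 := congrFun hy 1
  · cases L
    · exact absurd rfl hL
    · simp [outSide, halfSide, halfDiag, normal_eq] at x0 x1 y0 y1
      refine Or.inr ⟨_, _, Or.inl ⟨⟨x.2, ?_⟩, rfl⟩, Or.inr ⟨⟨y.2, ?_⟩, rfl⟩, 0, plane_ext ?_ ?_⟩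
      · nlinarith
      · nlinarith
      · simp [shearRefl]; grind
      · simp [shearRefl]; grind
    · simp [outSide, halfSide, halfDiag, normal_eq] at x0 x1 y0 y1
      refine Or.inl ⟨⟨x.2, ?_, ?_⟩, ⟨y.2, ?_, ?_⟩, 0, plane_ext ?_ ?_⟩
      · nlinarith
      · nlinarith
      · nlinarith
      · nlinarith
      · simp [shearRefl]; grind
      · simp [shearRefl]; grind
    · simp [outSide, halfSide, halfDiag, normal_eq] at x0 x1 y0 y1
      refine Or.inr ⟨_, _, Or.inr ⟨⟨x.2, ?_⟩, rfl⟩, Or.inl ⟨⟨y.2, ?_⟩, rfl⟩, 0, plane_ext ?_ ?_⟩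
      · nlinarith
      · nlinarith
      · simp [shearRefl]; grind
      · simp [shearRefl]; grind
  · cases L
    · exact absurd rfl hL
    · simp [outSide, halfSide, halfDiag, normal_eq] at x0 x1 y0 y1
      refine Or.inr ⟨_, _, Or.inl ⟨⟨x.2, ?_⟩, rfl⟩, Or.inl ⟨⟨y.2, ?_⟩, rfl⟩, 0, plane_ext ?_ ?_⟩
      · nlinarith
      · nlinarith
      · simp [shearRefl]; grind
      · simp [shearRefl]; grind
    · simp [outSide, halfSide, halfDiag, normal_eq] at x0 x1 y0 y1
      refine Or.inl ⟨⟨x.2, ?_, ?_⟩, ⟨y.2, ?_, ?_⟩, 1, plane_ext ?_ ?_⟩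
      · nlinarith
      · nlinarith
      · nlinarith
      · nlinarith
      · simp [shearRefl]; grind
      · simp [shearRefl]; grind
    · simp [outSide, halfSide, halfDiag, normal_eq] at x0 x1 y0 y1
      refine Or.inr ⟨_, _, Or.inr ⟨⟨x.2, ?_⟩, rfl⟩, Or.inr ⟨⟨y.2, ?_⟩, rfl⟩, 1, plane_ext ?_ ?_⟩
      · nlinarith
      · nlinarith
      · simp [shearRefl]; grind
      · simp [shearRefl]; grind

theorem exists_mem_outSide {L : Letter} {p : OctagonSurface} (hp : p ∈ labelledSide L) :
    ∃ x : octagon, (x : Plane) ∈ side (outSide L) ∧ toSurface x = p := by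
  obtain ⟨x, i, rfl, hi, rfl⟩ := hp
  rcases eq_outSide (i := i) with h | h
  · exact ⟨x, h ▸ hi, rfl⟩
  · have hm := sub_two_normal_mem_side hi
    refine ⟨⟨_, hm.1⟩, ?_, (toSurface_eq_of_sub (i := i) rfl).symm⟩
    have e : i + 4 = outSide (sideLabel i) := by
      conv_lhs => rw [h]
      exact add_four_add_four _
    rw [← e]
    exact hm

theorem mem_inducedSide_involution {L : Letter} (hL : L ≠ .A) {p : OctagonSurface} :
    p ∈ inducedSide involution L ↔ ∃ μ ∈ Set.Icc (0 : ℝ) 1, ∃ x : octagon, toSurface x = p ∧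
      ((x : Plane) = μ • halfDiag L - normal (outSide L) ∨
        (x : Plane) = -(μ • halfDiag L - normal (outSide L))) := by
  constructor
  · rintro ⟨q, hq, rfl⟩
    obtain ⟨x, hx, rfl⟩ := exists_mem_outSide hq
    obtain ⟨μ, hμ, hxμ⟩ := exists_eq_add_halfSide hL hx
    rcases le_total 0 μ with h | h
    · have hI : μ ∈ Set.Icc (0 : ℝ) 1 := ⟨h, hμ.2⟩
      refine ⟨μ, hI, ⟨_, halfDiag_sub_mem_octagon hL hI⟩, ?_, Or.inl rfl⟩
      exact (involution_toSurface (move_halfSide hL hμ x _ hxμ (Or.inl ⟨h, rfl⟩))).symm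
    · have hI : -μ ∈ Set.Icc (0 : ℝ) 1 := ⟨by linarith, by linarith [hμ.1]⟩
      refine ⟨-μ, hI, ⟨_, neg_mem_octagon (halfDiag_sub_mem_octagon hL hI)⟩, ?_, Or.inr rfl⟩
      refine (involution_toSurface (move_halfSide hL hμ x _ hxμ (Or.inr ⟨h, ?_⟩))).symm
      simp
  · rintro ⟨μ, hμ, y, rfl, hy⟩
    rcases hy with hy | hy
    · have hI : μ ∈ Set.Icc (-1 : ℝ) 1 := ⟨by linarith [hμ.1], hμ.2⟩
      have hx := add_halfSide_mem_side hL hI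
      exact ⟨_, ⟨⟨_, hx.1⟩, _, sideLabel_outSide L, hx, rfl⟩,
        involution_toSurface (move_halfSide hL hI _ y rfl (Or.inl ⟨hμ.1, hy⟩))⟩
    · have hI : -μ ∈ Set.Icc (-1 : ℝ) 1 := ⟨by linarith [hμ.2], by linarith [hμ.1]⟩
      have hx := add_halfSide_mem_side hL hI
      refine ⟨_, ⟨⟨_, hx.1⟩, _, sideLabel_outSide L, hx, rfl⟩,
        involution_toSurface (move_halfSide hL hI _ y rfl (Or.inr ⟨by linarith [hμ.1], ?_⟩))⟩
      rw [hy]; simp; abel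

/-- At height 1 the involution is (x, 1) ↦ (-x, 1) modulo the circumference 2√2. -/
theorem inducedSide_involution_A : inducedSide involution .A = labelledSide .A := by
  have hsub : ∀ p ∈ labelledSide .A, involution p ∈ labelledSide .A := by
    intro p hp
    have hb := sqrt_two_bounds
    have hs := sqrt_two_mul_self
    obtain ⟨x, hx, rfl⟩ := exists_mem_outSide hp
    have hx1 := hx.2
    rw [normal_dot] at hx1
    simp [outSide] at hx1
    have hm : Move x ⟨![-(x : Plane) 0, (x : Plane) 1], neg_fst_mem_octagon x.2⟩ := by
      refine Or.inr ⟨_, _, Or.inl ⟨⟨x.2, by linarith⟩, rfl⟩,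
        Or.inl ⟨⟨neg_fst_mem_octagon x.2, by simp; linarith⟩, rfl⟩, -1, plane_ext ?_ ?_⟩ <;>
        simp [shearRefl, hx1]; ring
    rw [involution_toSurface hm]
    refine ⟨_, 2, rfl, ⟨neg_fst_mem_octagon x.2, ?_⟩, rfl⟩
    rw [normal_dot]; simp [hx1]
  apply Set.Subset.antisymm
  · rintro _ ⟨p, hp, rfl⟩
    exact hsub p hp
  · intro p hp
    refine ⟨_, hsub p hp, ?_⟩
    obtain ⟨x, rfl⟩ := exists_rep p
    obtain ⟨x', h⟩ := exists_move x
    rw [involution_toSurface h, involution_toSurface h.symm]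

/-! ### Bi-infinite words -/

/-- Two increasing enumerations of the same set by the integers differ by a shift. -/
theorem exists_shift {α : Type*} [LinearOrder α] {f g : ℤ → α} (hf : StrictMono f)
    (hg : StrictMono g) (h : Set.range f = Set.range g) : ∃ m : ℤ, ∀ n, f n = g (n + m) := by
  have hex : ∀ n, ∃ m, g m = f n := fun n => by
    have : f n ∈ Set.range g := h ▸ ⟨n, rfl⟩
    exact this
  choose φ hφ using hex
  have hmono : StrictMono φ := fun a b hab => by
    rw [← hg.lt_iff_lt, hφ, hφ]; exact hf hab
  have hsurj : Function.Surjective φ := fun m => by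
    have : g m ∈ Set.range f := h ▸ ⟨m, rfl⟩
    obtain ⟨n, hn⟩ := this
    exact ⟨n, hg.injective (by rw [hφ, hn])⟩
  -- A strictly increasing surjection of ℤ cannot skip a value.
  have hsucc : ∀ n, φ (n + 1) = φ n + 1 := by
    intro n
    have h1 : φ n < φ (n + 1) := hmono (by omega)
    by_contra hne
    obtain ⟨k, hk⟩ := hsurj (φ n + 1)
    have h2 : n < k := hmono.lt_iff_lt.1 (by omega)
    have h3 : k < n + 1 := hmono.lt_iff_lt.1 (by omega)
    omega
  refine ⟨φ 0, fun n => ?_⟩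
  have : φ n = n + φ 0 := by
    induction n using Int.induction_on with
    | zero => simp
    | succ i ih => rw [hsucc, ih]; ring
    | pred i ih =>
      have := hsucc (-(i : ℤ) - 1)
      rw [sub_add_cancel, ih] at this
      linarith
  rw [← this, hφ]

theorem IsCuttingSequence.shift {sides : Letter → Set OctagonSurface} {τ : ℝ → OctagonSurface}
    {w : ℤ → Letter} (h : IsCuttingSequence sides τ w) (m : ℤ) :
    IsCuttingSequence sides τ (fun n => w (n + m)) := by
  obtain ⟨t, ht, hr, hw⟩ := h
  refine ⟨fun n => t (n + m), fun a b hab => ht (by omega), ?_, fun n => hw _⟩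
  rw [← hr]
  exact (Equiv.addRight m).surjective.range_comp t

theorem IsCuttingSequence.exists_shift {sides : Letter → Set OctagonSurface} {τ : ℝ → OctagonSurface}
    (hu : ∀ t L L', τ t ∈ sides L → τ t ∈ sides L' → L = L')
    {w w' : ℤ → Letter} (h : IsCuttingSequence sides τ w) (h' : IsCuttingSequence sides τ w') :
    ∃ m : ℤ, ∀ n, w n = w' (n + m) := by
  obtain ⟨t, ht, hr, hw⟩ := h
  obtain ⟨t', ht', hr', hw'⟩ := h'
  obtain ⟨m, hm⟩ := OctagonFlow.exists_shift ht ht' (hr.trans hr'.symm)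
  refine ⟨m, fun n => hu (t n) _ _ (hw n) ?_⟩
  rw [hm]; exact hw' _

theorem IsDerived.shift {w w' : ℤ → Letter} (h : IsDerived w w') (m : ℤ) :
    IsDerived w (fun n => w' (n + m)) := by
  obtain ⟨ha, e, he, hr, hw⟩ := h
  refine ⟨ha, fun n => e (n + m), fun a b hab => he (by omega), ?_, fun n => hw _⟩
  rw [← hr]
  exact (Equiv.addRight m).surjective.range_comp e

theorem IsDerived.exists_shift {w₁ w₂ v₁ v₂ : ℤ → Letter} (h₁ : IsDerived w₁ v₁)
    (h₂ : IsDerived w₂ v₂) (h : ∃ m : ℤ, ∀ n, w₁ n = w₂ (n + m)) :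
    ∃ m : ℤ, ∀ n, v₁ n = v₂ (n + m) := by
  obtain ⟨m, hm⟩ := h
  obtain ⟨-, e, he, hr, hw⟩ := h₁
  obtain ⟨-, f, hf, hr', hw'⟩ := h₂
  obtain ⟨k, hk⟩ := OctagonFlow.exists_shift (f := fun n => e n + m) (g := f)
    (fun a b hab => by have := he hab; simpa using this) hf (by
      ext n
      have h1 : n - m ∈ Set.range e ↔ n ∈ Set.range f := by
        rw [hr, hr']
        simp only [Set.mem_ofPred_eq, hm]
        rw [show n - m - 1 + m = n - 1 by ring, show n - m + 1 + m = n + 1 by ring]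
      rw [← h1]
      simp only [Set.mem_range, eq_sub_iff_add_eq])
  refine ⟨k, fun n => ?_⟩
  rw [hw, hw', hm, ← hk]

theorem IsIteratedDerived.shift {k : ℕ} {w v : ℤ → Letter} (h : IsIteratedDerived k w v) (m : ℤ) :
    IsIteratedDerived k w (fun n => v (n + m)) := by
  cases k with
  | zero =>
    obtain ⟨l, hl⟩ := h
    exact ⟨m + l, fun n => by simp only [hl, add_assoc]⟩
  | succ k =>
    obtain ⟨u, hu, hv⟩ := h
    exact ⟨u, hu, hv.shift m⟩

theorem IsIteratedDerived.exists_shift {k : ℕ} {w v v' : ℤ → Letter} (h : IsIteratedDerived k w v)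
    (h' : IsIteratedDerived k w v') : ∃ m : ℤ, ∀ n, v n = v' (n + m) := by
  induction k generalizing v v' with
  | zero =>
    obtain ⟨l, hl⟩ := h
    obtain ⟨l', hl'⟩ := h'
    exact ⟨l - l', fun n => by rw [hl, hl']; congr 1; ring⟩
  | succ k ih =>
    obtain ⟨u, hu, hv⟩ := h
    obtain ⟨u', hu', hv'⟩ := h'
    exact hv.exists_shift hv' (ih hu hu')

/-- An unbounded set of integers is enumerated increasingly by the integers. -/
theorem exists_enumeration {S : Set ℤ} (h1 : ∀ n, ∃ m ∈ S, n < m) (h2 : ∀ n, ∃ m ∈ S, m < n) :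
    ∃ e : ℤ → ℤ, StrictMono e ∧ Set.range e = S := by
  classical
  have : LocallyFiniteOrder S := Subtype.instLocallyFiniteOrder _
  have : SuccOrder S := LinearLocallyFiniteOrder.succOrder S
  have : PredOrder S := LinearLocallyFiniteOrder.predOrder S
  have : NoMaxOrder S := ⟨fun a => let ⟨m, hm, h⟩ := h1 a; ⟨⟨m, hm⟩, h⟩⟩
  have : NoMinOrder S := ⟨fun a => let ⟨m, hm, h⟩ := h2 a; ⟨⟨m, hm⟩, h⟩⟩
  have : Nonempty S := let ⟨m, hm, _⟩ := h1 0; ⟨⟨m, hm⟩⟩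
  let f : S ≃o ℤ := orderIsoIntOfLinearSuccPredArch
  refine ⟨fun n => (f.symm n : ℤ), fun a b hab => f.symm.strictMono hab, ?_⟩
  ext n
  constructor
  · rintro ⟨m, rfl⟩; exact (f.symm m).2
  · intro hn; exact ⟨f ⟨n, hn⟩, by simp⟩

/-- Every word which is a path on the basic diagram has sandwiched letters arbitrarily far to
both sides. -/
theorem exists_sandwiched {w : ℤ → Letter} (h : ∀ n, BaseEdge (w n) (w (n + 1))) (n : ℤ) :
    ∃ m, w (m - 1) = w (m + 1) ∧ n < m ∧ m < n + 8 := by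
  by_contra! hc
  -- A path without sandwiched letters never turns back, and the longest one is ADBCCBDA. Seven
  -- consecutive failures would need such a path of nine letters.
  have key : ∀ k : ℤ, 1 ≤ k → k ≤ 7 → w (n + k - 1) ≠ w (n + k + 1) := fun k h1 h2 he => by
    have := hc (n + k) he (by omega); omega
  have e1 := h (n + 0); have e2 := h (n + 1); have e3 := h (n + 2); have e4 := h (n + 3)
  have e5 := h (n + 4); have e6 := h (n + 5); have e7 := h (n + 6); have e8 := h (n + 7)
  have k1 := key 1 (by omega) (by omega)
  have k2 := key 2 (by omega) (by omega)
  have k3 := key 3 (by omega) (by omega)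
  have k4 := key 4 (by omega) (by omega)
  have k5 := key 5 (by omega) (by omega)
  have k6 := key 6 (by omega) (by omega)
  have k7 := key 7 (by omega) (by omega)
  simp only [add_assoc, add_sub_assoc] at e1 e2 e3 e4 e5 e6 e7 e8 k1 k2 k3 k4 k5 k6 k7
  norm_num at e1 e2 e3 e4 e5 e6 e7 e8 k1 k2 k3 k4 k5 k6 k7
  generalize w n = a0 at *
  generalize w (n + 1) = a1 at *
  generalize w (n + 2) = a2 at *
  generalize w (n + 3) = a3 at *
  generalize w (n + 4) = a4 at *
  generalize w (n + 5) = a5 at *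
  generalize w (n + 6) = a6 at *
  generalize w (n + 7) = a7 at *
  generalize w (n + 8) = a8 at *
  clear hc key h
  cases e1 <;> cases e2 <;> first | exact k1 rfl | skip
  all_goals cases e3 <;> first | exact k2 rfl | skip
  all_goals cases e4 <;> first | exact k3 rfl | skip
  all_goals cases e5 <;> first | exact k4 rfl | skip
  all_goals cases e6 <;> first | exact k5 rfl | skip
  all_goals cases e7 <;> first | exact k6 rfl | skip
  all_goals (cases e8; exact k7 rfl)

/-! ### Directions in the open sector `(0, π/8)` -/

/-- The open sector of directions with angle in `(0, π/8)`. -/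
def InSector (v : Plane) : Prop := 0 < v 1 ∧ (1 + √2) * v 1 < v 0

/-- The determinant of two vectors. -/
def cross (v w : Plane) : ℝ := v 0 * w 1 - v 1 * w 0

/-- Consecutive crossings of sides with these labels happen inside of one horizontal
cylinder. -/
inductive SameCylinder : Letter → Letter → Prop
  | cc : SameCylinder .C .C
  | bd : SameCylinder .B .D
  | db : SameCylinder .D .B

theorem neg_mem_side {i : Fin 8} {x : Plane} (h : x ∈ side (i + 4)) : -x ∈ side i :=
  ⟨neg_mem_octagon h.1, by rw [dotProduct_neg, ← neg_dotProduct, ← normal_add_four, h.2]⟩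

theorem not_isVertex_neg {x : Plane} (h : ¬ IsVertex x) : ¬ IsVertex (-x) := by
  rintro ⟨i, j, hij, hi, hj⟩
  refine h ⟨i + 4, j + 4, fun e => hij (by simpa using e), ?_, ?_⟩
  · rw [← neg_neg x]; exact neg_mem_side (by rwa [add_four_add_four])
  · rw [← neg_neg x]; exact neg_mem_side (by rwa [add_four_add_four])

theorem outSide_dot_pos {v : Plane} (hv : InSector v) (L : Letter) : 0 < normal (outSide L) ⬝ᵥ v := by
  have hb := sqrt_two_bounds
  obtain ⟨h1, h2⟩ := hv
  rw [normal_dot]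
  cases L <;> simp [outSide] <;> nlinarith

theorem outSide_injective : Function.Injective outSide := fun L L' h => by
  rw [← sideLabel_outSide L, h, sideLabel_outSide]

theorem neg_outSide_dot_outSide_lt (L L' : Letter) : normal (outSide L') ⬝ᵥ (-normal (outSide L)) < 1 := by
  have hb := sqrt_two_bounds
  have hs := sqrt_two_mul_self
  rw [normal_dot]
  cases L <;> cases L' <;> simp [outSide, normal_eq] <;> nlinarith

theorem dot_lt_of_mem_side {x : Plane} (hx : ¬ IsVertex x) {i j : Fin 8} (hi : x ∈ side i)
    (hij : i ≠ j) : normal j ⬝ᵥ x < 1 :=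
  lt_of_le_of_ne (hi.1 j) fun h => hij (eq_of_mem_side hx hi ⟨hi.1, h⟩)

theorem dot_halfDiag_lt {L : Letter} (hL : L ≠ .A) (L' : Letter) {μ : ℝ} (h0 : 0 ≤ μ) (h1 : μ < 1) :
    normal (outSide L') ⬝ᵥ (μ • halfDiag L - normal (outSide L)) < 1 := by
  have h2 := halfDiag_sub_mem_octagon hL (μ := 1) ⟨zero_le_one, le_rfl⟩ (outSide L')
  have h3 := neg_outSide_dot_outSide_lt L L'
  rw [dotProduct_neg] at h3
  rw [dotProduct_sub, dotProduct_smul, smul_eq_mul] at h2 ⊢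
  nlinarith

/-- The coordinates of the interior points of the sides `outSide L`. -/
def OnOutSide : Letter → Plane → Prop
  | .A, x => x 1 = 1 ∧ 1 - √2 < x 0 ∧ x 0 < √2 - 1
  | .B, x => x 0 = √2 - x 1 ∧ √2 - 1 < x 1 ∧ x 1 < 1
  | .C, x => x 0 = 1 ∧ 1 - √2 < x 1 ∧ x 1 < √2 - 1
  | .D, x => x 0 = √2 + x 1 ∧ -1 < x 1 ∧ x 1 < 1 - √2

theorem onOutSide_of_mem {L : Letter} {x : Plane} (hx : x ∈ side (outSide L)) (hv : ¬ IsVertex x) :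
    OnOutSide L x := by
  have X0 := fun j => dot_lt_of_mem_side hv hx (j := j)
  have hX := hx.2
  clear hx hv
  simp only [normal_dot] at X0 hX
  cases L
  · have h1 := X0 1 (by decide)
    have h2 := X0 3 (by decide)
    simp [outSide, half_sqrt_two_mul_lt] at h1 h2 hX
    exact ⟨hX, by linarith, by linarith⟩
  · have h1 := X0 0 (by decide)
    have h2 := X0 2 (by decide)
    simp [outSide, half_sqrt_two_mul_eq] at h1 h2 hX
    exact ⟨by linarith, by linarith, by linarith⟩
  · have h1 := X0 1 (by decide)
    have h2 := X0 7 (by decide)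
    simp [outSide, half_sqrt_two_mul_lt] at h1 h2 hX
    exact ⟨hX, by linarith, by linarith⟩
  · have h1 := X0 0 (by decide)
    have h2 := X0 6 (by decide)
    simp [outSide, half_sqrt_two_mul_eq] at h1 h2 hX
    exact ⟨by linarith, by linarith, by linarith⟩

/-- Here `x` is minus the entry point and `y` the exit point, so `x + y` is the displacement. For
pairs of sides that are not an edge, the ranges of the coordinates exclude displacements in the open
sector. -/
theorem baseEdge_of_onOutSide {L L' : Letter} {x y : Plane} (hx : OnOutSide L x)
    (hy : OnOutSide L' y) (hQ : 0 < x 1 + y 1)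
    (hP : (1 + √2) * (x 1 + y 1) < x 0 + y 0) : BaseEdge L L' := by
  have hb := sqrt_two_bounds
  have hs := sqrt_two_mul_self
  have key : ∀ c, c < x 1 + y 1 → (1 + √2) * c < x 0 + y 0 := fun c hc => by nlinarith
  cases L <;> cases L' <;> first
    | constructor
    | exfalso
      obtain ⟨hx0, hx1, hx2⟩ := hx
      obtain ⟨hy0, hy1, hy2⟩ := hy
  · nlinarith
  · nlinarith
  · nlinarith
  · nlinarith
  · nlinarith
  · nlinarith
  · nlinarith
  · nlinarith
  · nlinarith

/-- The point `halfDiag L - normal (outSide L)` is the vertex where the diagonal ends. The sign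
tells whether this vertex is to the left or to the right of the trajectory leaving the octagon at
`y`. -/
theorem cross_corner_sub {v y : Plane} (hv : InSector v) {L L' : Letter} (hL : L ≠ .A)
    (h : BaseEdge L L') (hy : OnOutSide L' y) :
    (SameCylinder L L' → 0 < cross v (halfDiag L - normal (outSide L) - y)) ∧
      (¬ SameCylinder L L' → cross v (halfDiag L - normal (outSide L) - y) < 0) := by
  have hb := sqrt_two_bounds
  have hs := sqrt_two_mul_self
  obtain ⟨v1, v2⟩ := hv
  have v3 : 2 * v 1 < v 0 := by nlinarith
  cases h <;> obtain ⟨hy0, hy1, hy2⟩ := hy <;> first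
    | exact absurd rfl hL
    | refine ⟨fun hc => ?_, fun hc => ?_⟩
  all_goals first
    | (exfalso; cases hc; done)
    | exact absurd (by constructor) hc
    | skip
  all_goals simp [cross, outSide, halfDiag, normal_eq, hy0]
  · nlinarith
  · nlinarith
  · nlinarith
  · nlinarith
  · nlinarith
  · nlinarith

theorem transition {v X Y : Plane} (hv : InSector v) {L L' : Letter} {l : ℝ} (hl : 0 < l)
    (hX : -X ∈ side (outSide L)) (hXv : ¬ IsVertex (-X)) (hY : Y ∈ side (outSide L'))
    (hYv : ¬ IsVertex Y) (h : X + l • v = Y) : BaseEdge L L' ∧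
    (L ≠ .A → (SameCylinder L L' → 0 < cross v (halfDiag L - normal (outSide L) - X)) ∧
      (¬ SameCylinder L L' → cross v (halfDiag L - normal (outSide L) - X) < 0)) ∧
    (L' ≠ .A → (SameCylinder L L' → 0 < cross v (halfDiag L' - normal (outSide L') + Y)) ∧
      (¬ SameCylinder L L' → cross v (halfDiag L' - normal (outSide L') + Y) < 0)) := by
  have hx := onOutSide_of_mem hX hXv
  have hy := onOutSide_of_mem hY hYv
  have e0 : (-X) 0 + Y 0 = l * v 0 := by rw [← h]; simp
  have e1 : (-X) 1 + Y 1 = l * v 1 := by rw [← h]; simp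
  have hb := baseEdge_of_onOutSide hx hy (by rw [e1]; exact mul_pos hl hv.1)
    (by rw [e0, e1]; nlinarith [hv.2])
  -- Moving the reference point along the trajectory does not change its cross product with `v`.
  have cL : cross v (halfDiag L - normal (outSide L) - X) =
      cross v (halfDiag L - normal (outSide L) - Y) := by
    simp [cross, ← h]; ring
  have cR : cross v (halfDiag L' - normal (outSide L') + Y) =
      cross v (halfDiag L' - normal (outSide L') - -X) := by
    simp [cross, ← h]; ring
  -- Rotating by π and reading the segment backwards keeps `v` and exchanges `-X` with `Y`; the
  -- diagram and `SameCylinder` are symmetric.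
  have hb' : BaseEdge L' L := by cases hb <;> constructor
  have hsc : SameCylinder L L' ↔ SameCylinder L' L :=
    ⟨fun h => by cases h <;> constructor, fun h => by cases h <;> constructor⟩
  rw [cL, cR]
  refine ⟨hb, fun hA => cross_corner_sub hv hA hb hy, fun hA => ?_⟩
  rw [hsc]
  exact cross_corner_sub hv hA hb' hx

/-! ### Linear trajectories in directions in the open sector `(0, π/8)` -/

instance : Finite Letter := Finite.of_injective outSide outSide_injective

instance : Nonempty Letter := ⟨.A⟩

theorem outSide_add_four_ne (L L' : Letter) : outSide L + 4 ≠ outSide L' := by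
  cases L <;> cases L' <;> decide

theorem normal_dot_ne_zero {v : Plane} (hv : InSector v) (i : Fin 8) : normal i ⬝ᵥ v ≠ 0 := by
  have := outSide_dot_pos hv (sideLabel i)
  rcases eq_outSide (i := i) with h | h <;> rw [h]
  · exact this.ne'
  · rw [normal_add_four, neg_dotProduct]
    exact (neg_neg_of_pos this).ne

/-- The exit time is the least of the four times at which the lines carrying the forward sides are
reached; the backward sides impose no condition. -/
theorem exists_exit {v : Plane} (hv : InSector v) {X : Plane} (hX : X ∈ octagon) :
    ∃ l : ℝ, 0 ≤ l ∧ ∃ L, X + l • v ∈ side (outSide L) := by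
  obtain ⟨L, hL⟩ := Finite.exists_min fun L : Letter =>
    (1 - normal (outSide L) ⬝ᵥ X) / (normal (outSide L) ⬝ᵥ v)
  have hp := outSide_dot_pos hv
  set l := (1 - normal (outSide L) ⬝ᵥ X) / (normal (outSide L) ⬝ᵥ v) with hl
  have h0 : 0 ≤ l := div_nonneg (sub_nonneg.2 (hX _)) (hp L).le
  refine ⟨l, h0, L, fun i => ?_, ?_⟩
  · rw [dotProduct_add, dotProduct_smul, smul_eq_mul]
    rcases eq_outSide (i := i) with h | h <;> rw [h]
    · have := (le_div_iff₀ (hp (sideLabel i))).1 (hL (sideLabel i))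
      linarith
    · have h1 := hX (outSide (sideLabel i) + 4)
      rw [normal_add_four, neg_dotProduct] at h1 ⊢
      rw [neg_dotProduct]
      have := mul_nonneg h0 (hp (sideLabel i)).le
      linarith
  · rw [dotProduct_add, dotProduct_smul, smul_eq_mul, hl, div_mul_cancel₀ _ (hp L).ne']
    ring

theorem dot_lt_of_between {v : Plane} (hv : InSector v) {X : Plane} (hX : X ∈ octagon) {l s : ℝ}
    (hl : X + l • v ∈ octagon) (h0 : 0 < s) (h1 : s < l) (i : Fin 8) :
    normal i ⬝ᵥ (X + s • v) < 1 := by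
  have e1 := hX i
  have e2 := hl i
  rw [dotProduct_add, dotProduct_smul, smul_eq_mul] at e2 ⊢
  rcases lt_or_gt_of_ne (normal_dot_ne_zero hv i) with h | h <;> nlinarith

theorem toSurface_notMem_labelledSide {x : octagon} (h : ∀ i, normal i ⬝ᵥ (x : Plane) < 1)
    (L : Letter) : toSurface x ∉ labelledSide L := by
  rw [toSurface_mem_labelledSide (not_isVertex_of_interior h)]
  rintro ⟨i, -, hi⟩
  exact (h i).ne hi.2

theorem IsLinearTrajectory.flow {v : Plane} {τ : ℝ → OctagonSurface} (hτ : IsLinearTrajectory v τ)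
    {X : octagon} {T l : ℝ} (hT : τ T = toSurface X) (hl : (X : Plane) + l • v ∈ octagon) {s : ℝ}
    (hs : s ∈ Set.Icc 0 l) (hm : (X : Plane) + s • v ∈ octagon) :
    τ (T + s) = toSurface ⟨_, hm⟩ := by
  refine linear_path_eq (τ := fun s => τ (T + s)) (fun t _ => hτ.1 _) (fun t _ => ?_)
    (fun t ht => add_smul_mem_octagon X.2 hl ht) (fun hX => ?_) hs
  · filter_upwards [hτ.eventually (T + t)] with h hh _
    rw [← add_assoc]; exact hh
  · rw [add_zero, hT]

theorem IsLinearTrajectory.hits_isolated {v : Plane} (hv : InSector v) {τ : ℝ → OctagonSurface}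
    (hτ : IsLinearTrajectory v τ) (T : ℝ) :
    ∀ᶠ h in 𝓝 (0 : ℝ), h ≠ 0 → ∀ L, τ (T + h) ∉ labelledSide L := by
  have h1 : ∀ᶠ u in 𝓝 (0 : Plane), ∀ x : octagon, toSurface x = τ T →
      ∀ k, (x : Plane) ∈ side k ∨ normal k ⬝ᵥ ((x : Plane) + u) < 1 := by
    refine eventually_reps (P := fun x u => ∀ k, x ∈ side k ∨ normal k ⬝ᵥ (x + u) < 1)
      (hτ.1 T) fun x _ => eventually_all.2 fun k => ?_
    by_cases hk : (x : Plane) ∈ side k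
    · exact Eventually.of_forall fun _ => Or.inl hk
    · filter_upwards [eventually_dot_lt (lt_of_le_of_ne (x.2 k) fun h => hk ⟨x.2, h⟩)] with u hu
      exact Or.inr hu
  filter_upwards [(tendsto_smul_zero v).eventually h1, hτ.eventually T] with h h1 h2 h0
  obtain ⟨x, y, hx, hy, hxy⟩ := h2
  rw [← hy]
  refine toSurface_notMem_labelledSide fun k => ?_
  rcases h1 x hx k with hk | hk
  · refine lt_of_le_of_ne (y.2 k) ?_
    rw [hxy, dotProduct_add, hk.2, dotProduct_smul, smul_eq_mul]
    have := mul_ne_zero h0 (normal_dot_ne_zero hv k)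
    intro h; exact this (by linarith)
  · rw [hxy]; exact hk

theorem exists_lt_of_isolated {t : ℤ → ℝ} (ht : StrictMono t)
    (h : ∀ T, ∀ᶠ s in 𝓝 (0 : ℝ), s ≠ 0 → T + s ∉ Set.range t) (T : ℝ) : ∃ n, T < t n := by
  by_contra! hT
  have hb : BddAbove (Set.range t) := ⟨T, by rintro _ ⟨n, rfl⟩; exact hT n⟩
  have h1 := tendsto_atTop_ciSup ht.monotone hb
  have h2 : Tendsto (fun n => t n - ⨆ i, t i) atTop (𝓝 0) := by
    simpa using h1.sub_const (⨆ i, t i)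
  obtain ⟨n, hn⟩ := (h2.eventually (h (⨆ i, t i))).exists
  have h3 : t n < ⨆ i, t i := (ht (lt_add_one n)).trans_le (le_ciSup hb _)
  exact hn (by linarith) ⟨n, by ring⟩

theorem exists_gt_of_isolated {t : ℤ → ℝ} (ht : StrictMono t)
    (h : ∀ T, ∀ᶠ s in 𝓝 (0 : ℝ), s ≠ 0 → T + s ∉ Set.range t) (T : ℝ) : ∃ n, t n < T := by
  have h1 : StrictMono fun n : ℤ => -t (-n) := fun a b hab => neg_lt_neg (ht (by omega))
  have h2 : ∀ T, ∀ᶠ s in 𝓝 (0 : ℝ), s ≠ 0 → T + s ∉ Set.range fun n : ℤ => -t (-n) := by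
    intro T
    have h2 : Tendsto (fun s : ℝ => -s) (𝓝 0) (𝓝 0) := by
      simpa using (continuous_neg (G := ℝ)).tendsto 0
    filter_upwards [h2.eventually (h (-T))] with s hs h0
    rintro ⟨n, hn⟩
    refine hs (by simpa using h0) ⟨-n, ?_⟩
    simp only at hn
    linarith
  obtain ⟨n, hn⟩ := exists_lt_of_isolated h1 h2 (-T)
  exact ⟨-n, by simpa using hn⟩

/-- Crossing times do not accumulate, so they are unbounded in both directions. -/
theorem exists_mem_Ico_of_isolated {t : ℤ → ℝ} (ht : StrictMono t)
    (h : ∀ T, ∀ᶠ s in 𝓝 (0 : ℝ), s ≠ 0 → T + s ∉ Set.range t) (T : ℝ) :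
    ∃ n, T ∈ Set.Ico (t n) (t (n + 1)) := by
  obtain ⟨a, ha⟩ := exists_gt_of_isolated ht h T
  obtain ⟨b, hb⟩ := exists_lt_of_isolated ht h T
  obtain ⟨n, hn, hmax⟩ := Int.exists_greatest_of_bdd (P := fun n => t n ≤ T)
    ⟨b, fun z hz => (ht.lt_iff_lt.1 (lt_of_le_of_lt hz hb)).le⟩ ⟨a, ha.le⟩
  refine ⟨n, hn, ?_⟩
  by_contra! hc
  have := hmax _ hc
  omega

/-- `X n` is the representative of the n-th crossing point from which the trajectory enters the
octagon. Interior points carry no label, so the exit point of the segment starting there is the next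
crossing. -/
theorem exists_crossings {v : Plane} (hv : InSector v) {τ : ℝ → OctagonSurface}
    (hτ : IsLinearTrajectory v τ) {w : ℤ → Letter} {t : ℤ → ℝ} (ht : StrictMono t)
    (hr : Set.range t = {s | ∃ L, τ s ∈ labelledSide L}) (hw : ∀ n, τ (t n) ∈ labelledSide (w n)) :
    ∃ X : ℤ → Plane, ∀ n, X n ∈ side (outSide (w n) + 4) ∧ ¬ IsVertex (X n) ∧
      X n + (t (n + 1) - t n) • v = X (n + 1) + (2 : ℝ) • normal (outSide (w (n + 1))) ∧
      ∀ s ∈ Set.Icc 0 (t (n + 1) - t n), ∀ hm : X n + s • v ∈ octagon,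
        τ (t n + s) = toSurface ⟨_, hm⟩ := by
  choose Y hY hYτ using fun n => exists_mem_outSide (hw n)
  have hYv : ∀ n, ¬ IsVertex (Y n) := fun n => by
    rw [← toSurface_mem_singularSet, hYτ]; exact hτ.1 _
  let X : ℤ → octagon := fun n => ⟨_, (sub_two_normal_mem_side (hY n)).1⟩
  have hX : ∀ n, (X n : Plane) ∈ side (outSide (w n) + 4) := fun n => sub_two_normal_mem_side (hY n)
  have hXv : ∀ n, ¬ IsVertex (X n) := fun n => not_isVertex_sub (hY n) (hYv n)
  have hXτ : ∀ n, τ (t n) = toSurface (X n) := fun n => by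
    rw [← hYτ]; exact toSurface_eq_of_sub rfl
  have key : ∀ n, (X n : Plane) + (t (n + 1) - t n) • v = Y (n + 1) := by
    intro n
    obtain ⟨l, hl0, L, hl⟩ := exists_exit hv (X n).2
    have hl1 : 0 < l := by
      refine lt_of_le_of_ne hl0 ?_
      rintro rfl
      rw [zero_smul, add_zero] at hl
      exact outSide_add_four_ne _ _ (eq_of_mem_side (hXv n) (hX n) hl)
    have hτl := hτ.flow (hXτ n) hl.1 ⟨hl0, le_rfl⟩ hl.1
    have hlL : τ (t n + l) ∈ labelledSide L := hτl ▸ ⟨_, _, sideLabel_outSide L, hl, rfl⟩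
    obtain ⟨m, hm⟩ : t n + l ∈ Set.range t := by rw [hr]; exact ⟨L, hlL⟩
    have hnm : n < m := ht.lt_iff_lt.1 (by linarith)
    have hm1 : m = n + 1 := by
      by_contra hne
      have h1 : t (n + 1) < t m := ht (by omega)
      have h2 : t n < t (n + 1) := ht (by omega)
      have hmem := add_smul_mem_octagon (X n).2 hl.1 (t := t (n + 1) - t n)
        ⟨by linarith, by linarith⟩
      have h3 := hτ.flow (hXτ n) hl.1 ⟨by linarith, by linarith⟩ hmem
      have h4 := hw (n + 1)
      rw [add_sub_cancel] at h3
      rw [h3] at h4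
      exact toSurface_notMem_labelledSide
        (dot_lt_of_between hv (X n).2 hl.1 (by linarith) (by linarith)) _ h4
    subst hm1
    have hLw : L = w (n + 1) := label_unique (hτ.1 _) hlL (hm ▸ hw (n + 1))
    subst hLw
    have e : l = t (n + 1) - t n := by linarith
    subst e
    have h5 : toSurface (Y (n + 1)) = toSurface ⟨_, hl.1⟩ :=
      (hYτ _).trans ((congrArg τ hm).trans hτl)
    rcases eq_or_glue_of_not_isVertex (hYv _) h5 with h6 | ⟨i, hi, h6⟩
    · exact (congrArg Subtype.val h6).symm
    · have e := eq_of_mem_side (hYv _) hi (hY _)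
      subst e
      have h7 := sub_two_normal_mem_side hi
      simp only at h6
      rw [← h6] at h7
      exact absurd (eq_of_mem_side (h6 ▸ not_isVertex_sub hi (hYv _)) h7 hl)
        (outSide_add_four_ne _ _)
  refine ⟨fun n => X n, fun n => ⟨hX n, hXv n, ?_, fun s hs hm => hτ.flow (hXτ n) ?_ hs hm⟩⟩
  · rw [key]; simp [X]
  · rw [key]; exact (Y _).2

theorem mem_side_outSide {L : Letter} {x : Plane} (h : match L with
    | .A => x 1 = 1 ∧ 1 - √2 ≤ x 0 ∧ x 0 ≤ √2 - 1
    | .B => x 0 = √2 - x 1 ∧ √2 - 1 ≤ x 1 ∧ x 1 ≤ 1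
    | .C => x 0 = 1 ∧ 1 - √2 ≤ x 1 ∧ x 1 ≤ √2 - 1
    | .D => x 0 = √2 + x 1 ∧ -1 ≤ x 1 ∧ x 1 ≤ 1 - √2) : x ∈ side (outSide L) := by
  have hb := sqrt_two_bounds
  have hs := sqrt_two_mul_self
  refine ⟨mem_octagon_iff.2 ?_, ?_⟩
  · cases L <;> obtain ⟨h0, h1, h2⟩ := h <;> rw [h0] <;>
      refine ⟨?_, ?_, ?_, ?_, ?_, ?_, ?_, ?_⟩ <;> linarith
  · rw [normal_dot]
    cases L <;> obtain ⟨h0, h1, h2⟩ := h <;> simp [outSide, h0] <;> linarith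

/-- Flowing backwards from the far end of the image of a side under the involution, one enters
the side itself. -/
theorem exists_corner_sub_mem_side {v : Plane} (hv : InSector v) {L : Letter} (hL : L ≠ .A) :
    ∃ l : ℝ, 0 < l ∧ -(halfDiag L - normal (outSide L) - l • v) ∈ side (outSide L) := by
  have hb := sqrt_two_bounds
  have hs := sqrt_two_mul_self
  obtain ⟨v1, v2⟩ := hv
  have v3 : 2 * v 1 < v 0 := by nlinarith
  cases L
  · exact absurd rfl hL
  -- In each case `l` is the time of backward flow from the corner to the line carrying the opposite
  -- side; it remains to locate the point between the ends of that side.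
  · have hp : 0 < v 0 + v 1 := by linarith
    have h1 : 2 / (v 0 + v 1) * (v 0 + v 1) = 2 := div_mul_cancel₀ _ hp.ne'
    have h0 : 0 < 2 / (v 0 + v 1) := by positivity
    refine ⟨2 / (v 0 + v 1), h0, mem_side_outSide ?_⟩
    generalize 2 / (v 0 + v 1) = l at *
    have h2 : 0 < l * v 1 := by positivity
    have h3 : (1 + √2) * (l * v 1) < l * v 0 := by nlinarith
    simp [halfDiag, outSide, normal_eq, vecHead, vecTail]
    refine ⟨by linarith, by linarith, by nlinarith⟩
  · have hp : 0 < v 0 := by linarith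
    have h1 : 2 / v 0 * v 0 = 2 := div_mul_cancel₀ _ hp.ne'
    have h0 : 0 < 2 / v 0 := by positivity
    refine ⟨2 / v 0, h0, mem_side_outSide ?_⟩
    generalize 2 / v 0 = l at *
    have h2 : 0 < l * v 1 := by positivity
    have h3 : (1 + √2) * (l * v 1) < l * v 0 := by nlinarith
    simp [halfDiag, outSide, normal_eq, vecHead, vecTail]
    refine ⟨by linarith, by linarith, by nlinarith⟩
  · have hp : 0 < v 0 - v 1 := by linarith
    have h1 : 2 * (√2 - 1) / (v 0 - v 1) * (v 0 - v 1) = 2 * (√2 - 1) := div_mul_cancel₀ _ hp.ne'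
    have h0 : 0 < 2 * (√2 - 1) / (v 0 - v 1) := div_pos (by linarith) hp
    refine ⟨2 * (√2 - 1) / (v 0 - v 1), h0, mem_side_outSide ?_⟩
    generalize 2 * (√2 - 1) / (v 0 - v 1) = l at *
    have h2 : 0 < l * v 1 := by positivity
    have h3 : (1 + √2) * (l * v 1) < l * v 0 := by nlinarith
    simp [halfDiag, outSide, normal_eq, vecHead, vecTail]
    refine ⟨by linarith, by linarith, by nlinarith⟩

theorem normal_outSide_mem (L : Letter) : normal (outSide L) ∈ side (outSide L) := by
  have hb := sqrt_two_bounds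
  apply mem_side_outSide
  cases L <;> simp [outSide, normal_eq] <;>
    first | exact ⟨by linarith, by linarith⟩ | exact ⟨by linarith, by linarith, by linarith⟩

/-- Convexity: for `μ = 1` the corner flows back into the side, and for `μ = 0` the midpoint already
lies on it. -/
theorem exists_backwards_mem_side {v : Plane} (hv : InSector v) {L : Letter} (hL : L ≠ .A) {μ : ℝ}
    (hμ : μ ∈ Set.Icc (0 : ℝ) 1) :
    ∃ l : ℝ, 0 ≤ l ∧ -(μ • halfDiag L - normal (outSide L) - l • v) ∈ side (outSide L) := by
  obtain ⟨l, hl, h⟩ := exists_corner_sub_mem_side hv hL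
  have h' := normal_outSide_mem L
  refine ⟨μ * l, mul_nonneg hμ.1 hl.le, ?_⟩
  have e : -(μ • halfDiag L - normal (outSide L) - (μ * l) • v) =
      μ • -(halfDiag L - normal (outSide L) - l • v) + (1 - μ) • normal (outSide L) := by
    ext i; simp; ring
  rw [e]
  refine ⟨octagon_convex h.1 h'.1 hμ.1 (by linarith [hμ.2]) (by ring), ?_⟩
  rw [dotProduct_add, dotProduct_smul, dotProduct_smul, h.2, h'.2]; simp

/-- The image of the side labelled `L` under the involution is entered from the side labelled
`L`. -/
theorem eq_of_flow_eq_diag {v X : Plane} (hv : InSector v) {L L' : Letter} (hL : L ≠ .A)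
    (hX : -X ∈ side (outSide L')) (hXv : ¬ IsVertex (-X)) {μ s : ℝ} (hμ : μ ∈ Set.Icc (0 : ℝ) 1)
    (h : X + s • v = μ • halfDiag L - normal (outSide L)) : L' = L := by
  obtain ⟨l, hl, h1⟩ := exists_backwards_mem_side hv hL hμ
  rw [← h] at h1
  have e : -(X + s • v - l • v) = -X + (l - s) • v := by ext i; simp; ring
  rw [e] at h1
  -- After rotation by π both points are exits of one line in direction `v` from the octagon, and
  -- such a line has only one exit.
  rcases lt_trichotomy l s with h2 | h2 | h2
  · have h3 := hX.1 (outSide L)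
    have h4 := h1.2
    rw [dotProduct_add, dotProduct_smul, smul_eq_mul] at h4
    have := outSide_dot_pos hv L
    nlinarith
  · rw [h2, sub_self, zero_smul, add_zero] at h1
    exact outSide_injective (eq_of_mem_side hXv hX h1)
  · have h3 := h1.1 (outSide L')
    have h4 := hX.2
    rw [dotProduct_add, dotProduct_smul, smul_eq_mul] at h3
    have := outSide_dot_pos hv L'
    nlinarith

theorem halfDiag_dot_nonneg (L : Letter) : 0 ≤ normal (outSide L) ⬝ᵥ halfDiag L := by
  by_cases hL : L = .A
  · subst hL; simp [halfDiag]
  · have h2 := halfDiag_sub_mem_octagon hL (μ := 1) ⟨zero_le_one, le_rfl⟩ (outSide L + 4)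
    rw [one_smul, normal_add_four, neg_dotProduct, dotProduct_sub, normal_dot_self] at h2
    linarith

/-- The crossings of a trajectory with the sides of the octagon: the `n`-th crossing is at the
time `t n`, with the side labelled `w n`, and it enters the octagon at `X n`. -/
structure Crossings (v : Plane) (τ : ℝ → OctagonSurface) (w : ℤ → Letter) (t : ℤ → ℝ)
    (X : ℤ → Plane) : Prop where
  sector : InSector v
  traj : IsLinearTrajectory v τ
  mono : StrictMono t
  range : Set.range t = {s | ∃ L, τ s ∈ labelledSide L}
  label : ∀ n, τ (t n) ∈ labelledSide (w n)
  mem : ∀ n, -X n ∈ side (outSide (w n))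
  notVertex : ∀ n, ¬ IsVertex (-X n)
  next : ∀ n, X n + (t (n + 1) - t n) • v = X (n + 1) + (2 : ℝ) • normal (outSide (w (n + 1)))
  flow : ∀ n, ∀ s ∈ Set.Icc 0 (t (n + 1) - t n), ∀ hm : X n + s • v ∈ octagon,
    τ (t n + s) = toSurface ⟨_, hm⟩

/-- The time at which a trajectory meets the diagonal that is the image under the involution of
the side crossed at the time `t n`. -/
noncomputable def diagTime (v : Plane) (w : ℤ → Letter) (t : ℤ → ℝ) (X : ℤ → Plane) (n : ℤ) : ℝ :=
  t n + cross (halfDiag (w n)) (X n + normal (outSide (w n))) / cross v (halfDiag (w n))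

/-! ### Sandwiched letters and the diagonals separated by the trajectory -/

namespace Crossings

variable {v : Plane} {τ : ℝ → OctagonSurface} {w : ℤ → Letter} {t : ℤ → ℝ} {X : ℤ → Plane}
  (H : Crossings v τ w t X)

include H

theorem exit_mem (n : ℤ) : X n + (2 : ℝ) • normal (outSide (w n)) ∈ side (outSide (w n)) := by
  have h := sub_two_normal_mem_side (H.mem n)
  rw [show -X n - (2 : ℝ) • normal (outSide (w n)) = -(X n + (2 : ℝ) • normal (outSide (w n))) by
    abel] at h
  simpa using neg_mem_side h

theorem exit_notVertex (n : ℤ) : ¬ IsVertex (X n + (2 : ℝ) • normal (outSide (w n))) := by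
  have h := not_isVertex_neg (not_isVertex_sub (H.mem n) (H.notVertex n))
  rwa [show X n + (2 : ℝ) • normal (outSide (w n)) = -(-X n - (2 : ℝ) • normal (outSide (w n))) by
    abel]

theorem trans_prop (n : ℤ) : BaseEdge (w n) (w (n + 1)) ∧
    (w n ≠ .A → (SameCylinder (w n) (w (n + 1)) →
        0 < cross v (halfDiag (w n) - (X n + normal (outSide (w n))))) ∧
      (¬ SameCylinder (w n) (w (n + 1)) →
        cross v (halfDiag (w n) - (X n + normal (outSide (w n)))) < 0)) ∧
    (w (n + 1) ≠ .A → (SameCylinder (w n) (w (n + 1)) →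
        0 < cross v (halfDiag (w (n + 1)) + (X (n + 1) + normal (outSide (w (n + 1)))))) ∧
      (¬ SameCylinder (w n) (w (n + 1)) →
        cross v (halfDiag (w (n + 1)) + (X (n + 1) + normal (outSide (w (n + 1))))) < 0)) := by
  have h := transition H.sector (sub_pos.2 (H.mono (lt_add_one n))) (H.mem n) (H.notVertex n)
    (H.exit_mem (n + 1)) (H.exit_notVertex (n + 1)) (H.next n)
  rw [show halfDiag (w n) - normal (outSide (w n)) - X n =
    halfDiag (w n) - (X n + normal (outSide (w n))) by abel,
    show halfDiag (w (n + 1)) - normal (outSide (w (n + 1))) +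
      (X (n + 1) + (2 : ℝ) • normal (outSide (w (n + 1)))) =
    halfDiag (w (n + 1)) + (X (n + 1) + normal (outSide (w (n + 1)))) by rw [two_smul]; abel] at h
  exact h

theorem edge (n : ℤ) : BaseEdge (w n) (w (n + 1)) := (H.trans_prop n).1

theorem sandwiched_of_A {n : ℤ} (h : w n = .A) : w (n - 1) = w (n + 1) := by
  have h1 := H.edge (n - 1)
  have h2 := H.edge n
  rw [sub_add_cancel] at h1
  rw [h] at h1 h2
  generalize w (n - 1) = a at *
  generalize w (n + 1) = b at *
  cases h1; cases h2; rfl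

/-- With the midpoint of the side as origin, the diagonal is [-U, U] and the trajectory is the line
through `c = X n + normal (outSide (w n))`; the product is positive iff the line separates ±U. Each
of B, C, D has exactly one neighbour in the diagram joined to it within a cylinder and one joined
otherwise, so equal signs mean equal neighbours. -/
theorem sandwiched_iff {n : ℤ} (h : w n ≠ .A) : w (n - 1) = w (n + 1) ↔
    0 < cross v (halfDiag (w n) - (X n + normal (outSide (w n)))) *
      cross v (halfDiag (w n) + (X n + normal (outSide (w n)))) := by
  obtain ⟨h1, -, h3⟩ := H.trans_prop (n - 1)
  obtain ⟨h4, h5, -⟩ := H.trans_prop n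
  rw [sub_add_cancel] at h1 h3
  obtain ⟨a1, a2⟩ := h3 h
  obtain ⟨b1, b2⟩ := h5 h
  have key : w (n - 1) = w (n + 1) ↔
      (SameCylinder (w (n - 1)) (w n) ↔ SameCylinder (w n) (w (n + 1))) := by
    generalize w (n - 1) = a at *
    generalize w (n + 1) = b at *
    generalize w n = c at *
    clear a1 a2 b1 b2 h3 h5
    have n1 : ¬ SameCylinder .A .D := fun h => nomatch h
    have n2 : ¬ SameCylinder .D .A := fun h => nomatch h
    have n3 : ¬ SameCylinder .B .C := fun h => nomatch h
    have n4 : ¬ SameCylinder .C .B := fun h => nomatch h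
    have n5 := SameCylinder.cc
    have n6 := SameCylinder.bd
    have n7 := SameCylinder.db
    cases h1 <;> cases h4 <;> simp_all
  rw [key]
  by_cases p : SameCylinder (w (n - 1)) (w n) <;> by_cases q : SameCylinder (w n) (w (n + 1)) <;>
    simp only [p, q, iff_true, iff_false, not_true, true_iff, false_iff, not_lt]
  · exact mul_pos (b1 q) (a1 p)
  · exact (mul_neg_of_neg_of_pos (b2 q) (a1 p)).le
  · exact (mul_neg_of_pos_of_neg (b1 q) (a2 p)).le
  · exact mul_pos_of_neg_of_neg (b2 q) (a2 p)

end Crossings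

/-! ### The times at which the diagonals are met -/

namespace Crossings

variable {v : Plane} {τ : ℝ → OctagonSurface} {w : ℤ → Letter} {t : ℤ → ℝ} {X : ℤ → Plane}

/-- The default value of `halfDiag` and 0/0 = 0 give the crossing time itself, as is right for a
side that is preserved. -/
theorem diagTime_of_A {n : ℤ} (h : w n = .A) : diagTime v w t X n = t n := by
  simp [diagTime, h, halfDiag, cross]

variable (H : Crossings v τ w t X)

include H

/-- Cramer's rule for c + s v = μ U gives μ = (v × c)/(v × U), and the sign condition of
`sandwiched_iff` says |μ| < 1. -/
theorem exists_diag_coord {n : ℤ} (hA : w n ≠ .A) (hs : w (n - 1) = w (n + 1)) :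
    ∃ μ ∈ Set.Ioo (-1 : ℝ) 1, X n + normal (outSide (w n)) + (diagTime v w t X n - t n) • v =
      μ • halfDiag (w n) := by
  have h := (H.sandwiched_iff hA).1 hs
  have e : diagTime v w t X n - t n = cross (halfDiag (w n)) (X n + normal (outSide (w n))) /
      cross v (halfDiag (w n)) := by rw [diagTime]; ring
  rw [e]
  generalize X n + normal (outSide (w n)) = c at *
  generalize halfDiag (w n) = U at *
  have e1 : cross v (U - c) = cross v U - cross v c := by simp [cross]; ring
  have e2 : cross v (U + c) = cross v U + cross v c := by simp [cross]; ring
  rw [e1, e2] at h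
  have hk : cross v U ≠ 0 := fun h0 => by rw [h0] at h; nlinarith [sq_nonneg (cross v c)]
  have hl : cross v c / cross v U * cross v U = cross v c := div_mul_cancel₀ _ hk
  have h2 : (cross v c / cross v U) ^ 2 < 1 := by
    rw [div_pow, div_lt_one (by positivity)]; nlinarith
  refine ⟨cross v c / cross v U, abs_lt.1 ((sq_lt_one_iff_abs_lt_one _).1 h2), plane_ext ?_ ?_⟩
  all_goals
    simp only [Pi.add_apply, Pi.smul_apply, smul_eq_mul]
    field_simp
    simp only [cross]
    ring

/-- The ends `μ = ±1` are excluded because the inequalities in `trans_prop` are strict. -/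
theorem eq_diagTime {n : ℤ} (hA : w n ≠ .A) {μ s : ℝ} (hμ : μ ∈ Set.Icc (-1 : ℝ) 1)
    (h : X n + normal (outSide (w n)) + s • v = μ • halfDiag (w n)) :
    w (n - 1) = w (n + 1) ∧ diagTime v w t X n = t n + s := by
  have h1 := H.trans_prop n
  have h2 := H.trans_prop (n - 1)
  rw [sub_add_cancel] at h2
  have n1 : cross v (halfDiag (w n) - (X n + normal (outSide (w n)))) ≠ 0 := by
    by_cases hc : SameCylinder (w n) (w (n + 1))
    · exact ((h1.2.1 hA).1 hc).ne'
    · exact ((h1.2.1 hA).2 hc).ne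
  have n2 : cross v (halfDiag (w n) + (X n + normal (outSide (w n)))) ≠ 0 := by
    by_cases hc : SameCylinder (w (n - 1)) (w n)
    · exact ((h2.2.2 hA).1 hc).ne'
    · exact ((h2.2.2 hA).2 hc).ne
  rw [H.sandwiched_iff hA, diagTime]
  clear h1 h2
  generalize X n + normal (outSide (w n)) = c at *
  generalize halfDiag (w n) = U at *
  obtain rfl : c = μ • U - s • v := by rw [← h]; abel
  have e1 : cross v (U - (μ • U - s • v)) = (1 - μ) * cross v U := by simp [cross]; ring
  have e2 : cross v (U + (μ • U - s • v)) = (1 + μ) * cross v U := by simp [cross]; ring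
  have e3 : cross U (μ • U - s • v) = s * cross v U := by simp [cross]; ring
  rw [e1] at n1
  rw [e2] at n2
  have hk := right_ne_zero_of_mul n1
  have m1 := lt_of_le_of_ne hμ.2 (sub_ne_zero.1 (left_ne_zero_of_mul n1)).symm
  have m2 := lt_of_le_of_ne hμ.1 (fun h => left_ne_zero_of_mul n2 (by rw [← h]; norm_num))
  rw [e1, e2, e3, mul_div_cancel_right₀ _ hk]
  refine ⟨?_, rfl⟩
  have : 0 < (1 - μ) * (1 + μ) := mul_pos (by linarith) (by linarith)
  have := mul_pos this (sq_pos_of_ne_zero hk)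
  nlinarith

theorem gap_pos (n : ℤ) : 0 < t (n + 1) - t n := sub_pos.2 (H.mono (lt_add_one n))

/-- For `μ ≥ 0` the diagonal is met between crossings `n` and `n + 1`, for `μ ≤ 0` between `n - 1`
and `n`. The bounds away from the neighbouring crossings are strict because the half diagonal, apart
from its end, stays off the forward sides (`dot_halfDiag_lt`). -/
theorem diagTime_spec {n : ℤ} (hs : w (n - 1) = w (n + 1)) :
    diagTime v w t X n ∈ Set.Ioo (t (n - 1)) (t (n + 1)) ∧
      τ (diagTime v w t X n) ∈ inducedSide involution (w n) := by
  by_cases hA : w n = .A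
  · rw [diagTime_of_A hA]
    refine ⟨⟨H.mono (by omega), H.mono (by omega)⟩, ?_⟩
    have := H.label n
    rw [hA, inducedSide_involution_A, ← hA]
    exact this
  obtain ⟨μ, hμ, h⟩ := H.exists_diag_coord hA hs
  rw [mem_inducedSide_involution hA]
  generalize hσ : diagTime v w t X n - t n = s at h
  have ht : diagTime v w t X n = t n + s := by linarith
  rw [ht]
  have hU := halfDiag_dot_nonneg (w n)
  have hp := outSide_dot_pos H.sector
  rcases le_total 0 μ with h0 | h0
  · have e : X n + s • v = μ • halfDiag (w n) - normal (outSide (w n)) := by rw [← h]; abel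
    have hm := halfDiag_sub_mem_octagon hA ⟨h0, hμ.2.le⟩
    have s0 : 0 ≤ s := by
      have h1 := (H.mem n).2
      have h2 := congrArg (fun x => normal (outSide (w n)) ⬝ᵥ x) e
      simp only [dotProduct_add, dotProduct_sub, dotProduct_smul, dotProduct_neg, normal_dot_self,
        smul_eq_mul] at h1 h2
      have := mul_nonneg h0 hU
      by_contra! hc
      nlinarith [hp (w n)]
    have s1 : s < t (n + 1) - t n := by
      have h1 := (H.exit_mem (n + 1)).2
      rw [← H.next n] at h1
      have h2 := dot_halfDiag_lt hA (w (n + 1)) h0 hμ.2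
      rw [← e] at h2
      simp only [dotProduct_add, dotProduct_smul, smul_eq_mul] at h1 h2
      by_contra! hc
      nlinarith [hp (w (n + 1))]
    refine ⟨⟨by linarith [H.mono (sub_one_lt n)], by linarith⟩, μ, ⟨h0, hμ.2.le⟩, ⟨_, hm⟩, ?_,
      Or.inl rfl⟩
    rw [H.flow n s ⟨s0, s1.le⟩ (e ▸ hm)]
    congr 1; exact Subtype.ext e.symm
  · have hnx := H.next (n - 1)
    have hg := H.gap_pos (n - 1)
    have hf := H.flow (n - 1)
    rw [sub_add_cancel] at hnx hg hf
    have e : X n + (2 : ℝ) • normal (outSide (w n)) + s • v =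
        -((-μ) • halfDiag (w n) - normal (outSide (w n))) := by
      rw [_root_.neg_smul, ← h, two_smul]; abel
    have e' : X (n - 1) + (t n - t (n - 1) + s) • v =
        -((-μ) • halfDiag (w n) - normal (outSide (w n))) := by
      rw [← e, ← hnx, add_smul]; abel
    have hI : -μ ∈ Set.Icc (0 : ℝ) 1 := ⟨by linarith, by linarith [hμ.1]⟩
    have hm := neg_mem_octagon (halfDiag_sub_mem_octagon hA hI)
    have s0 : s ≤ 0 := by
      have h1 := (H.exit_mem n).2
      have h2 := congrArg (fun x => normal (outSide (w n)) ⬝ᵥ x) e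
      simp only [dotProduct_add, dotProduct_sub, dotProduct_smul, dotProduct_neg, normal_dot_self,
        smul_eq_mul] at h1 h2
      have := mul_nonneg (neg_nonneg.2 h0) hU
      by_contra! hc
      nlinarith [hp (w n)]
    have s1 : 0 < t n - t (n - 1) + s := by
      have h1 := (H.mem (n - 1)).2
      have h2 := dot_halfDiag_lt hA (w (n - 1)) hI.1 (by linarith [hμ.1])
      rw [← neg_eq_iff_eq_neg.2 e'] at h2
      simp only [dotProduct_add, dotProduct_neg, dotProduct_smul, smul_eq_mul] at h1 h2
      by_contra! hc
      nlinarith [hp (w (n - 1))]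
    refine ⟨⟨by linarith, by linarith [H.mono (lt_add_one n)]⟩, -μ, hI, ⟨_, hm⟩, ?_, Or.inr rfl⟩
    have hτ := hf _ ⟨s1.le, by linarith⟩ (e' ▸ hm)
    rw [show t (n - 1) + (t n - t (n - 1) + s) = t n + s by ring] at hτ
    rw [hτ]
    congr 1; exact Subtype.ext e'.symm

/-- Both times may fall between the same two crossings, so `diagTime_spec` does not order them. The
vector `D • v` joins points of two explicit diagonals; its sign is tested by the cross product with
the second diagonal when both letters belong to one cylinder, and by height for the pair B, C. -/
theorem diagTime_lt_succ {n : ℤ} (hs : w (n - 1) = w (n + 1)) (hs' : w n = w (n + 1 + 1)) :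
    diagTime v w t X n < diagTime v w t X (n + 1) := by
  have hs'' : w (n + 1 - 1) = w (n + 1 + 1) := by rw [add_sub_cancel_right]; exact hs'
  by_cases hA : w n = .A
  · rw [diagTime_of_A hA]
    have := (H.diagTime_spec hs'').1.1
    rwa [add_sub_cancel_right] at this
  by_cases hA' : w (n + 1) = .A
  · rw [diagTime_of_A hA']
    exact (H.diagTime_spec hs).1.2
  obtain ⟨μ, hμ, h⟩ := H.exists_diag_coord hA hs
  obtain ⟨μ', hμ', h'⟩ := H.exists_diag_coord hA' hs''
  have hR := (H.trans_prop n).2.2 hA'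
  have hv := H.sector
  set D := diagTime v w t X (n + 1) - diagTime v w t X n with hD
  suffices 0 < D by rw [hD] at this; linarith
  have key : D • v = μ' • halfDiag (w (n + 1)) - μ • halfDiag (w n) + normal (outSide (w n)) +
      normal (outSide (w (n + 1))) := by
    rw [← h, ← h', hD]
    have := H.next n
    rw [two_smul] at this
    have e : X n = X (n + 1) + (normal (outSide (w (n + 1))) + normal (outSide (w (n + 1)))) -
      (t (n + 1) - t n) • v := by rw [← this]; abel
    rw [e]
    ext i
    simp
    ring
  have he := H.edge n
  have hb := sqrt_two_bounds
  have hss := sqrt_two_mul_self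
  have hk : 0 < cross v (halfDiag (w (n + 1)) + (X (n + 1) + normal (outSide (w (n + 1))))) →
      0 < cross v (halfDiag (w (n + 1))) := by
    intro hc
    have e : cross v (halfDiag (w (n + 1)) + (X (n + 1) + normal (outSide (w (n + 1))))) =
        (1 + μ') * cross v (halfDiag (w (n + 1))) := by
      rw [show X (n + 1) + normal (outSide (w (n + 1))) = μ' • halfDiag (w (n + 1)) -
        (diagTime v w t X (n + 1) - t (n + 1)) • v by rw [← h']; abel]
      simp [cross]; ring
    rw [e] at hc
    exact pos_of_mul_pos_right hc (by linarith [hμ'.1])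
  have hcr : ∀ u : Plane, D * cross v u = cross (D • v) u := fun u => by simp [cross]; ring
  obtain ⟨m1, m2⟩ := hμ
  obtain ⟨m3, m4⟩ := hμ'
  generalize halfDiag (w (n + 1)) + (X (n + 1) + normal (outSide (w (n + 1)))) = Z at *
  clear h h' hs hs' hs''
  generalize w n = a at *
  generalize w (n + 1) = b at *
  have c1 := congrFun key 1
  have c2 := hcr (halfDiag b)
  rw [key] at c2
  clear key hcr
  clear_value D
  have hv1 := hv.1
  cases he
  · exact absurd rfl hA
  · exact absurd rfl hA'
  · have h1 := hk (hR.1 .db)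
    refine pos_of_mul_pos_left ?_ h1.le
    rw [c2]
    simp [cross, halfDiag, outSide, normal_eq]
    nlinarith
  · have h1 := hk (hR.1 .bd)
    refine pos_of_mul_pos_left ?_ h1.le
    rw [c2]
    simp [cross, halfDiag, outSide, normal_eq]
    nlinarith
  · simp [halfDiag, outSide, normal_eq] at c1
    refine pos_of_mul_pos_left ?_ hv1.le
    rw [c1]; nlinarith
  · simp [halfDiag, outSide, normal_eq] at c1
    refine pos_of_mul_pos_left ?_ hv1.le
    rw [c1]; nlinarith
  · have h1 := hk (hR.1 .cc)
    refine pos_of_mul_pos_left ?_ h1.le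
    rw [c2]
    simp [cross, halfDiag, outSide, normal_eq]
    nlinarith

end Crossings

/-! ### The derived sequence as cutting sequence along the diagonals -/

namespace Crossings

variable {v : Plane} {τ : ℝ → OctagonSurface} {w : ℤ → Letter} {t : ℤ → ℝ} {X : ℤ → Plane}
variable (H : Crossings v τ w t X)

include H

theorem range_isolated (T : ℝ) : ∀ᶠ s in 𝓝 (0 : ℝ), s ≠ 0 → T + s ∉ Set.range t := by
  filter_upwards [H.traj.hits_isolated H.sector T] with s hs h0
  rw [H.range]
  rintro ⟨L, hL⟩
  exact hs h0 L hL

/-- Of the two representatives of a crossing point, one starts segment `n` and the other ends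
segment `n - 1`; any other point of the trajectory has only one. -/
theorem exists_segment {T : ℝ} {x : octagon} (hx : toSurface x = τ T) :
    ∃ n, ∃ s ∈ Set.Icc 0 (t (n + 1) - t n), T = t n + s ∧ X n + s • v = x := by
  obtain ⟨n, hn⟩ := exists_mem_Ico_of_isolated H.mono H.range_isolated T
  have hX : X n ∈ octagon := by simpa using neg_mem_octagon (H.mem n).1
  have hend : X n + (t (n + 1) - t n) • v ∈ octagon := by
    rw [H.next n]; exact (H.exit_mem (n + 1)).1
  have hI : T - t n ∈ Set.Icc 0 (t (n + 1) - t n) := ⟨by linarith [hn.1], by linarith [hn.2]⟩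
  have hm := add_smul_mem_octagon hX hend hI
  have hf := H.flow n _ hI hm
  rw [add_sub_cancel] at hf
  have hv : ¬ IsVertex (X n + (T - t n) • v) := by
    have := H.traj.1 T
    rwa [hf, toSurface_mem_singularSet] at this
  rcases eq_or_glue_of_not_isVertex hv (hf.symm.trans hx.symm) with h | ⟨i, hi, h⟩
  · exact ⟨n, _, hI, by ring, congrArg Subtype.val h⟩
  · have h0 : T = t n := by
      by_contra hne
      have h1 := lt_of_le_of_ne hn.1 (Ne.symm hne)
      exact (dot_lt_of_between H.sector hX hend (s := T - t n) (by linarith) (by linarith [hn.2])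
        i).ne hi.2
    subst h0
    simp only [sub_self, zero_smul, add_zero] at hi h
    have hXi : X n ∈ side (outSide (w n) + 4) := by
      have := neg_mem_side (i := outSide (w n) + 4) (x := -X n)
        (by rw [add_four_add_four]; exact H.mem n)
      simpa using this
    have hXv : ¬ IsVertex (X n) := by simpa using not_isVertex_neg (H.notVertex n)
    obtain rfl := eq_of_mem_side hXv hi hXi
    have hnx := H.next (n - 1)
    have hg := H.gap_pos (n - 1)
    rw [sub_add_cancel] at hnx hg
    refine ⟨n - 1, t n - t (n - 1), by rw [sub_add_cancel]; exact ⟨hg.le, le_rfl⟩, by ring, ?_⟩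
    rw [hnx, h, normal_add_four, smul_neg, sub_neg_eq_add]

/-- By `eq_of_flow_eq_diag`, a point of the half diagonal attached to the entry side belongs to the
crossing that starts the segment. The other half is handled by rotation by π and belongs to the
crossing `n + 1` that ends it. -/
theorem exists_diagTime_eq {T : ℝ} {L : Letter} (h : τ T ∈ inducedSide involution L) :
    ∃ n, w (n - 1) = w (n + 1) ∧ diagTime v w t X n = T := by
  by_cases hA : L = .A
  · rw [hA, inducedSide_involution_A] at h
    obtain ⟨n, rfl⟩ : T ∈ Set.range t := by rw [H.range]; exact ⟨_, h⟩
    have hn := label_unique (H.traj.1 _) (H.label n) h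
    exact ⟨n, H.sandwiched_of_A hn, diagTime_of_A hn⟩
  obtain ⟨μ, hμ, x, hx, hxμ⟩ := (mem_inducedSide_involution hA).1 h
  obtain ⟨n, s, hs, rfl, hX⟩ := H.exists_segment hx
  rcases hxμ with hxμ | hxμ <;> rw [hxμ] at hX
  · obtain rfl := eq_of_flow_eq_diag H.sector hA (H.mem n) (H.notVertex n) hμ hX
    exact ⟨n, H.eq_diagTime hA ⟨by linarith [hμ.1], hμ.2⟩ (by
      rw [← eq_sub_iff_add_eq.1 hX]; abel)⟩
  · have e : -(X (n + 1) + (2 : ℝ) • normal (outSide (w (n + 1)))) + (t (n + 1) - t n - s) • v =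
        μ • halfDiag L - normal (outSide L) := by
      rw [← neg_eq_iff_eq_neg.2 hX, ← H.next n]
      ext i; simp; ring
    have hY := H.exit_mem (n + 1)
    have hYv := H.exit_notVertex (n + 1)
    have hL := eq_of_flow_eq_diag H.sector hA (by rwa [neg_neg]) (by rwa [neg_neg]) hμ e
    have hd := H.eq_diagTime (n := n + 1) (μ := -μ) (s := -(t (n + 1) - t n - s)) (hL ▸ hA)
      ⟨by linarith [hμ.2], by linarith [hμ.1]⟩ (by
        rw [hL, _root_.neg_smul, _root_.neg_smul, ← eq_sub_iff_add_eq.1 e, two_smul, hL]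
        abel)
    exact ⟨n + 1, hd.1, by rw [hd.2]; ring⟩

theorem diagTime_strictMonoOn : StrictMonoOn (diagTime v w t X) {n | w (n - 1) = w (n + 1)} := by
  intro a ha b hb hab
  rcases (by omega : b = a + 1 ∨ a + 2 ≤ b) with rfl | h
  · exact H.diagTime_lt_succ ha (by simpa using hb)
  · exact ((H.diagTime_spec ha).1.2.trans_le (H.mono.monotone (by omega))).trans
      (H.diagTime_spec hb).1.1

theorem exists_derived : ∃ w', IsDerived w w' ∧ IsCuttingSequence (inducedSide involution) τ w' := by
  obtain ⟨e, he, hr⟩ := exists_enumeration (S := {n | w (n - 1) = w (n + 1)})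
    (fun n => let ⟨m, h1, h2, _⟩ := exists_sandwiched H.edge n; ⟨m, h1, h2⟩)
    (fun n => let ⟨m, h1, _, h3⟩ := exists_sandwiched H.edge (n - 8); ⟨m, h1, by omega⟩)
  have hm : ∀ n, w (e n - 1) = w (e n + 1) := fun n =>
    (by rw [← hr]; exact ⟨n, rfl⟩ : e n ∈ {n | w (n - 1) = w (n + 1)})
  refine ⟨fun n => w (e n), ⟨⟨0, fun n => ?_⟩, e, he, hr, fun n => rfl⟩,
    fun n => diagTime v w t X (e n),
    fun a b hab => H.diagTime_strictMonoOn (hm a) (hm b) (he hab), ?_,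
    fun n => (H.diagTime_spec (hm n)).2⟩
  · have hid : ∀ L, relabel 0 L = L := fun L => by cases L <;> rfl
    rw [DiagramEdge, hid, hid]
    exact H.edge n
  · ext T
    constructor
    · rintro ⟨n, rfl⟩
      exact ⟨_, (H.diagTime_spec (hm n)).2⟩
    · rintro ⟨L, hL⟩
      obtain ⟨n, hn, rfl⟩ := H.exists_diagTime_eq hL
      obtain ⟨k, rfl⟩ : n ∈ Set.range e := by rw [hr]; exact hn
      exact ⟨k, rfl⟩

end Crossings

theorem exists_derived_of_inSector {v : Plane} (hv : InSector v) {τ : ℝ → OctagonSurface}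
    (hτ : IsLinearTrajectory v τ) {w : ℤ → Letter} (hw : IsCuttingSequence labelledSide τ w) :
    (∀ n, BaseEdge (w n) (w (n + 1))) ∧
    ∃ w', IsDerived w w' ∧ IsCuttingSequence (inducedSide involution) τ w' := by
  obtain ⟨t, ht, hr, hl⟩ := hw
  obtain ⟨X, hX⟩ := exists_crossings hv hτ ht hr hl
  have H : Crossings v τ w t X := ⟨hv, hτ, ht, hr, hl, fun n => neg_mem_side (hX n).1,
    fun n => not_isVertex_neg (hX n).2.1, fun n => (hX n).2.2.1, fun n => (hX n).2.2.2⟩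
  exact ⟨H.edge, H.exists_derived⟩

/-! ### The quadratic form associated to a point of the upper half plane -/

/-- The symmetric bilinear form `(u, v) ↦ Re ((u₀ z + u₁) (v₀ z̄ + v₁))`. -/
def form (z : ℍ) (u v : Plane) : ℝ :=
  u 0 * v 0 * (z.re ^ 2 + z.im ^ 2) + (u 0 * v 1 + u 1 * v 0) * z.re + u 1 * v 1

theorem rightAct_rightAct (z : ℍ) (M N : GL (Fin 2) ℝ) :
    rightAct (rightAct z M) N = rightAct z (M * N) := by
  rw [rightAct, rightAct, rightAct, smul_smul]
  congr 1
  ext : 1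
  exact (Matrix.transpose_mul _ _).symm

theorem rightAct_one (z : ℍ) : rightAct z 1 = z := by
  have : transposeGL 1 = 1 := by ext : 1; exact Matrix.transpose_one
  rw [rightAct, this, one_smul]

/-- Clearing the denominator turns u₀(zM) + u₁ into (Mu)₀z + (Mu)₁, up to a conjugation that the
real part ignores. -/
theorem form_rightAct (z : ℍ) (M : GL (Fin 2) ℝ) : ∃ K > 0, ∀ u v, form (rightAct z M) u v * K =
    form z ((M : Matrix (Fin 2) (Fin 2) ℝ) *ᵥ u) ((M : Matrix (Fin 2) (Fin 2) ℝ) *ᵥ v) := by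
  have hK := normSq_denom_pos (transposeGL M) z.im_ne_zero
  refine ⟨_, hK, fun u v => ?_⟩
  have h1 : ((transposeGL M • z : ℍ).re) ^ 2 + ((transposeGL M • z : ℍ).im) ^ 2 =
      Complex.normSq (num (transposeGL M) z) / Complex.normSq (denom (transposeGL M) z) := by
    rw [re_smul, im_smul, sq_abs, ← Complex.normSq_div, Complex.normSq_apply]; ring
  rw [form, rightAct, h1, re_smul, Complex.div_re]
  field_simp
  have e00 : transposeGL M 0 0 = M 0 0 := rfl
  have e01 : transposeGL M 0 1 = M 1 0 := rfl
  have e10 : transposeGL M 1 0 = M 0 1 := rfl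
  have e11 : transposeGL M 1 1 = M 1 1 := rfl
  simp only [form, num, denom, e00, e01, e10, e11, Complex.normSq_apply, Complex.add_re,
    Complex.add_im, Complex.mul_re, Complex.mul_im, Complex.ofReal_re, Complex.ofReal_im,
    Matrix.mulVec, dotProduct, Fin.sum_univ_two, coe_re, coe_im]
  ring

theorem form_I (u v : Plane) : form UpperHalfPlane.I u v = u ⬝ᵥ v := by
  simp [form, dotProduct, Fin.sum_univ_two]

/-- Up to a positive function, this is the value of the form along a Teichmüller ray. -/
noncomputable def rayForm (θ : ℝ) (u v : Plane) (t : ℝ) : ℝ :=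
  Real.exp (2 * t) * (cross ![Real.cos θ, Real.sin θ] u * cross ![Real.cos θ, Real.sin θ] v) +
    (![Real.cos θ, Real.sin θ] ⬝ᵥ u) * (![Real.cos θ, Real.sin θ] ⬝ᵥ v)

/-- The flow gives the direction θ the weight e^{-t} and its normal the weight e^t. Multiplying by
e^t makes the form affine in e^{2t}. -/
theorem form_teichRay (θ t : ℝ) : ∃ K > 0, ∀ u v, form (teichRay θ t) u v * K = rayForm θ u v t := by
  obtain ⟨K, hK, h⟩ := form_rightAct UpperHalfPlane.I (teichFlowDir θ t)
  refine ⟨K * Real.exp t, by positivity, fun u v => ?_⟩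
  rw [← mul_assoc, teichRay, diskPoint, h, form_I, rayForm]
  have hd : ∀ u, ((teichFlowDir θ t : GL (Fin 2) ℝ) : Matrix (Fin 2) (Fin 2) ℝ) *ᵥ u =
      !![Real.sin θ, Real.cos θ; -Real.cos θ, Real.sin θ] *ᵥ
        (!![Real.exp (t / 2), 0; 0, Real.exp (-t / 2)] *ᵥ
          (!![Real.sin θ, -Real.cos θ; Real.cos θ, Real.sin θ] *ᵥ u)) := by
    intro u
    have e1 : ((rotation (Real.pi / 2 - θ) : GL (Fin 2) ℝ) : Matrix (Fin 2) (Fin 2) ℝ) =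
        !![Real.sin θ, -Real.cos θ; Real.cos θ, Real.sin θ] := by
      rw [← Real.cos_pi_div_two_sub θ, ← Real.sin_pi_div_two_sub θ]; rfl
    have hsc := Real.sin_sq_add_cos_sq θ
    have e2 : (((rotation (Real.pi / 2 - θ))⁻¹ : GL (Fin 2) ℝ) : Matrix (Fin 2) (Fin 2) ℝ) =
        !![Real.sin θ, Real.cos θ; -Real.cos θ, Real.sin θ] := by
      rw [Matrix.coe_units_inv]
      apply Matrix.inv_eq_left_inv
      rw [e1]
      ext i j
      fin_cases i <;> fin_cases j <;> simp [Matrix.mul_apply, Fin.sum_univ_two] <;> linarith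
    rw [teichFlowDir, Units.val_mul, Units.val_mul, e1, e2, ← Matrix.mulVec_mulVec,
      ← Matrix.mulVec_mulVec]
    rfl
  rw [hd, hd]
  have h1 : Real.exp (t / 2) ^ 2 * Real.exp t = Real.exp (2 * t) := by
    rw [sq, ← Real.exp_add, ← Real.exp_add]; congr 1; ring
  have h2 : Real.exp (-t / 2) ^ 2 * Real.exp t = 1 := by
    rw [sq, ← Real.exp_add, ← Real.exp_add, ← Real.exp_zero]; congr 1; ring
  have hsc := Real.sin_sq_add_cos_sq θ
  rw [← h1, show ∀ a b : ℝ, a + b = a + 1 * b by intros; ring, ← h2]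
  generalize Real.exp (t / 2) = a
  generalize Real.exp (-t / 2) = b
  simp [cross, Matrix.mulVec, dotProduct, Fin.sum_univ_two]
  have hc : Real.cos θ ^ 2 = 1 - Real.sin θ ^ 2 := by linarith
  ring_nf
  have hc4 : Real.cos θ ^ 4 = (1 - Real.sin θ ^ 2) ^ 2 := by rw [← hc]; ring
  have hc3 : Real.cos θ ^ 3 = Real.cos θ * (1 - Real.sin θ ^ 2) := by rw [← hc]; ring
  simp only [hc4, hc3, hc]
  ring

theorem form_symm (z : ℍ) (u v : Plane) : form z u v = form z v u := by
  simp only [form]; ring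

theorem form_injective {z z' : ℍ} {K : ℝ} (h : ∀ u v, form z u v * K = form z' u v) : z = z' := by
  have h1 := h ![0, 1] ![0, 1]
  have h2 := h ![0, 1] ![1, 0]
  have h3 := h ![1, 0] ![1, 0]
  simp [form] at h1 h2 h3
  subst h1
  rw [mul_one] at h2 h3
  have h4 : z.im = z'.im := by
    rw [h2] at h3
    exact (sq_eq_sq₀ z.im_pos.le z'.im_pos.le).1 (by linarith)
  exact UpperHalfPlane.ext (Complex.ext h2 h4)

/-! ### The sides of the ideal octagon -/

/-- A vector that spans the eigenspace of `γ_i` to the eigenvalue `-1`. -/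
def negVec (i : Fin 8) : Plane :=
  ![![1, 0], ![1, 1], ![1, 1], ![0, 1], ![0, 1], ![-1, 1], ![-1, 1], ![-1, 0]] i

/-- A vector that spans the eigenspace of `γ_i` to the eigenvalue `1`. -/
noncomputable def fixVec (i : Fin 8) : Plane :=
  ![![1 + √2, 1], ![1 + √2, 1], ![1, 1 + √2], ![1, 1 + √2], ![-1, 1 + √2], ![-1, 1 + √2],
    ![-(1 + √2), 1], ![-(1 + √2), 1]] i

theorem nu_mulVec_negVec (i : Fin 8) : ∃ c : ℝ, 0 < c ∧ nuMatrix i *ᵥ negVec i = c • ![1, 0] := by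
  have h : 1 / √2 = √2 / 2 := by field_simp; nlinarith [sqrt_two_mul_self]
  have h0 := sqrt_two_bounds
  refine ⟨![1, √2, √2, 1, 1, √2, √2, 1] i, ?_, ?_⟩
  · fin_cases i <;> simp
  · fin_cases i <;> apply plane_ext <;> simp [nuMatrix, negVec, h, Matrix.mulVec, dotProduct,
      Fin.sum_univ_two]

theorem nu_mulVec_fixVec (i : Fin 8) : nuMatrix i *ᵥ fixVec i = ![1 + √2, 1] := by
  have h : 1 / √2 = √2 / 2 := by field_simp; nlinarith [sqrt_two_mul_self]
  have h0 := sqrt_two_mul_self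
  fin_cases i <;> apply plane_ext <;> simp [nuMatrix, fixVec, h, Matrix.mulVec, dotProduct,
      Fin.sum_univ_two, -one_div, -mul_eq_right₀, -mul_eq_left₀] <;> nlinarith

theorem gammaSide_mulVec_eq (i : Fin 8) {u x : Plane} (h : (gammaGL : Matrix (Fin 2) (Fin 2) ℝ) *ᵥ
    (nuMatrix i *ᵥ u) = nuMatrix i *ᵥ x) :
    (gammaSide i : Matrix (Fin 2) (Fin 2) ℝ) *ᵥ u = x := by
  have e : ((nuGL i : GL (Fin 2) ℝ) : Matrix (Fin 2) (Fin 2) ℝ) = nuMatrix i := rfl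
  rw [← e] at h
  rw [gammaSide, Units.val_mul, Units.val_mul, ← Matrix.mulVec_mulVec, ← Matrix.mulVec_mulVec, h,
    Matrix.mulVec_mulVec, Units.inv_mul, Matrix.one_mulVec]

theorem gammaSide_mulVec_negVec (i : Fin 8) :
    (gammaSide i : Matrix (Fin 2) (Fin 2) ℝ) *ᵥ negVec i = -negVec i := by
  obtain ⟨c, -, hc⟩ := nu_mulVec_negVec i
  apply gammaSide_mulVec_eq
  rw [Matrix.mulVec_neg, hc]
  ext j
  fin_cases j <;> simp [gammaGL, Matrix.mulVec, dotProduct, Fin.sum_univ_two]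

theorem gammaSide_mulVec_fixVec (i : Fin 8) :
    (gammaSide i : Matrix (Fin 2) (Fin 2) ℝ) *ᵥ fixVec i = fixVec i := by
  apply gammaSide_mulVec_eq
  rw [nu_mulVec_fixVec]
  ext j
  fin_cases j <;> simp [gammaGL, Matrix.mulVec, dotProduct, Fin.sum_univ_two]; ring

theorem exists_eq_negVec_add_fixVec (i : Fin 8) (u : Plane) :
    ∃ x y : ℝ, u = x • negVec i + y • fixVec i := by
  have hk : cross (negVec i) (fixVec i) ≠ 0 := by
    have h0 := sqrt_two_bounds
    fin_cases i <;> simp [cross, negVec, fixVec]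
  refine ⟨cross u (fixVec i) / cross (negVec i) (fixVec i),
    cross (negVec i) u / cross (negVec i) (fixVec i), plane_ext ?_ ?_⟩
  all_goals
    simp only [Pi.add_apply, Pi.smul_apply, smul_eq_mul]
    field_simp
    simp only [cross]
    ring

theorem gammaSide_mul_self (i : Fin 8) : gammaSide i * gammaSide i = 1 := by
  have h : gammaGL * gammaGL = 1 := by
    ext j k
    fin_cases j <;> fin_cases k <;> simp [gammaGL, Matrix.mul_apply, Fin.sum_univ_two]
  rw [gammaSide, show (nuGL i)⁻¹ * gammaGL * nuGL i * ((nuGL i)⁻¹ * gammaGL * nuGL i) =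
    (nuGL i)⁻¹ * (gammaGL * gammaGL) * nuGL i by group, h]
  group

/-- The function whose zero set is the `i`-th side of the ideal octagon, and which is positive on
the ideal octagon. -/
noncomputable def wall (i : Fin 8) (z : ℍ) : ℝ := form z (negVec i) (fixVec i)

theorem mem_idealSide_iff {i : Fin 8} {z : ℍ} : z ∈ idealSide i ↔ rightAct z (gammaSide i) = z := by
  constructor
  · rintro ⟨y, hy, rfl⟩
    have hy : rightAct y gammaGL = y := hy
    simp only
    rw [rightAct_rightAct, gammaSide, ← mul_assoc, ← mul_assoc, mul_inv_cancel, one_mul,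
      ← rightAct_rightAct, hy]
  · intro h
    refine ⟨rightAct z (nuGL i)⁻¹, ?_, ?_⟩
    · change rightAct _ _ = _
      have e : (nuGL i)⁻¹ * gammaGL = gammaSide i * (nuGL i)⁻¹ := by rw [gammaSide]; group
      rw [rightAct_rightAct, e, ← rightAct_rightAct, h]
    · simp only
      rw [rightAct_rightAct, inv_mul_cancel, rightAct_one]

theorem wall_rightAct_gammaSide (i : Fin 8) (z : ℍ) :
    ∃ K > 0, wall i (rightAct z (gammaSide i)) * K = -wall i z := by
  obtain ⟨K, hK, h⟩ := form_rightAct z (gammaSide i)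
  refine ⟨K, hK, ?_⟩
  rw [wall, h, gammaSide_mulVec_negVec, gammaSide_mulVec_fixVec, wall]
  simp only [form, Pi.neg_apply]; ring

/-- In the eigenbasis of γ_i the reflection changes only the sign of the mixed terms of the form,
and these vanish on the wall. -/
theorem rightAct_gammaSide_of_wall {i : Fin 8} {z : ℍ} (h : wall i z = 0) :
    rightAct z (gammaSide i) = z := by
  obtain ⟨K, hK, hf⟩ := form_rightAct z (gammaSide i)
  refine form_injective (K := K) fun u v => ?_
  rw [hf]
  obtain ⟨x, y, rfl⟩ := exists_eq_negVec_add_fixVec i u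
  obtain ⟨x', y', rfl⟩ := exists_eq_negVec_add_fixVec i v
  have h' : form z (fixVec i) (negVec i) = 0 := by rw [form_symm]; exact h
  rw [wall] at h
  simp only [Matrix.mulVec_add, Matrix.mulVec_smul, gammaSide_mulVec_negVec,
    gammaSide_mulVec_fixVec]
  simp only [form, Pi.add_apply, Pi.neg_apply, Pi.smul_apply, smul_eq_mul] at h h' ⊢
  linear_combination (-2 * (x * y')) * h - 2 * (y * x') * h'

theorem mem_idealSide_iff_wall {i : Fin 8} {z : ℍ} : z ∈ idealSide i ↔ wall i z = 0 := by
  rw [mem_idealSide_iff]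
  refine ⟨fun h => ?_, rightAct_gammaSide_of_wall⟩
  obtain ⟨K, hK, hf⟩ := wall_rightAct_gammaSide i z
  rw [h] at hf
  nlinarith

/-- Half planes cut off from the ideal octagon by different sides are disjoint. -/
theorem wall_pos_of_wall_nonpos {i j : Fin 8} {z : ℍ} (hi : wall i z ≤ 0) (hij : i ≠ j) :
    0 < wall j z := by
  by_contra! hj
  have hb := sqrt_two_bounds
  have hs := sqrt_two_mul_self
  -- The half plane behind a wall projects to the real axis between its two ideal vertices (walls 3
  -- and 4 are vertical lines), and these eight shadows are disjoint.
  have key : ∀ i : Fin 8, wall i z ≤ 0 → ![1 - √2 < z.re ∧ z.re < 0, -1 < z.re ∧ z.re < 1 - √2,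
      -(1 + √2) < z.re ∧ z.re < -1, z.re ≤ -(1 + √2), 1 + √2 ≤ z.re, 1 < z.re ∧ z.re < 1 + √2,
      √2 - 1 < z.re ∧ z.re < 1, 0 < z.re ∧ z.re < √2 - 1] i := by
    intro i h
    have hz := z.im_pos
    have hNx : z.re ^ 2 < z.re ^ 2 + z.im ^ 2 := by nlinarith
    simp only [wall, form] at h
    generalize z.re ^ 2 + z.im ^ 2 = N at *
    generalize z.re = x at *
    fin_cases i <;> simp [negVec, fixVec] at h ⊢
    · constructor <;> by_contra! hc <;> nlinarith
    · constructor <;> by_contra! hc <;> nlinarith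
    · constructor <;> by_contra! hc <;> nlinarith
    · linarith
    · linarith
    · constructor <;> by_contra! hc <;> nlinarith
    · constructor <;> by_contra! hc <;> nlinarith
    · constructor <;> by_contra! hc <;> nlinarith
  have h1 := key i hi
  have h2 := key j hj
  clear key hi hj
  generalize z.re = x at *
  fin_cases i <;> fin_cases j <;> simp at hij h1 h2 <;> linarith

/-- Products of the reflections `γ_i` without repetitions of neighbouring factors; the first
argument is the index of the last factor. -/
inductive Reduced : Option (Fin 8) → GL (Fin 2) ℝ → Prop
  | one : Reduced none 1
  | mul {o g} (i : Fin 8) : Reduced o g → o ≠ some i → Reduced (some i) (g * gammaSide i)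

theorem Reduced.exists_mul {o : Option (Fin 8)} {g : GL (Fin 2) ℝ} (h : Reduced o g) (i : Fin 8) :
    ∃ o', Reduced o' (g * gammaSide i) := by
  by_cases ho : o = some i
  · cases h with
    | one => simp at ho
    | mul j h' hj =>
      obtain rfl : j = i := by simpa using ho
      rw [mul_assoc, gammaSide_mul_self, mul_one]
      exact ⟨_, h'⟩
  · exact ⟨_, h.mul i ho⟩

theorem exists_reduced {g : GL (Fin 2) ℝ} (hg : g ∈ reflectionGroup) : ∃ o, Reduced o g := by
  induction hg using Subgroup.closure_induction_right with
  | one => exact ⟨none, .one⟩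
  | mul_right x y hx hy ih =>
    obtain ⟨i, rfl⟩ := hy
    obtain ⟨o, ho⟩ := ih
    exact ho.exists_mul i
  | mul_inv_cancel x y hx hy ih =>
    obtain ⟨i, rfl⟩ := hy
    obtain ⟨o, ho⟩ := ih
    rw [inv_eq_of_mul_eq_one_left (gammaSide_mul_self i)]
    exact ho.exists_mul i

/-- A reduced product maps the ideal octagon into the half plane behind the side belonging to its
last factor. -/
theorem Reduced.wall_nonpos {o : Option (Fin 8)} {g : GL (Fin 2) ℝ} (h : Reduced o g) {z : ℍ}
    (hz : ∀ i, 0 ≤ wall i z) :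
    ∀ i, o = some i → wall i (rightAct z g) ≤ 0 ∧ (g ≠ gammaSide i → wall i (rightAct z g) < 0) := by
  induction h with
  | one => simp
  | @mul o g j h hj ih =>
    intro i hi
    obtain rfl : j = i := by simpa using hi
    obtain ⟨K, hK, hw⟩ := wall_rightAct_gammaSide j (rightAct z g)
    rw [rightAct_rightAct] at hw
    cases h with
    | one =>
      rw [rightAct_one] at hw
      refine ⟨?_, fun h => absurd (one_mul _) h⟩
      have := hz j
      by_contra! hc
      nlinarith
    | @mul _ g' k h hk =>
      -- Ping-pong: a point behind wall `k` is strictly in front of wall `j`, and the reflection in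
      -- `j` puts it strictly behind.
      have := wall_pos_of_wall_nonpos (ih k rfl).1 (j := j) (by rintro rfl; exact hj rfl)
      have hlt : wall j (rightAct z (g' * gammaSide k * gammaSide j)) < 0 := by
        by_contra! hc
        nlinarith
      exact ⟨hlt.le, fun _ => hlt⟩

/-- A group element carrying a point of the closed octagon onto E_l must be trivial or γ_l: with
last factor `i ≠ l` it would map the point strictly in front of wall `l`, and any other element
ending in γ_l strictly behind it. -/
theorem wall_eq_zero_of_mem_tessellationSide {z : ℍ} (hz : ∀ i, 0 ≤ wall i z) {l : Fin 8}
    (h : z ∈ tessellationSide l) : wall l z = 0 := by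
  obtain ⟨g, hg, y, hy, rfl⟩ := h
  simp only at hz ⊢
  rw [mem_idealSide_iff_wall] at hy
  set z := rightAct y g with hz'
  have hyz : y = rightAct z g⁻¹ := by rw [hz', rightAct_rightAct, mul_inv_cancel, rightAct_one]
  rw [hyz] at hy
  obtain ⟨o, ho⟩ := exists_reduced (inv_mem hg)
  have hw := ho.wall_nonpos hz
  cases o with
  | none =>
    generalize g⁻¹ = g' at *
    cases ho
    rwa [rightAct_one] at hy
  | some i =>
    obtain rfl : i = l := by
      by_contra hne
      exact (wall_pos_of_wall_nonpos (hw i rfl).1 hne).ne' hy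
    by_cases hgi : g⁻¹ = gammaSide i
    · rw [hgi] at hy
      obtain ⟨K, hK, hw⟩ := wall_rightAct_gammaSide i z
      rw [hy] at hw
      linarith
    · exact absurd hy ((hw i rfl).2 hgi).ne

/-! ### Crossings of a Teichmüller ray with the tessellation -/

/-- The product of the values of the expanding linear form at the two vectors belonging to the
`i`-th side of the image of the ideal octagon under `M⁻¹`. -/
noncomputable def sideSign (θ : ℝ) (M : GL (Fin 2) ℝ) (i : Fin 8) : ℝ :=
  cross ![Real.cos θ, Real.sin θ] ((M : Matrix (Fin 2) (Fin 2) ℝ) *ᵥ negVec i) *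
    cross ![Real.cos θ, Real.sin θ] ((M : Matrix (Fin 2) (Fin 2) ℝ) *ᵥ fixVec i)

/-- Up to a positive function, the value of `wall i` along a Teichmüller ray, moved by `M`. -/
noncomputable def rayWall (θ : ℝ) (M : GL (Fin 2) ℝ) (i : Fin 8) (t : ℝ) : ℝ :=
  rayForm θ ((M : Matrix (Fin 2) (Fin 2) ℝ) *ᵥ negVec i)
    ((M : Matrix (Fin 2) (Fin 2) ℝ) *ᵥ fixVec i) t

theorem wall_teichRay (θ t : ℝ) (M : GL (Fin 2) ℝ) :
    ∃ K > 0, ∀ i, wall i (rightAct (teichRay θ t) M) * K = rayWall θ M i t := by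
  obtain ⟨K, hK, h⟩ := form_teichRay θ t
  obtain ⟨K', hK', h'⟩ := form_rightAct (teichRay θ t) M
  refine ⟨K' * K, mul_pos hK' hK, fun i => ?_⟩
  rw [wall, ← mul_assoc, h', h, rayWall]

/-- The slope with respect to e^{2t} is constant, so its sign decides whether a wall is crossed
outwards. -/
theorem rayWall_sub (θ : ℝ) (M : GL (Fin 2) ℝ) (i : Fin 8) (t t' : ℝ) :
    rayWall θ M i t' - rayWall θ M i t =
      (Real.exp (2 * t') - Real.exp (2 * t)) * sideSign θ M i := by
  rw [rayWall, rayWall, rayForm, rayForm, sideSign]; ring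

theorem rayWall_mul_gammaSide (θ : ℝ) (M : GL (Fin 2) ℝ) (i : Fin 8) (t : ℝ) :
    rayWall θ (M * gammaSide i) i t = -rayWall θ M i t := by
  rw [rayWall, rayWall, Units.val_mul, ← Matrix.mulVec_mulVec, ← Matrix.mulVec_mulVec,
    gammaSide_mulVec_negVec, gammaSide_mulVec_fixVec, Matrix.mulVec_neg, rayForm, rayForm]
  simp only [cross, dotProduct_neg, Pi.neg_apply]; ring

theorem sideSign_mul_gammaSide (θ : ℝ) (M : GL (Fin 2) ℝ) (i : Fin 8) :
    sideSign θ (M * gammaSide i) i = -sideSign θ M i := by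
  rw [sideSign, sideSign, Units.val_mul, ← Matrix.mulVec_mulVec, ← Matrix.mulVec_mulVec,
    gammaSide_mulVec_negVec, gammaSide_mulVec_fixVec, Matrix.mulVec_neg]
  simp only [cross, Pi.neg_apply]; ring

theorem exists_rayWall_eq_zero {θ : ℝ} {M : GL (Fin 2) ℝ} {i : Fin 8} {t t' : ℝ} (htt : t ≤ t')
    (h : 0 < rayWall θ M i t) (h' : rayWall θ M i t' < 0) :
    ∃ u, t < u ∧ u < t' ∧ rayWall θ M i u = 0 := by
  have hc : Continuous (rayWall θ M i) := by
    unfold rayWall rayForm; fun_prop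
  obtain ⟨u, hu, hu0⟩ := intermediate_value_Icc' htt hc.continuousOn ⟨h'.le, h.le⟩
  refine ⟨u, lt_of_le_of_ne hu.1 ?_, lt_of_le_of_ne hu.2 ?_, hu0⟩
  · rintro rfl; exact h.ne' hu0
  · rintro rfl; exact h'.ne hu0

theorem mem_tessellationSide_of_rayWall {θ : ℝ} {M : GL (Fin 2) ℝ} (hM : M ∈ reflectionGroup)
    {i : Fin 8} {t : ℝ} (h : rayWall θ M i t = 0) : teichRay θ t ∈ tessellationSide i := by
  obtain ⟨K, hK, hw⟩ := wall_teichRay θ t M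
  have h0 : wall i (rightAct (teichRay θ t) M) = 0 := by
    have := hw i
    rw [h] at this
    exact (mul_eq_zero.1 this).resolve_right hK.ne'
  refine ⟨M⁻¹, inv_mem hM, _, mem_idealSide_iff_wall.2 h0, ?_⟩
  simp only
  rw [rightAct_rightAct, mul_inv_cancel, rightAct_one]

theorem gammaSide_mem (i : Fin 8) : gammaSide i ∈ reflectionGroup := Subgroup.subset_closure ⟨i, rfl⟩

theorem rayWall_eq_zero_of_mem {θ : ℝ} {M : GL (Fin 2) ℝ} (hM : M ∈ reflectionGroup) {t : ℝ}
    (hz : ∀ i, 0 ≤ rayWall θ M i t) {l : Fin 8} (h : teichRay θ t ∈ tessellationSide l) :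
    rayWall θ M l t = 0 := by
  obtain ⟨K, hK, hw⟩ := wall_teichRay θ t M
  have h0 : ∀ i, 0 ≤ wall i (rightAct (teichRay θ t) M) := fun i => by
    have := hz i
    rw [← hw i] at this
    exact nonneg_of_mul_nonneg_left this hK
  obtain ⟨g, hg, y, hy, hgy⟩ := h
  rw [← hw l, wall_eq_zero_of_mem_tessellationSide h0, zero_mul]
  refine ⟨g * M, mul_mem hg hM, y, hy, ?_⟩
  simp only at hgy ⊢
  rw [← hgy, rightAct_rightAct]

/-- The state in which a Teichmüller ray enters the octagon `𝒪 M⁻¹` of the tessellation. -/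
def Enters (θ : ℝ) (M : GL (Fin 2) ℝ) (t : ℝ) : Prop :=
  ∀ i, 0 ≤ rayWall θ M i t ∧ (rayWall θ M i t = 0 → 0 < sideSign θ M i)

theorem enters_one (θ : ℝ) (i : Fin 8) : 0 < rayWall θ 1 i 0 := by
  obtain ⟨K, hK, hw⟩ := wall_teichRay θ 0 1
  rw [← hw]
  refine mul_pos ?_ hK
  have : teichRay θ 0 = UpperHalfPlane.I := by
    have : teichFlow 0 = 1 := by
      ext i j
      fin_cases i <;> fin_cases j <;> simp [teichFlow]
    rw [teichRay, diskPoint, teichFlowDir, this, mul_one, inv_mul_cancel, rightAct_one]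
  rw [rightAct_one, this, wall, form_I]
  have hb := sqrt_two_bounds
  fin_cases i <;> simp [negVec, fixVec, dotProduct, Fin.sum_univ_two] <;> linarith

/-- A wall vanishing at `T` has positive slope, so before `T'` nothing can become negative without
an earlier crossing. Wall `l` falls to 0 at `T'`, hence has negative slope; the reflection in it
fixes the crossing point, reverses this slope, and the other seven walls are positive there. `hne`
excludes a crossing at the starting time. -/
theorem Enters.next {θ : ℝ} {M : GL (Fin 2) ℝ} (hM : M ∈ reflectionGroup) {T T' : ℝ}
    (hT : Enters θ M T) (hTT : T ≤ T') {l : Fin 8} (hne : T = T' → ∀ i, 0 < rayWall θ M i T)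
    (hl : teichRay θ T' ∈ tessellationSide l)
    (hno : ∀ u, T < u → u < T' → ∀ i, teichRay θ u ∉ tessellationSide i) :
    sideSign θ M l < 0 ∧ Enters θ (M * gammaSide l) T' := by
  have hmono : ∀ {t t' : ℝ}, t < t' → 0 < Real.exp (2 * t') - Real.exp (2 * t) := fun h =>
    sub_pos.2 (Real.exp_lt_exp.2 (by linarith))
  have h0 : ∀ i, 0 ≤ rayWall θ M i T' := by
    intro i
    by_contra! hc
    rcases (hT i).1.eq_or_lt with h | h
    · have h1 := (hT i).2 h.symm
      have h2 := rayWall_sub θ M i T T'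
      rcases hTT.eq_or_lt with h3 | h3
      · subst h3; linarith
      · have := mul_pos (hmono h3) h1
        linarith
    · obtain ⟨u, h1, h2, h3⟩ := exists_rayWall_eq_zero hTT h hc
      exact hno u h1 h2 i (mem_tessellationSide_of_rayWall hM h3)
  have hl0 := rayWall_eq_zero_of_mem hM h0 hl
  have hlt : T < T' := by
    refine lt_of_le_of_ne hTT fun h => ?_
    have := hne h l
    rw [h, hl0] at this
    exact this.false
  have hs : sideSign θ M l < 0 := by
    have h2 := rayWall_sub θ M l T T'
    rw [hl0] at h2
    have h3 := hmono hlt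
    rcases (hT l).1.eq_or_lt with h | h
    · have := mul_pos h3 ((hT l).2 h.symm)
      linarith
    · by_contra! hc
      have := mul_nonneg h3.le hc
      linarith
  refine ⟨hs, fun i => ?_⟩
  by_cases hi : i = l
  · subst hi
    rw [rayWall_mul_gammaSide, sideSign_mul_gammaSide, hl0]
    exact ⟨by simp, fun _ => by linarith⟩
  · obtain ⟨K, hK, hw⟩ := wall_teichRay θ T' M
    obtain ⟨K', hK', hw'⟩ := wall_teichRay θ T' (M * gammaSide l)
    have hwl : wall l (rightAct (teichRay θ T') M) = 0 := by
      have := hw l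
      rw [hl0] at this
      exact (mul_eq_zero.1 this).resolve_right hK.ne'
    have hpos : 0 < rayWall θ (M * gammaSide l) i T' := by
      rw [← hw', ← rightAct_rightAct, rightAct_gammaSide_of_wall hwl]
      exact mul_pos (wall_pos_of_wall_nonpos hwl.le (Ne.symm hi)) hK'
    exact ⟨hpos.le, fun h => absurd h hpos.ne'⟩

theorem gammaProd_succ {k : ℕ} (s : Fin (k + 1) → Fin 8) :
    gammaProd s = gammaProd (fun j => s j.castSucc) * gammaSide (s (Fin.last k)) := by
  rw [gammaProd, gammaProd, List.ofFn_succ', List.prod_concat]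

theorem gammaProd_mem {k : ℕ} (s : Fin k → Fin 8) : gammaProd s ∈ reflectionGroup := by
  refine list_prod_mem fun x hx => ?_
  obtain ⟨j, rfl⟩ := List.mem_ofFn.1 hx
  exact gammaSide_mem _

/-- The times `t` are the times of the first crossings of a Teichmüller ray with sides of the
tessellation, and `s` lists the labels of these sides. -/
def IsCuttingTimes (θ : ℝ) {k : ℕ} (s : Fin k → Fin 8) (t : Fin k → ℝ) : Prop :=
  StrictMono t ∧ (∀ j, 0 ≤ t j ∧ teichRay θ (t j) ∈ tessellationSide (s j)) ∧
    ∀ u, 0 ≤ u → (∃ i, teichRay θ u ∈ tessellationSide i) → (∃ j, u = t j) ∨ ∀ j, t j < u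

theorem IsCuttingTimes.init {θ : ℝ} {k : ℕ} {s : Fin (k + 1) → Fin 8} {t : Fin (k + 1) → ℝ}
    (h : IsCuttingTimes θ s t) :
    IsCuttingTimes θ (fun j : Fin k => s j.castSucc) (fun j => t j.castSucc) := by
  refine ⟨h.1.comp Fin.strictMono_castSucc, fun j => h.2.1 _, fun u hu hi => ?_⟩
  rcases h.2.2 u hu hi with ⟨j, rfl⟩ | h'
  · rcases Fin.eq_castSucc_or_eq_last j with ⟨j, rfl⟩ | rfl
    · exact Or.inl ⟨j, rfl⟩
    · exact Or.inr fun j => h.1 (Fin.castSucc_lt_last j)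
  · exact Or.inr fun j => h' _

theorem IsCuttingTimes.step {θ : ℝ} {k : ℕ} {s : Fin (k + 1) → Fin 8} {t : Fin (k + 1) → ℝ}
    (h : IsCuttingTimes θ s t) {T : ℝ} (hT0 : 0 ≤ T) (hT : ∀ j : Fin k, t j.castSucc ≤ T)
    (hTt : (∃ j : Fin k, T = t j.castSucc) ∨
      T = 0 ∧ ∀ i, 0 < rayWall θ (gammaProd fun j : Fin k => s j.castSucc) i T)
    (hE : Enters θ (gammaProd fun j : Fin k => s j.castSucc) T) :
    sideSign θ (gammaProd fun j : Fin k => s j.castSucc) (s (Fin.last k)) < 0 ∧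
      Enters θ (gammaProd s) (t (Fin.last k)) := by
  rw [gammaProd_succ s]
  refine hE.next (gammaProd_mem _) ?_ ?_ (h.2.1 _).2 fun u h1 h2 i hi => ?_
  · rcases hTt with ⟨j, rfl⟩ | ⟨rfl, -⟩
    · exact (h.1 (Fin.castSucc_lt_last j)).le
    · exact (h.2.1 _).1
  · intro hTT
    rcases hTt with ⟨j, rfl⟩ | ⟨-, h'⟩
    · exact absurd hTT (h.1 (Fin.castSucc_lt_last j)).ne
    · exact h'
  · rcases h.2.2 u (hT0.trans h1.le) ⟨i, hi⟩ with ⟨j, rfl⟩ | h'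
    · rcases Fin.eq_castSucc_or_eq_last j with ⟨j, rfl⟩ | rfl
      · exact absurd h1 (hT j).not_gt
      · exact h2.false
    · exact absurd (h' (Fin.last k)) h2.not_gt

/-- `T` is the last crossing time, or 0 if there is none; in the latter case the strict positivity
makes the first crossing happen after time 0. -/
theorem IsCuttingTimes.exists_enters {θ : ℝ} {k : ℕ} {s : Fin k → Fin 8} {t : Fin k → ℝ}
    (h : IsCuttingTimes θ s t) : ∃ T, 0 ≤ T ∧ (∀ j, t j ≤ T) ∧
      ((∃ j, T = t j) ∨ T = 0 ∧ ∀ i, 0 < rayWall θ (gammaProd s) i T) ∧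
      Enters θ (gammaProd s) T := by
  induction k with
  | zero =>
    have e : gammaProd s = 1 := by simp [gammaProd]
    rw [e]
    exact ⟨0, le_rfl, fun j => j.elim0, Or.inr ⟨rfl, enters_one θ⟩,
      fun i => ⟨(enters_one θ i).le, fun h => absurd h (enters_one θ i).ne'⟩⟩
  | succ k ih =>
    obtain ⟨T, h0, h1, h2, h3⟩ := ih h.init
    exact ⟨t (Fin.last k), (h.2.1 _).1, fun j => h.1.monotone (Fin.le_last j), Or.inl ⟨_, rfl⟩,
      (h.step h0 h1 h2 h3).2⟩

theorem TeichCuttingStartsWith.init {θ : ℝ} {k : ℕ} {s : Fin (k + 1) → Fin 8}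
    (h : TeichCuttingStartsWith θ s) : TeichCuttingStartsWith θ fun j : Fin k => s j.castSucc := by
  obtain ⟨t, ht⟩ := h
  exact ⟨_, IsCuttingTimes.init ht⟩

theorem TeichCuttingStartsWith.sideSign_neg {θ : ℝ} {k : ℕ} {s : Fin (k + 1) → Fin 8}
    (h : TeichCuttingStartsWith θ s) :
    sideSign θ (gammaProd fun j : Fin k => s j.castSucc) (s (Fin.last k)) < 0 := by
  obtain ⟨t, ht⟩ := h
  obtain ⟨T, h0, h1, h2, h3⟩ := (IsCuttingTimes.init ht).exists_enters
  exact (IsCuttingTimes.step ht h0 h1 h2 h3).1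

theorem cross_mulVec (M : Matrix (Fin 2) (Fin 2) ℝ) (u v : Plane) :
    cross (M *ᵥ u) (M *ᵥ v) = M.det * cross u v := by
  simp only [cross, Matrix.mulVec, dotProduct, Fin.sum_univ_two, Matrix.det_fin_two]; ring

/-- A crossing with label `i` decides the sector of the renormalized direction. -/
theorem inSector_of_sideSign {θ : ℝ} {M : GL (Fin 2) ℝ} {i : Fin 8} (h : sideSign θ M i < 0)
    {u : Plane} (hu : (M : Matrix (Fin 2) (Fin 2) ℝ) *ᵥ u = ![Real.cos θ, Real.sin θ]) :
    InSector (nuMatrix i *ᵥ u) ∨ InSector (-(nuMatrix i *ᵥ u)) := by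
  obtain ⟨c, hc, h1⟩ := nu_mulVec_negVec i
  have h2 := nu_mulVec_fixVec i
  have hdet := nuMatrix_det_ne_zero i
  have hM := M.det.ne_zero
  rw [sideSign, ← hu, cross_mulVec, cross_mulVec] at h
  have e1 := cross_mulVec (nuMatrix i) u (negVec i)
  have e2 := cross_mulVec (nuMatrix i) u (fixVec i)
  rw [h1] at e1
  rw [h2] at e2
  generalize nuMatrix i *ᵥ u = e at *
  simp only [cross, Pi.smul_apply, smul_eq_mul, cons_val_zero, cons_val_one] at e1 e2 h
  -- Determinants enter squared, so `sideSign` is negative exactly when this product is positive,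
  -- that is, on the double sector ±(0, π/8).
  have h3 : 0 < e 1 * (e 0 - e 1 * (1 + √2)) := by
    have h4 : cross u (negVec i) * cross u (fixVec i) < 0 := by
      have h5 : (M : Matrix (Fin 2) (Fin 2) ℝ).det ^ 2 * (cross u (negVec i) * cross u (fixVec i))
        < 0 := by simp only [cross]; linarith
      by_contra! hc
      have := mul_nonneg (sq_nonneg (M : Matrix (Fin 2) (Fin 2) ℝ).det) hc
      linarith
    have h6 : (nuMatrix i).det ^ 2 * (cross u (negVec i) * cross u (fixVec i)) < 0 :=
      mul_neg_of_pos_of_neg (by positivity) h4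
    have h7 : (nuMatrix i).det ^ 2 * (cross u (negVec i) * cross u (fixVec i)) =
        -(c * (e 1 * (e 0 - e 1 * (1 + √2)))) := by
      simp only [cross]
      linear_combination (-(e 0 - e 1 * (1 + √2))) * e1 -
        (nuMatrix i).det * (u 0 * negVec i 1 - u 1 * negVec i 0) * e2
    rw [h7] at h6
    have h8 : 0 < c * (e 1 * (e 0 - e 1 * (1 + √2))) := by linarith
    exact pos_of_mul_pos_right h8 hc.le
  rcases pos_and_pos_or_neg_and_neg_of_mul_pos h3 with ⟨h5, h6⟩ | ⟨h5, h6⟩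
  · exact Or.inl ⟨h5, by linarith⟩
  · refine Or.inr ⟨by simpa using h5, ?_⟩
    simp only [Pi.neg_apply]
    linarith

/-! ### Renormalization -/

theorem IsCuttingSequence.congr {sides sides' : Letter → Set OctagonSurface}
    {τ τ' : ℝ → OctagonSurface} {w : ℤ → Letter} (h : ∀ t L, τ' t ∈ sides' L ↔ τ t ∈ sides L)
    (hw : IsCuttingSequence sides τ w) : IsCuttingSequence sides' τ' w := by
  obtain ⟨t, ht, hr, hl⟩ := hw
  exact ⟨t, ht, by simpa only [h] using hr, fun n => (h _ _).2 (hl n)⟩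

theorem isCuttingSequence_comp_iff {sides sides' : Letter → Set OctagonSurface}
    {τ τ' : ℝ → OctagonSurface} {w : ℤ → Letter} {π : Letter → Letter} (hπ : Function.Injective π)
    (h : ∀ t L, τ' t ∈ sides' (π L) ↔ τ t ∈ sides L) :
    IsCuttingSequence sides' τ' (fun n => π (w n)) ↔ IsCuttingSequence sides τ w := by
  have hs := Finite.surjective_of_injective hπ
  have e : ∀ s, (∃ L, τ' s ∈ sides' L) ↔ ∃ L, τ s ∈ sides L := fun s => by
    rw [hs.exists]; simp only [h]
  unfold IsCuttingSequence
  simp only [h, e]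

theorem isAffineAutomorphism_refl : IsAffineAutomorphism (Homeomorph.refl OctagonSurface) 1 := by
  refine ⟨Set.image_id _, fun p _ => ⟨1, one_pos, fun u q _ h => ?_⟩⟩
  rw [Units.val_one, one_mulVec]
  exact h

/-- Up to the sign, each isometry `ν_i` maps directions in the open sector
`(i π / 8, (i + 1) π / 8)` to the open sector `(0, π / 8)`. -/
theorem exists_derived_of_sector {i : Fin 8} {v : Plane}
    (hv : InSector (nuMatrix i *ᵥ v) ∨ InSector (-(nuMatrix i *ᵥ v))) {τ : ℝ → OctagonSurface}
    (hτ : IsLinearTrajectory v τ) {w : ℤ → Letter} (hw : IsCuttingSequence labelledSide τ w) :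
    ∃ Ψ : OctagonSurface ≃ₜ OctagonSurface, IsAffineAutomorphism Ψ (gammaSide i) ∧
      ∃ w', IsDerived w w' ∧ IsCuttingSequence (inducedSide Ψ) τ w' := by
  obtain ⟨Φ, N, hΦ, hN, hL, hvN⟩ : ∃ (Φ : OctagonSurface ≃ₜ OctagonSurface) (N : GL (Fin 2) ℝ),
      IsAffineAutomorphism Φ N ∧ N⁻¹ * (gammaGL * N) = gammaSide i ∧
      (∀ p L, Φ p ∈ labelledSide (relabel i L) ↔ p ∈ labelledSide L) ∧
      InSector ((N : Matrix (Fin 2) (Fin 2) ℝ) *ᵥ v) := by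
    obtain ⟨Φ, hΦ, hL⟩ := exists_nu_automorphism i
    rcases hv with hv | hv
    · exact ⟨Φ, _, hΦ, (mul_assoc _ _ _).symm, hL, hv⟩
    -- Since -I is central and preserves all labels, replacing ν_i by -ν_i changes neither the
    -- conjugate of γ nor the words.
    · obtain ⟨Φ', hΦ', hL'⟩ := exists_neg_automorphism
      refine ⟨_, _, hΦ.trans hΦ', ?_, fun p L => (hL' _ _).trans (hL _ _), ?_⟩
      · rw [gammaSide]; simp [mul_assoc]
      · rw [neg_one_mul, Units.val_neg, Matrix.neg_mulVec]
        exact hv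
  have hinj := relabel_injective i
  obtain ⟨hedge, w', ⟨-, e, he, hr, hwe⟩, hc⟩ := exists_derived_of_inSector hvN
    (hΦ.linearTrajectory hτ) ((isCuttingSequence_comp_iff hinj fun t L => hL (τ t) L).2 hw)
  refine ⟨_, hN ▸ (hΦ.trans isAffineAutomorphism_involution).trans hΦ.symm, fun n => w (e n),
    ⟨⟨i, hedge⟩, e, he, ?_, fun n => rfl⟩, ?_⟩
  · rw [hr]
    simp only [hinj.eq_iff]
  · obtain rfl : w' = fun n => relabel i (w (e n)) := funext hwe
    refine (isCuttingSequence_comp_iff hinj fun t L => ?_).1 hc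
    have h1 : ∀ L, Φ '' labelledSide L = labelledSide (relabel i L) := by
      intro L
      ext p
      constructor
      · rintro ⟨q, hq, rfl⟩
        exact (hL q L).2 hq
      · intro hp
        refine ⟨Φ.symm p, ?_, Φ.apply_symm_apply p⟩
        rw [← hL, Φ.apply_symm_apply]; exact hp
    rw [inducedSide, inducedSide, ← h1]
    constructor
    · rintro ⟨_, ⟨q, hq, rfl⟩, h⟩
      exact ⟨q, hq, by simp [h]⟩
    · rintro ⟨q, hq, h⟩
      exact ⟨_, ⟨q, hq, rfl⟩, by simp [← h]⟩

theorem exists_renormalization {θ c : ℝ} (hc : 0 < c) {τ : ℝ → OctagonSurface}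
    (hτ : IsLinearTrajectory (c • ![Real.cos θ, Real.sin θ]) τ)
    {w : ℤ → Letter} (hw : IsCuttingSequence labelledSide τ w)
    {k : ℕ} {s : Fin k → Fin 8} (hs : TeichCuttingStartsWith θ s) :
    ∃ Ψ : OctagonSurface ≃ₜ OctagonSurface, IsAffineAutomorphism Ψ (gammaProd s) ∧
      ∃ v, IsIteratedDerived k w v ∧ IsCuttingSequence (inducedSide Ψ) τ v := by
  induction k with
  | zero =>
    refine ⟨Homeomorph.refl _, ?_, w, ⟨0, fun n => by rw [add_zero]⟩, ?_⟩
    · rw [show gammaProd s = 1 by simp [gammaProd]]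
      exact isAffineAutomorphism_refl
    · refine hw.congr fun t L => ?_
      rw [inducedSide]
      simp
  | succ k ih =>
    obtain ⟨Ψ, hΨ, v, hv, hvc⟩ := ih hs.init
    -- The next label names the side through which the ray leaves the octagon 𝒪(γ^(k))⁻¹, and
    -- thereby the sector of the pulled back direction.
    have hsec := inSector_of_sideSign hs.sideSign_neg
      (u := (((gammaProd fun j : Fin k => s j.castSucc)⁻¹ : GL (Fin 2) ℝ) :
        Matrix (Fin 2) (Fin 2) ℝ) *ᵥ ![Real.cos θ, Real.sin θ])
      (by rw [Matrix.mulVec_mulVec, Units.mul_inv, Matrix.one_mulVec])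
    have hscale : ∀ {u : Plane}, InSector u → InSector (c • u) := fun {u} h => by
      refine ⟨mul_pos hc h.1, ?_⟩
      have := mul_lt_mul_of_pos_left h.2 hc
      simp only [Pi.smul_apply, smul_eq_mul]
      linarith
    have hτ' := hΨ.symm.linearTrajectory hτ
    rw [Matrix.mulVec_smul] at hτ'
    obtain ⟨Ψ', hΨ', v', hd, hc'⟩ := exists_derived_of_sector (i := s (Fin.last k)) (by
      rw [Matrix.mulVec_smul, ← smul_neg]
      exact hsec.imp hscale hscale) hτ'
      (hvc.congr fun t L => (Set.ext_iff.1 (Ψ.toEquiv.image_eq_preimage_symm (labelledSide L)) _).symm)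
    refine ⟨Ψ'.trans Ψ, ?_, v', ⟨v, hv, hd⟩, hc'.congr fun t L => ?_⟩
    · rw [gammaProd_succ]
      exact hΨ'.trans hΨ
    · constructor
      · rintro ⟨q, hq, h⟩
        exact ⟨q, hq, by rw [← h]; simp⟩
      · rintro ⟨q, hq, h⟩
        exact ⟨q, hq, by simp [h]⟩

theorem inducedSide_unique {Ψ : OctagonSurface ≃ₜ OctagonSurface} {M : GL (Fin 2) ℝ}
    (hΨ : IsAffineAutomorphism Ψ M) {p : OctagonSurface} (hp : p ∉ singularSet) {L L' : Letter}
    (h : p ∈ inducedSide Ψ L) (h' : p ∈ inducedSide Ψ L') : L = L' := by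
  obtain ⟨q, hq, rfl⟩ := h
  obtain ⟨q', hq', he⟩ := h'
  obtain rfl := Ψ.injective he
  exact label_unique (fun h => hp (hΨ.apply_mem_iff.2 h)) hq hq'

end OctagonFlow

theorem proposition3p1
    (θ c : ℝ) (hc : 0 < c) (τ : ℝ → OctagonSurface)
    (hτ : IsLinearTrajectory (c • ![Real.cos θ, Real.sin θ]) τ)
    (w : ℤ → Letter) (hw : IsCuttingSequence labelledSide τ w)
    (k : ℕ) (s : Fin k → Fin 8) (hs : TeichCuttingStartsWith θ s) :
    (∃ v : ℤ → Letter, IsIteratedDerived k w v) ∧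
    (∃! Ψ : OctagonSurface ≃ₜ OctagonSurface, IsAffineAutomorphism Ψ (gammaProd s)) ∧
    ∀ Ψ : OctagonSurface ≃ₜ OctagonSurface, IsAffineAutomorphism Ψ (gammaProd s) →
      ∀ v : ℤ → Letter,
        IsIteratedDerived k w v ↔ IsCuttingSequence (inducedSide Ψ) τ v := by
  obtain ⟨Ψ, hΨ, v, hv, hvc⟩ := exists_renormalization hc hτ hw hs
  refine ⟨⟨v, hv⟩, ⟨Ψ, hΨ, fun Φ hΦ => hΦ.unique hΨ⟩, fun Φ hΦ u => ?_⟩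
  obtain rfl := hΦ.unique hΨ
  -- Both properties determine the word up to a shift and are invariant under shifts, so one common
  -- word is enough.
  constructor
  · intro hu
    obtain ⟨m, hm⟩ := hu.exists_shift hv
    rw [funext hm]
    exact hvc.shift m
  · intro hu
    obtain ⟨m, hm⟩ := hu.exists_shift
      (fun t _ _ h h' => inducedSide_unique hΦ (hτ.1 t) h h') hvc
    rw [funext hm]
    exact hv.shift m
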